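/- For $n\ge 1$ consider the hypercube $V_n=\{0,1\}^n\subset\mathbb R^n$ with its set of directed edges $E_n=\{(v,v+e_j): v,v+e_j\in V_n,\ 1\le j\le n\}$, where $e_1,\dots,e_n$ is the standard basis, and let $(\xi_e)_{e\in E_n}$ be independent standard exponential random variables. Write $\boldsymbol 0=(0,\dots,0)$, $\boldsymbol 1=(1,\dots,1)$, let $d$ be the Hamming distance, and let $[x]_l=(x_l,x_{l+1})$ denote the $l$-th edge of a path $x$. Let $\mathcal V_{r,n}$ be the set of pairs $(x,y)\in V_n^{r+1}\times V_n^{r+1}$ with $x_1=\boldsymbol 0$, $d(x_{r+1},\boldsymbol 0)=r$, $d(y_1,\boldsymbol 1)=r$, $y_{r+1}=\boldsymbol 1$, $y_1-x_{r+1}\in V_n$, and $(x_i,x_{i+1}),(y_i,y_{i+1})\in E_n$ for all $1\le i\le r$. For every finite (possibly empty) sequence $(\pi_1,\dots,\pi_{i-1})$ of natural numbers let $(\eta_{\pi_1\dots\pi_{i-1}\pi_i})_{\pi_i\in\mathbb N}$ and $(\tilde\eta_{\pi_1\dots\pi_{i-1}\pi_i})_{\pi_i\in\mathbb N}$ be (enumerations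 of) Poisson point processes on $\mathbb R$ with intensity $\mathbf 1_{\mathbb R^+}dx$, all of these sequences being independent, and set $$Z_r=\sum_{\pi\in\mathbb N^r}\exp\Big(-\sum_{j=1}^r\eta_{\pi_1\pi_2\dots\pi_j}\Big),\qquad \widetilde Z_r=\sum_{\pi\in\mathbb N^r}\exp\Big(-\sum_{j=1}^r\tilde\eta_{\pi_1\pi_2\dots\pi_j}\Big).$$ For every $r$ these series converge almost surely, and the following hold. 1. ($n$-convergence) For every fixed $r$, as $n\to\infty$, $$\sum_{(x,y)\in\mathcal V_{r,n}}\exp\Big(-n\sum_{l=1}^r\big(\xi_{[x]_l}+\xi_{[y]_l}\big)\Big)\longrightarrow Z_r\,\widetilde Z_r\quad\text{weakly.}$$ 2. ($r$-convergence) As $r\to\infty$, the pair $(Z_r,\widetilde Z_r)$ converges weakly to a pair of independent standard exponential random variables. -/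

import Mathlib

open MeasureTheory ProbabilityTheory Filter Topology

/-- The vertices of the `n`-dimensional hypercube. -/
abbrev Vertex (n : ℕ) : Type := Fin n → Bool

namespace Vertex

/-- The embedding of the hypercube into `ℝⁿ`, with image `{0,1}ⁿ`. -/
def embed {n : ℕ} (v : Vertex n) : Fin n → ℝ := fun i => if v i = true then 1 else 0

/-- The vertex `(0, …, 0)`. -/
def zero (n : ℕ) : Vertex n := fun _ => false

/-- The vertex `(1, …, 1)`. -/
def one (n : ℕ) : Vertex n := fun _ => true

end Vertex

/-- `(u, v)` is a directed edge of the hypercube: `v = u + e_j` for some standard basis vector. -/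
def IsEdge {n : ℕ} (u v : Vertex n) : Prop :=
  ∃ j : Fin n, v.embed = u.embed + Pi.single j (1 : ℝ)

/-- The directed edges of the hypercube. -/
abbrev Edge (n : ℕ) : Type := {e : Vertex n × Vertex n // IsEdge e.1 e.2}

/-- The pair `(x, y)` consists of a directed path `x` with `r` steps starting at `0` and a directed
path `y` with `r` steps ending at `1`, such that the difference of the first vertex of `y` and the
last vertex of `x` is again a vertex of the hypercube. -/
structure IsPathPair {r n : ℕ} (x y : Fin (r + 1) → Vertex n) : Prop where
  x_start : x 0 = Vertex.zero n
  x_dist : hammingDist (x (Fin.last r)) (Vertex.zero n) = r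
  y_dist : hammingDist (y 0) (Vertex.one n) = r
  y_end : y (Fin.last r) = Vertex.one n
  diff_mem : ∃ w : Vertex n, (y 0).embed - (x (Fin.last r)).embed = w.embed
  x_edge : ∀ l : Fin r, IsEdge (x l.castSucc) (x l.succ)
  y_edge : ∀ l : Fin r, IsEdge (y l.castSucc) (y l.succ)

/-- The set of pairs of paths leading `r` steps away from `0` and leading to `1` in `r` steps which
can be part of one directed path from `0` to `1`. -/
abbrev PathPair (r n : ℕ) : Type :=
  {p : (Fin (r + 1) → Vertex n) × (Fin (r + 1) → Vertex n) // IsPathPair p.1 p.2}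

namespace PathPair

variable {r n : ℕ}

/-- The `l`-th edge `[x]_l` of the first path of the pair. -/
def xEdge (p : PathPair r n) (l : Fin r) : Edge n :=
  ⟨(p.1.1 l.castSucc, p.1.1 l.succ), p.2.x_edge l⟩

/-- The `l`-th edge `[y]_l` of the second path of the pair. -/
def yEdge (p : PathPair r n) (l : Fin r) : Edge n :=
  ⟨(p.1.2 l.castSucc, p.1.2 l.succ), p.2.y_edge l⟩

end PathPair

open scoped Classical in
/-- `∑_{(x,y)} exp (-n ∑_{l ≤ r} (ξ_{[x]_l} + ξ_{[y]_l}))`, the sum being over all the pairs of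
paths in `PathPair r n`, for given edge weights `ξ`. -/
noncomputable def pathPairSum (r n : ℕ) (ξ : Edge n → ℝ) : ℝ :=
  ∑ p : PathPair r n, Real.exp (-(n : ℝ) * ∑ l : Fin r, (ξ (p.xEdge l) + ξ (p.yEdge l)))

/-- The number of indices `i` such that the point `η i ω` lies in `A`, that is, the value at `A`
of the random measure `∑ i, δ_{η i}`. -/
noncomputable def pointCount {Ω E : Type*} [MeasurableSpace E] (η : ℕ → Ω → E) (A : Set E)
    (ω : Ω) : ENNReal :=
  Measure.sum (fun i => Measure.dirac (η i ω)) A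

/-- The random points `η 0, η 1, …` are the points, listed with multiplicity and in an arbitrary
(random) order, of a Poisson point process with intensity measure `Λ` (of infinite total mass):
the number of points in a measurable set `A` with `Λ A < ∞` is Poisson distributed with parameter
`Λ A`, and the numbers of points in finitely many disjoint measurable sets are independent. -/
structure IsPoissonPointProcess {Ω E : Type*} [MeasurableSpace Ω] [MeasurableSpace E]
    (η : ℕ → Ω → E) (Λ : Measure E) (P : Measure Ω) : Prop where
  measurable : ∀ i, Measurable (η i)
  law_count : ∀ A : Set E, MeasurableSet A → Λ A ≠ ⊤ →
    HasLaw (pointCount η A)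
      ((poissonMeasure (Λ A).toNNReal).map (fun k : ℕ => (k : ENNReal))) P
  indep_count : ∀ (m : ℕ) (A : Fin m → Set E), (∀ i, MeasurableSet (A i)) →
    (∀ i j, i ≠ j → Disjoint (A i) (A j)) → iIndepFun (fun i => pointCount η (A i)) P

/-- The summand `exp (-∑_{j ≤ r} η_{π_1 … π_j})`, where `η p i` stands for `η_{p_1 … p_k i}` if
`p = [p_1, …, p_k]`. -/
noncomputable def cascadeTerm {Ω : Type*} (η : List ℕ → ℕ → Ω → ℝ) (r : ℕ) (ω : Ω)
    (π : Fin r → ℕ) : ℝ :=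
  Real.exp (-∑ j : Fin r, η ((List.ofFn π).take j) (π j) ω)

/-- `Z_r = ∑_{π ∈ ℕ^r} exp (-∑_{j ≤ r} η_{π_1 … π_j})`. -/
noncomputable def cascadeSum {Ω : Type*} (η : List ℕ → ℕ → Ω → ℝ) (r : ℕ) (ω : Ω) : ℝ :=
  ∑' π : Fin r → ℕ, cascadeTerm η r ω π

instance isProbabilityMeasure_expMeasure_one : IsProbabilityMeasure (expMeasure 1) :=
  isProbabilityMeasure_expMeasure one_pos

/-! Everything rests on the Laplace exponents φ_0(s) = |s|, φ_{m+1}(s) = ∫_0^∞ (1 - exp(-φ_m(s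
e^{-x}))) dx (`laplaceExponent`). By the Laplace functional of a Poisson process, averaging over the
last generation of a cascade lowers its depth by one and turns φ_m into φ_{m+1}; hence E exp(-t Z_r)
= exp(-φ_r(t)) (`integral_exp_neg_cascadeSum`). The function log(1 + t) is a fixed point of the
recursion, and φ_m(t) is within 2^{-m} t² of it because ∫ e^{-2x} dx = 1/2
(`abs_laplaceExponent_sub_log_le`). So E exp(-t Z_r) tends to 1/(1 + t), the transform of the
standard exponential law, and independence of the two cascades gives the pair.

On the cube, let W_k(v) be the sum over directed paths of length k from 0 to v of the products of
the weights exp(-n ξ_e). The same recursion holds up to O(1/n) for fixed k and t: E exp(-∑_v φ_m(t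
W_{k+1}(v))) is close to E exp(-∑_v φ_{m+1}(t W_k(v))). First, φ_m is almost additive, with defect
at most ab, so the different last edges into a vertex may be separated at the cost of cross terms
whose expectation is O(1/n) (`integral_cross_le`). Second, a vertex of level k has n - k fresh
outgoing edges, and each satisfies 1 - E exp(-φ_m(s exp(-n ξ))) ≈ φ_{m+1}(s)/n. Iterating gives
`abs_integral_exp_neg_sub_le`, and convergence of Laplace transforms together with a bound on the
means gives weak convergence.

In the pair sum, reversal and complementation turn the second path into one starting at 0. The
admissibility condition says that the two end sets are disjoint; dropping it changes the sum by at
most r²/n in L¹ once n ≥ 2r. Then the two factors use different edges, hence are independent, and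
the product of their limits results. -/

/-! ### Weak convergence on the half-line from Laplace transforms. -/

section LaplaceTransform

open scoped NNReal ENNReal BoundedContinuousFunction Polynomial

/-- The bounded continuous function `x ↦ exp (-x)` on the nonnegative reals. -/
noncomputable def expNegBCF : ℝ≥0 →ᵇ ℝ :=
  BoundedContinuousFunction.ofNormedAddCommGroup (fun x : ℝ≥0 => Real.exp (-(x : ℝ)))
    (by fun_prop) 1 (fun x => by
      rw [Real.norm_eq_abs, Real.abs_exp]
      exact Real.exp_le_one_iff.2 (by simp))

/-- The polynomials in `exp (-x)`. -/
noncomputable def expNegSubalgebra : StarSubalgebra ℝ (ℝ≥0 →ᵇ ℝ) where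
  toSubalgebra := (Polynomial.aeval expNegBCF).range
  star_mem' := by
    intro a ha
    have : star a = a := by ext x; simp
    simpa [this] using ha

lemma aeval_expNegBCF_apply (p : ℝ[X]) (x : ℝ≥0) :
    (Polynomial.aeval expNegBCF p) x = ∑ k ∈ p.support, p.coeff k * Real.exp (-(k * (x : ℝ))) := by
  rw [Polynomial.aeval_def, Polynomial.eval₂_eq_sum, Polynomial.sum]
  simp only [BoundedContinuousFunction.coe_sum, Finset.sum_apply]
  refine Finset.sum_congr rfl fun k _ => ?_
  rw [← Algebra.smul_def]
  simp [expNegBCF, ← Real.exp_nat_mul]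

/-- Markov's inequality: the mass outside the compact interval `[0, M]` is at most `C / M`. -/
lemma isTightMeasureSet_of_lintegral_le {ι : Type*} (μ : ι → Measure ℝ≥0) (C : ℝ≥0)
    (h : ∀ i, ∫⁻ x, (x : ℝ≥0∞) ∂(μ i) ≤ C) : IsTightMeasureSet (Set.range μ) := by
  rw [isTightMeasureSet_iff_exists_isCompact_measure_compl_le]
  intro ε hε
  obtain rfl | hε' := eq_or_ne ε ∞
  · exact ⟨∅, isCompact_empty, fun _ _ => le_top⟩
  obtain ⟨M, hM0, hM⟩ : ∃ M : ℝ≥0, 0 < M ∧ (C : ℝ≥0∞) / M ≤ ε := by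
    lift ε to ℝ≥0 using hε'
    have hε0 : 0 < ε := by exact_mod_cast hε
    -- `C + 1` instead of `C` keeps `M` positive when `C = 0`.
    refine ⟨(C + 1) / ε, by positivity, ?_⟩
    rw [← ENNReal.coe_div (by positivity)]
    norm_cast
    rw [div_div_eq_mul_div, div_le_iff₀ (by positivity), mul_comm]
    gcongr
    simp
  refine ⟨Set.Icc 0 M, isCompact_Icc, ?_⟩
  rintro _ ⟨i, rfl⟩
  have hsub : (Set.Icc 0 M)ᶜ ⊆ {x : ℝ≥0 | (M : ℝ≥0∞) ≤ (x : ℝ≥0∞)} := by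
    intro x hx
    simp only [Set.mem_compl_iff, Set.mem_Icc, zero_le, true_and, not_le] at hx
    simpa using hx.le
  refine (measure_mono hsub).trans ?_
  refine (meas_ge_le_lintegral_div (by fun_prop) (by simpa using hM0.ne') (by simp)).trans ?_
  exact (ENNReal.div_le_div_right (h i) _).trans hM

/-- Integer parameters suffice: the polynomials in `exp (-x)` form an algebra of bounded continuous
functions that separates points, and the bound on the means supplies tightness. -/
lemma tendsto_of_tendsto_laplace {ι : Type*} {l : Filter ι} (μ : ι → ProbabilityMeasure ℝ≥0)
    (μ₀ : ProbabilityMeasure ℝ≥0) (C : ℝ≥0) (hC : ∀ i, ∫⁻ x, (x : ℝ≥0∞) ∂(μ i : Measure ℝ≥0) ≤ C)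
    (h : ∀ k : ℕ, Tendsto (fun i => ∫ x, Real.exp (-(k * (x : ℝ))) ∂(μ i : Measure ℝ≥0)) l
      (𝓝 (∫ x, Real.exp (-(k * (x : ℝ))) ∂(μ₀ : Measure ℝ≥0)))) :
    Tendsto μ l (𝓝 μ₀) := by
  refine ProbabilityMeasure.tendsto_of_tight_of_separatesPoints ℝ (A := expNegSubalgebra) ?_ ?_ ?_
  · have := isTightMeasureSet_of_lintegral_le (fun i => (μ i : Measure ℝ≥0)) C hC
    exact this
  · intro x y hxy
    refine ⟨expNegBCF, ⟨BoundedContinuousFunction.toContinuousMapStarₐ ℝ expNegBCF, ⟨expNegBCF, ⟨Polynomial.X, by simp⟩, rfl⟩, rfl⟩, ?_⟩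
    simpa [expNegBCF] using hxy
  · rintro g ⟨p, rfl⟩
    have key : ∀ ν : Measure ℝ≥0, IsProbabilityMeasure ν → ∫ x, (Polynomial.aeval expNegBCF p) x ∂ν =
        ∑ k ∈ p.support, p.coeff k * ∫ x : ℝ≥0, Real.exp (-(k * (x : ℝ))) ∂ν := by
      intro ν hν
      simp_rw [aeval_expNegBCF_apply]
      rw [integral_finsetSum]
      · simp_rw [integral_const_mul]
      · intro k _
        refine Integrable.const_mul (Integrable.of_bound (C := 1) (by fun_prop) ?_) _
        refine ae_of_all _ fun x => ?_
        rw [Real.norm_eq_abs, Real.abs_exp]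
        exact Real.exp_le_one_iff.2 (by simp; positivity)
    change Tendsto (fun i => ∫ x, (Polynomial.aeval expNegBCF p) x ∂(μ i : Measure ℝ≥0)) l
      (𝓝 (∫ x, (Polynomial.aeval expNegBCF p) x ∂(μ₀ : Measure ℝ≥0)))
    rw [key _ inferInstance]
    simp_rw [fun i => key (μ i : Measure ℝ≥0) inferInstance]
    exact tendsto_finsetSum _ fun k _ => (h k).const_mul _

/-- The argument takes place on `ℝ≥0`, where `exp (-x)` is bounded; the result is carried back to
`ℝ` by the continuous inclusion. -/
lemma tendstoInDistribution_of_tendsto_laplace {ι : Type*} {l : Filter ι} {Ω : ι → Type*}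
    [∀ i, MeasurableSpace (Ω i)] {P : ∀ i, Measure (Ω i)} [∀ i, IsProbabilityMeasure (P i)]
    {Ω' : Type*} [MeasurableSpace Ω'] {P' : Measure Ω'} [IsProbabilityMeasure P']
    {X : ∀ i, Ω i → ℝ} {Z : Ω' → ℝ} (hX : ∀ i, AEMeasurable (X i) (P i)) (hZ : AEMeasurable Z P')
    (hX0 : ∀ i ω, 0 ≤ X i ω) (hZ0 : ∀ ω, 0 ≤ Z ω) (C : ℝ≥0)
    (hC : ∀ i, ∫⁻ ω, ENNReal.ofReal (X i ω) ∂(P i) ≤ C)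
    (h : ∀ t : ℝ, 0 ≤ t → Tendsto (fun i => ∫ ω, Real.exp (-(t * X i ω)) ∂(P i)) l
      (𝓝 (∫ ω, Real.exp (-(t * Z ω)) ∂P'))) :
    TendstoInDistribution X l Z P P' := by
  have hX' : ∀ i, AEMeasurable (fun ω => (X i ω).toNNReal) (P i) := fun i => (hX i).real_toNNReal
  have hZ' : AEMeasurable (fun ω => (Z ω).toNNReal) P' := hZ.real_toNNReal
  have main : TendstoInDistribution (fun i ω => (X i ω).toNNReal) l
      (fun ω => (Z ω).toNNReal) P P' := by
    refine ⟨hX', hZ', ?_⟩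
    refine tendsto_of_tendsto_laplace _ _ C ?_ ?_
    · intro i
      change ∫⁻ x, (x : ℝ≥0∞) ∂((P i).map (fun ω => (X i ω).toNNReal)) ≤ C
      rw [lintegral_map' (by fun_prop) (hX' i)]
      exact hC i
    · intro k
      have := h k (by positivity)
      change Tendsto (fun i => ∫ x : ℝ≥0, Real.exp (-(k * (x : ℝ)))
        ∂((P i).map (fun ω => (X i ω).toNNReal))) l (𝓝 (∫ x : ℝ≥0, Real.exp (-(k * (x : ℝ)))
        ∂(P'.map (fun ω => (Z ω).toNNReal))))
      rw [integral_map hZ' (by fun_prop)]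
      simp_rw [fun i => integral_map (μ := P i) (hX' i)
        (f := fun x : ℝ≥0 => Real.exp (-(k * (x : ℝ)))) (by fun_prop)]
      simpa [Real.coe_toNNReal, hX0, hZ0] using this
  have := main.continuous_comp (g := ((↑) : ℝ≥0 → ℝ)) NNReal.continuous_coe
  refine this.congr (fun i => ae_of_all _ fun ω => ?_) (ae_of_all _ fun ω => ?_)
  · simp [hX0]
  · simp [hZ0]

end LaplaceTransform

/-! ### Independence of functions of disjoint subfamilies. -/

section Independence

/-- Freezing the coordinates outside `S` at a constant leaves `φ` unchanged and displays it as a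
measurable function of the coordinates in `S` alone. -/
lemma comap_le_iSup_comap_of_eqOn {Ω ι β γ : Type*} [MeasurableSpace β] [MeasurableSpace γ]
    [Nonempty β] (f : ι → Ω → β) {S : Set ι} {φ : (ι → β) → γ} (hφ : Measurable φ)
    (hφS : ∀ a b, Set.EqOn a b S → φ a = φ b) :
    MeasurableSpace.comap (fun ω => φ (fun i => f i ω)) inferInstance ≤
      ⨆ i ∈ S, MeasurableSpace.comap (f i) inferInstance := by
  classical
  obtain ⟨b⟩ := ‹Nonempty β›
  have : (fun ω => φ (fun i => f i ω)) = fun ω => φ (fun i => if i ∈ S then f i ω else b) := by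
    ext ω
    exact hφS _ _ fun i hi => by simp [hi]
  rw [this]
  refine @Measurable.comap_le _ _ (⨆ i ∈ S, MeasurableSpace.comap (f i) inferInstance) _ _ ?_
  refine hφ.comp (@measurable_pi_lambda _ _ _ (⨆ i ∈ S, MeasurableSpace.comap (f i) inferInstance)
    _ _ fun i => ?_)
  by_cases hi : i ∈ S
  · simp only [hi, if_true]
    refine Measurable.mono (comap_measurable (f i)) ?_ le_rfl
    exact le_biSup (fun i => MeasurableSpace.comap (f i) inferInstance) hi
  · simp only [hi, if_false]
    exact measurable_const

/-- Functions of disjoint subfamilies of an independent family are independent. -/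
lemma iIndepFun_indepFun_of_eqOn {Ω ι β γ δ : Type*} [MeasurableSpace Ω] {P : Measure Ω}
    [MeasurableSpace β] [MeasurableSpace γ] [MeasurableSpace δ] [Nonempty β] {f : ι → Ω → β}
    (hf : iIndepFun f P) (hm : ∀ i, Measurable (f i)) {S T : Set ι} (hST : Disjoint S T)
    {φ : (ι → β) → γ} {ψ : (ι → β) → δ} (hφ : Measurable φ) (hψ : Measurable ψ)
    (hφS : ∀ a b, Set.EqOn a b S → φ a = φ b) (hψT : ∀ a b, Set.EqOn a b T → ψ a = ψ b) :
    IndepFun (fun ω => φ (fun i => f i ω)) (fun ω => ψ (fun i => f i ω)) P := by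
  rw [IndepFun_iff_Indep]
  have h := indep_iSup_of_disjoint (fun i => (hm i).comap_le) hf.iIndep hST
  exact indep_of_indep_of_le_left (indep_of_indep_of_le_right h
    (comap_le_iSup_comap_of_eqOn f hψ hψT)) (comap_le_iSup_comap_of_eqOn f hφ hφS)

/-- If `X` and the `Y i` are independent, products of functions of `X` and `Y i` can be
integrated by integrating out the `Y i` one by one. -/
lemma integral_prod_of_indepFun {Ω ι α β : Type*} [MeasurableSpace Ω] {P : Measure Ω}
    [IsProbabilityMeasure P] [MeasurableSpace α] [MeasurableSpace β] [Fintype ι] {X : Ω → α}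
    {Y : ι → Ω → β} (hX : Measurable X) (hY : ∀ i, Measurable (Y i))
    (hXY : IndepFun X (fun ω i => Y i ω) P) (hYi : iIndepFun Y P) {f : ι → α → β → ℝ}
    (hf : ∀ i, Measurable (Function.uncurry (f i))) (hf0 : ∀ i x y, 0 ≤ f i x y)
    (hf1 : ∀ i x y, f i x y ≤ 1) :
    ∫ ω, ∏ i, f i (X ω) (Y i ω) ∂P = ∫ ω, ∏ i, ∫ ω', f i (X ω) (Y i ω') ∂P ∂P := by
  have hYm : Measurable (fun ω i => Y i ω) := by fun_prop
  have hF : Measurable (fun p : α × (ι → β) => ∏ i, f i p.1 (p.2 i)) := by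
    refine Finset.measurable_prod _ fun i _ => ?_
    exact (hf i).comp (f := fun p : α × (ι → β) => (p.1, p.2 i)) (by fun_prop)
  have hb : ∀ x (y : ι → β), ‖∏ i, f i x (y i)‖ ≤ 1 := fun x y => by
    rw [Real.norm_eq_abs, Finset.abs_prod]
    refine Finset.prod_le_one (fun i _ => abs_nonneg _) fun i _ => ?_
    rw [abs_of_nonneg (hf0 _ _ _)]
    exact hf1 _ _ _
  have := Measure.isProbabilityMeasure_map hX.aemeasurable (μ := P)
  have := Measure.isProbabilityMeasure_map hYm.aemeasurable (μ := P)
  have h1 : ∫ ω, ∏ i, f i (X ω) (Y i ω) ∂P =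
      ∫ p, ∏ i, f i p.1 (p.2 i) ∂((P.map X).prod (P.map (fun ω i => Y i ω))) := by
    rw [← hXY.map_prod_eq_prod_map_map hX.aemeasurable hYm.aemeasurable,
      integral_map (by fun_prop) hF.aestronglyMeasurable]
  -- Fubini freezes the value of `X`; what remains is a product of functions of the separate
  -- independent `Y i`.
  rw [h1, integral_prod _ (Integrable.of_bound hF.aestronglyMeasurable 1
    (ae_of_all _ fun p => hb _ _)), integral_map hX.aemeasurable]
  · refine integral_congr_ae (ae_of_all _ fun ω => ?_)
    have hfx : ∀ i, Measurable (f i (X ω)) := fun i => (hf i).comp (measurable_prodMk_left)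
    have hc := hYi.comp (fun i => f i (X ω)) hfx
    dsimp only
    rw [integral_map hYm.aemeasurable]
    · exact hc.integral_fun_prod_eq_prod_integral
        fun i => ((hfx i).comp (hY i)).aestronglyMeasurable
    · exact (hF.comp measurable_prodMk_left).aestronglyMeasurable
  · exact (hF.stronglyMeasurable.integral_prod_right').aestronglyMeasurable

end Independence

/-! ### Stability of convergence in distribution. -/

section Distribution

variable {ι : Type*} {l : Filter ι} {Ω : ι → Type*} [∀ i, MeasurableSpace (Ω i)]
  {P : ∀ i, Measure (Ω i)} [∀ i, IsProbabilityMeasure (P i)] {Ω' : Type*} [MeasurableSpace Ω']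
  {P' : Measure Ω'} [IsProbabilityMeasure P']

/-- Bounded Lipschitz test functions determine weak convergence, and such a function changes by at
most a constant times `|Y - X|`. -/
lemma tendstoInDistribution_of_tendsto_integral_abs_sub [l.IsCountablyGenerated] {X Y : ∀ i, Ω i → ℝ} {Z : Ω' → ℝ}
    (hX : TendstoInDistribution X l Z P P') (hY : ∀ i, AEMeasurable (Y i) (P i))
    (hi : ∀ i, Integrable (fun ω => Y i ω - X i ω) (P i))
    (h : Tendsto (fun i => ∫ ω, |Y i ω - X i ω| ∂(P i)) l (𝓝 0)) :
    TendstoInDistribution Y l Z P P' := by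
  refine ⟨hY, hX.aemeasurable_limit, ?_⟩
  refine tendsto_iff_forall_lipschitz_integral_tendsto.2 ?_
  have hXt := tendsto_iff_forall_lipschitz_integral_tendsto.1 hX.tendsto
  rintro F ⟨M, hM⟩ ⟨L, hL⟩
  have h1 := hXt F ⟨M, hM⟩ ⟨L, hL⟩
  dsimp at h1 ⊢
  have hc := hL.continuous
  simp_rw [fun i => integral_map (μ := P i) (f := F) (hX.forall_aemeasurable i)
    hc.aestronglyMeasurable] at h1
  simp_rw [fun i => integral_map (μ := P i) (f := F) (hY i) hc.aestronglyMeasurable]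
  have hint : ∀ i, ∀ V : Ω i → ℝ, AEMeasurable V (P i) → Integrable (fun ω => F (V ω)) (P i) := by
    intro i V hV
    refine Integrable.of_bound (C := ‖F 0‖ + M) (hc.measurable.comp_aemeasurable hV).aestronglyMeasurable
      (ae_of_all _ fun ω => ?_)
    have := hM (V ω) 0
    rw [Real.dist_eq] at this
    have h2 := abs_sub_abs_le_abs_sub (F (V ω)) (F 0)
    simp only [Real.norm_eq_abs]
    linarith
  have hdiff : Tendsto (fun i => ∫ ω, F (Y i ω) ∂(P i) - ∫ ω, F (X i ω) ∂(P i)) l (𝓝 0) := by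
    refine squeeze_zero_norm (a := fun i => L * ∫ ω, |Y i ω - X i ω| ∂(P i)) (fun i => ?_) ?_
    · rw [← integral_sub (hint i _ (hY i)) (hint i _ (hX.forall_aemeasurable i)),
        ← integral_const_mul]
      refine norm_integral_le_of_norm_le ((hi i).abs.const_mul _) (ae_of_all _ fun ω => ?_)
      simpa [Real.dist_eq] using hL.dist_le_mul (Y i ω) (X i ω)
    · simpa using h.const_mul (L : ℝ)
  simpa using hdiff.add h1

/-- Forming product measures is weakly continuous. Independence is asked only eventually because the
two path families share no edges only once the dimension is at least `2 * r`. -/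
lemma tendstoInDistribution_prodMk_of_indepFun {X Y : ∀ i, Ω i → ℝ} {Z Z' : Ω' → ℝ}
    (hX : TendstoInDistribution X l Z P P') (hY : TendstoInDistribution Y l Z' P P')
    (hXY : ∀ᶠ i in l, IndepFun (X i) (Y i) (P i)) (hZ : IndepFun Z Z' P') :
    TendstoInDistribution (fun i ω => (X i ω, Y i ω)) l (fun ω => (Z ω, Z' ω)) P P' := by
  have hm := fun i => (hX.forall_aemeasurable i).prodMk (hY.forall_aemeasurable i)
  have hm' := hX.aemeasurable_limit.prodMk hY.aemeasurable_limit
  refine ⟨hm, hm', ?_⟩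
  have h := (ProbabilityMeasure.continuous_prod.tendsto _).comp
    (hX.tendsto.prodMk_nhds hY.tendsto)
  have hlim : (⟨P'.map (fun ω => (Z ω, Z' ω)), Measure.isProbabilityMeasure_map
      (hX.aemeasurable_limit.prodMk hY.aemeasurable_limit)⟩ : ProbabilityMeasure (ℝ × ℝ)) =
      ProbabilityMeasure.prod ⟨P'.map Z, Measure.isProbabilityMeasure_map hX.aemeasurable_limit⟩
        ⟨P'.map Z', Measure.isProbabilityMeasure_map hY.aemeasurable_limit⟩ := by
    apply Subtype.ext
    exact hZ.map_prod_eq_prod_map_map hX.aemeasurable_limit hY.aemeasurable_limit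
  change Tendsto (β := ProbabilityMeasure (ℝ × ℝ)) (fun i => ⟨(P i).map (fun ω => (X i ω, Y i ω)),
    Measure.isProbabilityMeasure_map (hm i)⟩) l (𝓝 ⟨P'.map (fun ω => (Z ω, Z' ω)),
    Measure.isProbabilityMeasure_map hm'⟩)
  rw [hlim]
  refine h.congr' ?_
  filter_upwards [hXY] with i hi
  apply Subtype.ext
  exact (hi.map_prod_eq_prod_map_map (hX.forall_aemeasurable i) (hY.forall_aemeasurable i)).symm

end Distribution

/-! ### The Laplace exponents, their near-additivity and their limit. -/

section LaplaceExponent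

/-- The Laplace exponent of the cascade sums: `E (exp (-t Z_r)) = exp (-laplaceExponent r t)` for
`t ≥ 0`. -/
noncomputable def laplaceExponent : ℕ → ℝ → ℝ
  -- The absolute value makes every exponent nonnegative and 1-Lipschitz on all of `ℝ`, so
  -- integrability needs no sign condition.
  | 0, s => |s|
  | m + 1, s => ∫ x in Set.Ioi (0 : ℝ), (1 - Real.exp (-laplaceExponent m (s * Real.exp (-x))))

lemma laplaceExponent_zero (s : ℝ) : laplaceExponent 0 s = |s| := rfl

lemma laplaceExponent_succ (m : ℕ) (s : ℝ) : laplaceExponent (m + 1) s =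
    ∫ x in Set.Ioi (0 : ℝ), (1 - Real.exp (-laplaceExponent m (s * Real.exp (-x)))) := rfl

lemma integrableOn_exp_neg : IntegrableOn (fun x : ℝ => Real.exp (-x)) (Set.Ioi 0) :=
  integrableOn_exp_neg_Ioi 0

lemma integral_exp_neg_Ioi_eq_one : ∫ x in Set.Ioi (0 : ℝ), Real.exp (-x) = 1 := by
  simpa using integral_exp_neg_Ioi 0

lemma integrableOn_exp_neg_two : IntegrableOn (fun x : ℝ => Real.exp (-x) ^ 2) (Set.Ioi 0) := by
  have := integrableOn_exp_mul_Ioi (a := -2) (by norm_num) 0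
  refine this.congr_fun (fun x _ => ?_) measurableSet_Ioi
  simp only [← Real.exp_nat_mul]
  congr 1; push_cast; ring

lemma integral_exp_neg_sq : ∫ x in Set.Ioi (0 : ℝ), Real.exp (-x) ^ 2 = 1 / 2 := by
  have := integral_exp_mul_Ioi (a := -2) (by norm_num) 0
  rw [← neg_neg (1 / 2 : ℝ)]
  convert this using 1
  · refine integral_congr_ae (ae_of_all _ fun x => ?_)
    simp only [← Real.exp_nat_mul]
    congr 1; push_cast; ring
  · norm_num

lemma abs_exp_neg_sub_exp_neg_le {a b : ℝ} (ha : 0 ≤ a) (hb : 0 ≤ b) :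
    |Real.exp (-a) - Real.exp (-b)| ≤ |a - b| := by
  wlog h : a ≤ b generalizing a b
  · rw [abs_sub_comm, abs_sub_comm a]
    exact this hb ha (le_of_not_ge h)
  have h1 : Real.exp (-b) ≤ Real.exp (-a) := Real.exp_le_exp.2 (by linarith)
  rw [abs_of_nonneg (by linarith), abs_of_nonpos (by linarith)]
  have h2 : Real.exp (-b) = Real.exp (-a) * Real.exp (-(b - a)) := by
    rw [← Real.exp_add]; congr 1; ring
  have h3 : 1 - (b - a) ≤ Real.exp (-(b - a)) := Real.one_sub_le_exp_neg _
  have h4 : Real.exp (-a) ≤ 1 := Real.exp_le_one_iff.2 (by linarith)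
  have h5 := Real.exp_pos (-a)
  rw [h2]
  nlinarith

lemma one_sub_exp_neg_nonneg {a : ℝ} (ha : 0 ≤ a) : 0 ≤ 1 - Real.exp (-a) := by
  linarith [Real.exp_le_one_iff.2 (neg_nonpos.2 ha)]

lemma one_sub_exp_neg_le (a : ℝ) : 1 - Real.exp (-a) ≤ a := by
  linarith [Real.one_sub_le_exp_neg a]

/-- The three facts are proved together: the Lipschitz bound and the value at zero give the bound by
`|s|` that makes the next integral converge. The Lipschitz constant stays 1 because `exp (-x)` has
integral 1. -/
lemma laplaceExponent_basic (m : ℕ) : (∀ s, 0 ≤ laplaceExponent m s) ∧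
    laplaceExponent m 0 = 0 ∧
    (∀ a b, |laplaceExponent m a - laplaceExponent m b| ≤ |a - b|) := by
  induction m with
  | zero =>
    refine ⟨fun s => abs_nonneg s, by simp [laplaceExponent], fun a b => ?_⟩
    exact abs_abs_sub_abs_le a b
  | succ m ih =>
    obtain ⟨h0, hz, hL⟩ := ih
    have hc : Continuous (laplaceExponent m) := by
      refine (LipschitzWith.of_dist_le_mul (K := 1) fun a b => ?_).continuous
      simpa [Real.dist_eq] using hL a b
    have hle : ∀ s, laplaceExponent m s ≤ |s| := fun s => by
      have := hL s 0
      rw [hz, sub_zero, sub_zero, abs_of_nonneg (h0 s)] at this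
      exact this
    have hint : ∀ s : ℝ, IntegrableOn
        (fun x => 1 - Real.exp (-laplaceExponent m (s * Real.exp (-x)))) (Set.Ioi 0) := by
      intro s
      refine Integrable.mono' (integrableOn_exp_neg.const_mul |s|)
        (by fun_prop) (ae_of_all _ fun x => ?_)
      rw [Real.norm_eq_abs, abs_of_nonneg (one_sub_exp_neg_nonneg (h0 _))]
      refine (one_sub_exp_neg_le _).trans ((hle _).trans ?_)
      rw [abs_mul, Real.abs_exp]
    refine ⟨fun s => ?_, ?_, fun a b => ?_⟩
    · exact integral_nonneg fun x => one_sub_exp_neg_nonneg (h0 _)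
    · simp [laplaceExponent, hz]
    · rw [laplaceExponent_succ, laplaceExponent_succ, ← integral_sub (hint a) (hint b),
        ← Real.norm_eq_abs]
      refine (norm_integral_le_of_norm_le (integrableOn_exp_neg.const_mul |a - b|)
        (ae_of_all _ fun x => ?_)).trans ?_
      · rw [Real.norm_eq_abs, sub_sub_sub_cancel_left, abs_sub_comm]
        refine (abs_exp_neg_sub_exp_neg_le (h0 _) (h0 _)).trans ((hL _ _).trans ?_)
        rw [← sub_mul, abs_mul, Real.abs_exp]
      · rw [integral_const_mul, integral_exp_neg_Ioi_eq_one, mul_one]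

lemma laplaceExponent_nonneg (m : ℕ) (s : ℝ) : 0 ≤ laplaceExponent m s :=
  (laplaceExponent_basic m).1 s

lemma laplaceExponent_apply_zero (m : ℕ) : laplaceExponent m 0 = 0 := (laplaceExponent_basic m).2.1

lemma abs_laplaceExponent_sub_le (m : ℕ) (a b : ℝ) :
    |laplaceExponent m a - laplaceExponent m b| ≤ |a - b| := (laplaceExponent_basic m).2.2 a b

@[fun_prop]
lemma continuous_laplaceExponent (m : ℕ) : Continuous (laplaceExponent m) := by
  refine (LipschitzWith.of_dist_le_mul (K := 1) fun a b => ?_).continuous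
  simpa [Real.dist_eq] using abs_laplaceExponent_sub_le m a b

@[fun_prop]
lemma measurable_laplaceExponent (m : ℕ) : Measurable (laplaceExponent m) :=
  (continuous_laplaceExponent m).measurable

lemma laplaceExponent_le_abs (m : ℕ) (s : ℝ) : laplaceExponent m s ≤ |s| := by
  have := abs_laplaceExponent_sub_le m s 0
  rwa [laplaceExponent_apply_zero, sub_zero, sub_zero,
    abs_of_nonneg (laplaceExponent_nonneg m s)] at this

lemma laplaceExponent_le (m : ℕ) {s : ℝ} (hs : 0 ≤ s) : laplaceExponent m s ≤ s := by
  simpa [abs_of_nonneg hs] using laplaceExponent_le_abs m s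

lemma laplaceExponent_mul_exp_le (m : ℕ) (s x : ℝ) :
    laplaceExponent m (s * Real.exp (-x)) ≤ |s| * Real.exp (-x) := by
  simpa [abs_mul] using laplaceExponent_le_abs m (s * Real.exp (-x))

lemma integrableOn_one_sub_exp_neg_laplaceExponent (m : ℕ) (s : ℝ) : IntegrableOn
    (fun x => 1 - Real.exp (-laplaceExponent m (s * Real.exp (-x)))) (Set.Ioi 0) := by
  refine Integrable.mono' (integrableOn_exp_neg.const_mul |s|)
    (by fun_prop) (ae_of_all _ fun x => ?_)
  rw [Real.norm_eq_abs, abs_of_nonneg (one_sub_exp_neg_nonneg (laplaceExponent_nonneg _ _))]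
  exact (one_sub_exp_neg_le _).trans (laplaceExponent_mul_exp_le m s x)

/-- With `u = a * exp (-x)` and `v = b * exp (-x)`, the integrand is at most `2 * (u * v)`: one `u *
v` from the induction hypothesis, one from the product `(1 - exp (-p)) * (1 - exp (-q))`. The factor
`exp (-x) ^ 2` integrates to `1 / 2`, so the constant 1 reproduces itself. -/
lemma abs_laplaceExponent_add_sub_le (m : ℕ) {a b : ℝ} (ha : 0 ≤ a) (hb : 0 ≤ b) :
    |laplaceExponent m (a + b) - laplaceExponent m a - laplaceExponent m b| ≤ a * b := by
  induction m generalizing a b with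
  | zero =>
    simp only [laplaceExponent_zero, abs_of_nonneg ha, abs_of_nonneg hb,
      abs_of_nonneg (add_nonneg ha hb)]
    simp; positivity
  | succ m ih =>
    have hi := integrableOn_one_sub_exp_neg_laplaceExponent m
    have he : laplaceExponent (m + 1) (a + b) - laplaceExponent (m + 1) a -
        laplaceExponent (m + 1) b = ∫ x in Set.Ioi (0 : ℝ),
          ((1 - Real.exp (-laplaceExponent m ((a + b) * Real.exp (-x)))) -
          (1 - Real.exp (-laplaceExponent m (a * Real.exp (-x)))) -
          (1 - Real.exp (-laplaceExponent m (b * Real.exp (-x))))) := by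
      refine Eq.symm ((integral_sub ((hi (a + b)).sub (hi a)) (hi b)).trans ?_)
      exact congrArg (· - _) (integral_sub (hi (a + b)) (hi a))
    rw [he, ← Real.norm_eq_abs]
    refine (norm_integral_le_of_norm_le (integrableOn_exp_neg_two.const_mul (2 * (a * b)))
        (ae_of_all _ fun x => ?_)).trans ?_
    · rw [Real.norm_eq_abs]
      set u := a * Real.exp (-x) with hu
      set v := b * Real.exp (-x) with hv
      have hu0 : 0 ≤ u := by positivity
      have hv0 : 0 ≤ v := by positivity
      have huv : (a + b) * Real.exp (-x) = u + v := by rw [hu, hv]; ring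
      rw [huv]
      have h1 := ih hu0 hv0
      set p := laplaceExponent m u with hp
      set q := laplaceExponent m v with hq
      have hp0 : 0 ≤ p := laplaceExponent_nonneg m u
      have hq0 : 0 ≤ q := laplaceExponent_nonneg m v
      have hpu : p ≤ u := laplaceExponent_le m hu0
      have hqv : q ≤ v := laplaceExponent_le m hv0
      have h2 : |Real.exp (-laplaceExponent m (u + v)) - Real.exp (-(p + q))| ≤ u * v := by
        refine (abs_exp_neg_sub_exp_neg_le (laplaceExponent_nonneg m _) (by positivity)).trans ?_
        rwa [← sub_sub]
      have h3 : (1 - Real.exp (-p)) * (1 - Real.exp (-q)) ≤ u * v :=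
        mul_le_mul ((one_sub_exp_neg_le p).trans hpu) ((one_sub_exp_neg_le q).trans hqv)
          (one_sub_exp_neg_nonneg hq0) hu0
      have h4 : 0 ≤ (1 - Real.exp (-p)) * (1 - Real.exp (-q)) :=
        mul_nonneg (one_sub_exp_neg_nonneg hp0) (one_sub_exp_neg_nonneg hq0)
      have h5 : Real.exp (-(p + q)) = Real.exp (-p) * Real.exp (-q) := by
        rw [← Real.exp_add]; congr 1; ring
      have h6 : 2 * (a * b) * Real.exp (-x) ^ 2 = 2 * (u * v) := by rw [hu, hv]; ring
      rw [h6]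
      rw [abs_le] at h2 ⊢
      rw [h5] at h2
      constructor <;> nlinarith [h2.1, h2.2]
    · rw [integral_const_mul, integral_exp_neg_sq]
      apply le_of_eq; ring

/-- Adding a term `a i` costs `a i` times the sum so far, while the right side grows by twice that
amount. The factor two is given away to match the cross terms of a squared path weight. -/
lemma abs_laplaceExponent_sum_sub_le (m : ℕ) {ι : Type*} (s : Finset ι) (a : ι → ℝ)
    (ha : ∀ i ∈ s, 0 ≤ a i) :
    |laplaceExponent m (∑ i ∈ s, a i) - ∑ i ∈ s, laplaceExponent m (a i)| ≤
      (∑ i ∈ s, a i) ^ 2 - ∑ i ∈ s, a i ^ 2 := by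
  classical
  induction s using Finset.induction_on with
  | empty => simp [laplaceExponent_apply_zero]
  | insert i s hi ih =>
    rw [Finset.sum_insert hi, Finset.sum_insert hi, Finset.sum_insert hi]
    have ha' : ∀ j ∈ s, 0 ≤ a j := fun j hj => ha j (Finset.mem_insert_of_mem hj)
    have h1 := ih ha'
    have h2 := abs_laplaceExponent_add_sub_le m (ha i (Finset.mem_insert_self i s))
      (Finset.sum_nonneg ha')
    have h3 := mul_nonneg (ha i (Finset.mem_insert_self i s)) (Finset.sum_nonneg ha')
    rw [abs_le] at h1 h2 ⊢
    constructor <;> nlinarith [h1.1, h1.2, h2.1, h2.2]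

/-- The integrand has the primitive `-log (1 + t * exp (-x))`, which vanishes at infinity; thus `log
(1 + t)` is a fixed point of the recursion for `laplaceExponent`. -/
lemma integral_one_sub_exp_neg_log (t : ℝ) (ht : 0 ≤ t) :
    IntegrableOn (fun x => 1 - Real.exp (-Real.log (1 + t * Real.exp (-x)))) (Set.Ioi 0) ∧
    ∫ x in Set.Ioi (0 : ℝ), (1 - Real.exp (-Real.log (1 + t * Real.exp (-x)))) =
      Real.log (1 + t) := by
  have hpos : ∀ x : ℝ, 0 < 1 + t * Real.exp (-x) := fun x => by positivity
  have hd : ∀ x ∈ Set.Ici (0 : ℝ), HasDerivAt (fun x => -Real.log (1 + t * Real.exp (-x)))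
      (1 - Real.exp (-Real.log (1 + t * Real.exp (-x)))) x := by
    intro x _
    have h1 : HasDerivAt (fun x : ℝ => 1 + t * Real.exp (-x)) (t * (Real.exp (-x) * (-1))) x :=
      (((hasDerivAt_neg x).exp).const_mul t).const_add 1
    have h2 := (h1.log (hpos x).ne').neg
    refine h2.congr_deriv ?_
    rw [Real.exp_neg (Real.log _), Real.exp_log (hpos x)]
    have := (hpos x).ne'
    field_simp
    ring
  have hlim : Tendsto (fun x : ℝ => -Real.log (1 + t * Real.exp (-x))) atTop (𝓝 0) := by
    have h1 : Tendsto (fun x : ℝ => 1 + t * Real.exp (-x)) atTop (𝓝 1) := by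
      simpa using ((Real.tendsto_exp_neg_atTop_nhds_zero).const_mul t).const_add 1
    simpa using (h1.log one_ne_zero).neg
  have hn : ∀ x ∈ Set.Ioi (0 : ℝ), 0 ≤ 1 - Real.exp (-Real.log (1 + t * Real.exp (-x))) := by
    intro x _
    refine one_sub_exp_neg_nonneg (Real.log_nonneg ?_)
    have : 0 ≤ t * Real.exp (-x) := by positivity
    linarith
  refine ⟨integrableOn_Ioi_deriv_of_nonneg' hd hn hlim, ?_⟩
  rw [integral_Ioi_of_hasDerivAt_of_nonneg' hd hn hlim]
  simp

/-- The map defining `laplaceExponent (m + 1)` contracts towards its fixed point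
`t ↦ log (1 + t)`. -/
lemma abs_laplaceExponent_sub_log_le (m : ℕ) {t : ℝ} (ht : 0 ≤ t) :
    |laplaceExponent m t - Real.log (1 + t)| ≤ (1 / 2) ^ m * t ^ 2 := by
  induction m generalizing t with
  | zero =>
    have h1 : Real.log (1 + t) ≤ t := by
      linarith [Real.log_le_sub_one_of_pos (show 0 < 1 + t by linarith)]
    have h2 : 1 - (1 + t)⁻¹ ≤ Real.log (1 + t) := Real.one_sub_inv_le_log_of_pos (by linarith)
    have h3 : t - t ^ 2 ≤ 1 - (1 + t)⁻¹ := by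
      have : 1 - (1 + t)⁻¹ = t / (1 + t) := by field_simp; ring
      rw [this, le_div_iff₀ (by linarith)]
      nlinarith [pow_nonneg ht 3]
    rw [laplaceExponent_zero, abs_of_nonneg ht, abs_of_nonneg (by linarith)]
    linarith
  | succ m ih =>
    obtain ⟨hint, hval⟩ := integral_one_sub_exp_neg_log t ht
    rw [laplaceExponent_succ, ← hval,
      ← integral_sub (integrableOn_one_sub_exp_neg_laplaceExponent m t) hint, ← Real.norm_eq_abs]
    -- The induction hypothesis at `t * exp (-x)` carries the factor `exp (-x) ^ 2`, whose integral
    -- `1 / 2` is the contraction rate.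
    refine (norm_integral_le_of_norm_le
      (integrableOn_exp_neg_two.const_mul ((1 / 2) ^ m * t ^ 2)) (ae_of_all _ fun x => ?_)).trans ?_
    · have hx : 0 ≤ t * Real.exp (-x) := by positivity
      rw [Real.norm_eq_abs, sub_sub_sub_cancel_left, abs_sub_comm]
      refine (abs_exp_neg_sub_exp_neg_le (laplaceExponent_nonneg _ _)
        (Real.log_nonneg (by linarith))).trans ((ih hx).trans (le_of_eq ?_))
      ring
    · rw [integral_const_mul, integral_exp_neg_sq]
      apply le_of_eq; ring

lemma tendsto_exp_neg_laplaceExponent {t : ℝ} (ht : 0 ≤ t) :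
    Tendsto (fun m => Real.exp (-laplaceExponent m t)) atTop (𝓝 (1 + t)⁻¹) := by
  have h : Tendsto (fun m => laplaceExponent m t) atTop (𝓝 (Real.log (1 + t))) := by
    rw [tendsto_iff_norm_sub_tendsto_zero]
    refine squeeze_zero (fun _ => norm_nonneg _)
      (fun m => abs_laplaceExponent_sub_log_le m ht) ?_
    simpa using (tendsto_pow_atTop_nhds_zero_of_lt_one (r := (1 / 2 : ℝ)) (by norm_num)
      (by norm_num)).mul_const (t ^ 2)
  have := (Real.continuous_exp.tendsto _).comp h.neg
  rwa [Real.exp_neg, Real.exp_log (by linarith)] at this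

end LaplaceExponent

/-! ### Campbell's formula and the Laplace functional of a Poisson process. -/

section PoissonPointProcess

open scoped ENNReal NNReal Nat

lemma tsum_eq_toReal_tsum_ofReal {ι : Type*} {f : ι → ℝ} (hf : ∀ i, 0 ≤ f i) :
    ∑' i, f i = (∑' i, ENNReal.ofReal (f i)).toReal := by
  rw [ENNReal.tsum_toReal_eq fun _ => ENNReal.ofReal_ne_top]
  exact tsum_congr fun i => (ENNReal.toReal_ofReal (hf i)).symm

lemma summable_of_tsum_ofReal_ne_top {ι : Type*} {f : ι → ℝ} (hf : ∀ i, 0 ≤ f i)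
    (h : ∑' i, ENNReal.ofReal (f i) ≠ ∞) : Summable f := by
  refine (ENNReal.summable_toReal h).congr fun i => ENNReal.toReal_ofReal (hf i)

lemma measurable_tsum_of_nonneg {α ι : Type*} [MeasurableSpace α] [Countable ι] {f : ι → α → ℝ}
    (hf : ∀ i, Measurable (f i)) (h0 : ∀ i x, 0 ≤ f i x) :
    Measurable (fun x => ∑' i, f i x) := by
  simp_rw [fun x => tsum_eq_toReal_tsum_ofReal (fun i => h0 i x)]
  fun_prop

lemma lintegral_poissonMeasure (r : ℝ≥0) (F : ℕ → ℝ≥0∞) :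
    ∫⁻ k, F k ∂(poissonMeasure r) =
      ∑' k, ENNReal.ofReal (Real.exp (-r) * r ^ k / k !) * F k := by
  rw [poissonMeasure, lintegral_sum_measure]
  simp

lemma lintegral_natCast_poissonMeasure (r : ℝ≥0) :
    ∫⁻ k, (k : ℝ≥0∞) ∂(poissonMeasure r) = r := by
  rw [lintegral_poissonMeasure, tsum_eq_zero_add' ENNReal.summable]
  have h : ∀ k : ℕ, ENNReal.ofReal (Real.exp (-r) * r ^ (k + 1) / (k + 1)!) * ((k + 1 : ℕ) : ℝ≥0∞) =
      r * ENNReal.ofReal (Real.exp (-r) * r ^ k / k !) := by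
    intro k
    rw [← ENNReal.ofReal_natCast (k + 1), ← ENNReal.ofReal_mul (by positivity),
      ← ENNReal.ofReal_coe_nnreal, ← ENNReal.ofReal_mul (by positivity)]
    congr 1
    rw [Nat.factorial_succ]
    push_cast
    field_simp
    ring
  simp_rw [h]
  rw [ENNReal.tsum_mul_left, ← ENNReal.ofReal_tsum_of_nonneg (fun k => by positivity)
    (hasSum_one_poissonMeasure r).summable, (hasSum_one_poissonMeasure r).tsum_eq]
  simp

lemma integral_exp_neg_mul_poissonMeasure (r : ℝ≥0) (c : ℝ) :
    ∫ k, Real.exp (-(c * (k : ℝ))) ∂(poissonMeasure r) =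
      Real.exp (-(r * (1 - Real.exp (-c)))) := by
  rw [integral_poissonMeasure]
  have h : ∀ k : ℕ, (Real.exp (-r) * r ^ k / k !) • Real.exp (-(c * (k : ℝ))) =
      Real.exp (-r) * ((r * Real.exp (-c)) ^ k / k !) := by
    intro k
    rw [mul_pow, ← Real.exp_nat_mul, smul_eq_mul]
    have : -(c * (k : ℝ)) = k * (-c) := by ring
    rw [this]
    ring
  simp_rw [h]
  rw [tsum_mul_left, (NormedSpace.expSeries_div_hasSum_exp (r * Real.exp (-c))).tsum_eq,
    ← Real.exp_eq_exp_ℝ, ← Real.exp_add]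
  congr 1
  ring

variable {Ω E : Type*} [MeasurableSpace Ω] [MeasurableSpace E] {η : ℕ → Ω → E} {Λ : Measure E}
  {P : Measure Ω}

lemma pointCount_eq_tsum {Ω E : Type*} [MeasurableSpace E] (η : ℕ → Ω → E) {A : Set E} (hA : MeasurableSet A) (ω : Ω) :
    pointCount η A ω = ∑' i, A.indicator 1 (η i ω) := by
  rw [pointCount, Measure.sum_apply _ hA]
  simp [Measure.dirac_apply' _ hA]

namespace IsPoissonPointProcess

lemma lintegral_pointCount (h : IsPoissonPointProcess η Λ P) {A : Set E} (hA : MeasurableSet A)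
    (hΛ : Λ A ≠ ∞) : ∫⁻ ω, pointCount η A ω ∂P = Λ A := by
  have hl := h.law_count A hA hΛ
  have h1 : ∫⁻ ω, pointCount η A ω ∂P = ∫⁻ x, x ∂(P.map (pointCount η A)) := by
    rw [lintegral_map' aemeasurable_id' hl.aemeasurable]
  rw [h1, hl.map_eq, lintegral_map measurable_id' (by fun_prop), lintegral_natCast_poissonMeasure,
    ENNReal.coe_toNNReal hΛ]

/-- The intensity measure is the sum of the laws of the points. -/
lemma sum_map_eq [SigmaFinite Λ] (h : IsPoissonPointProcess η Λ P) :
    Measure.sum (fun i => P.map (η i)) = Λ := by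
  have key : ∀ A, MeasurableSet A → Λ A ≠ ∞ → Measure.sum (fun i => P.map (η i)) A = Λ A := by
    intro A hA hΛ
    rw [← h.lintegral_pointCount hA hΛ, Measure.sum_apply _ hA]
    simp_rw [pointCount_eq_tsum η hA]
    rw [lintegral_tsum (f := fun i ω => A.indicator 1 (η i ω)) fun i =>
      ((measurable_one.indicator hA).comp (h.measurable i)).aemeasurable]
    refine tsum_congr fun i => ?_
    rw [Measure.map_apply (h.measurable i) hA]
    have : (fun ω => A.indicator (1 : E → ℝ≥0∞) (η i ω)) = (η i ⁻¹' A).indicator 1 := by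
      ext ω; simp only [Set.indicator, Set.mem_preimage]; rfl
    rw [this, lintegral_indicator_one (h.measurable i hA)]
  -- Counts have a prescribed law only on sets of finite intensity, so the measures are compared on
  -- an exhaustion by such sets.
  rw [← Measure.restrict_univ (μ := Measure.sum _), ← Measure.restrict_univ (μ := Λ),
    ← iUnion_spanningSets Λ, Measure.restrict_iUnion_congr]
  intro n
  ext A hA
  rw [Measure.restrict_apply hA, Measure.restrict_apply hA]
  refine key _ (hA.inter (measurableSet_spanningSets Λ n)) ?_
  exact ((measure_mono Set.inter_subset_right).trans_lt (measure_spanningSets_lt_top Λ n)).ne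

/-- Campbell's formula. -/
lemma lintegral_tsum_eq [SigmaFinite Λ] (h : IsPoissonPointProcess η Λ P) {f : E → ℝ≥0∞}
    (hf : Measurable f) : ∫⁻ ω, ∑' i, f (η i ω) ∂P = ∫⁻ x, f x ∂Λ := by
  rw [lintegral_tsum (f := fun i ω => f (η i ω)) fun i => (hf.comp (h.measurable i)).aemeasurable]
  conv_rhs => rw [← h.sum_map_eq, lintegral_sum_measure]
  exact tsum_congr fun i => (lintegral_map hf (h.measurable i)).symm

lemma ae_tsum_ofReal_ne_top [SigmaFinite Λ] (h : IsPoissonPointProcess η Λ P) {f : E → ℝ}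
    (hf : Measurable f) (hi : Integrable f Λ) :
    ∀ᵐ ω ∂P, ∑' i, ENNReal.ofReal (f (η i ω)) ≠ ∞ := by
  have hm : ∀ i, Measurable (fun ω => f (η i ω)) := fun i => hf.comp (h.measurable i)
  refine (ae_lt_top (Measurable.tsum fun i => (hm i).ennreal_ofReal) ?_).mono
    fun ω hω => hω.ne
  rw [h.lintegral_tsum_eq (f := fun x => ENNReal.ofReal (f x)) (by fun_prop)]
  exact hi.lintegral_lt_top.ne

lemma ae_summable [SigmaFinite Λ] (h : IsPoissonPointProcess η Λ P) {f : E → ℝ}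
    (hf : Measurable f) (h0 : ∀ x, 0 ≤ f x) (hi : Integrable f Λ) :
    ∀ᵐ ω ∂P, Summable (fun i => f (η i ω)) :=
  (h.ae_tsum_ofReal_ne_top hf hi).mono fun _ hω =>
    summable_of_tsum_ofReal_ne_top (fun _ => h0 _) hω

lemma ae_pointCount_ne_top (h : IsPoissonPointProcess η Λ P) {A : Set E} (hA : MeasurableSet A)
    (hΛ : Λ A ≠ ∞) : ∀ᵐ ω ∂P, pointCount η A ω ≠ ∞ := by
  refine (ae_lt_top' (h.law_count A hA hΛ).aemeasurable ?_).mono fun ω hω => hω.ne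
  rwa [h.lintegral_pointCount hA hΛ]

lemma integral_exp_neg_mul_pointCount (h : IsPoissonPointProcess η Λ P) {A : Set E}
    (hA : MeasurableSet A) (hΛ : Λ A ≠ ∞) (c : ℝ) :
    ∫ ω, Real.exp (-(c * (pointCount η A ω).toReal)) ∂P =
      Real.exp (-(Λ.real A * (1 - Real.exp (-c)))) := by
  have hl := h.law_count A hA hΛ
  rw [← integral_map (f := fun x : ℝ≥0∞ => Real.exp (-(c * x.toReal))) hl.aemeasurable
    (Measurable.aestronglyMeasurable (by fun_prop)), hl.map_eq,
    integral_map (by fun_prop) (Measurable.aestronglyMeasurable (by fun_prop))]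
  simp only [ENNReal.toReal_natCast]
  rw [integral_exp_neg_mul_poissonMeasure]
  rfl

/-- The level sets of the nonzero values are disjoint with finite intensity, so their counts are
independent Poisson variables. The value zero is dropped since its level set may have infinite
intensity; `|s|` appears because an L¹ approximation of a nonnegative function may take negative
values. -/
lemma laplace_simpleFunc [SigmaFinite Λ] (h : IsPoissonPointProcess η Λ P) (s : SimpleFunc E ℝ)
    (hs : Integrable s Λ) :
    ∫ ω, Real.exp (-∑' i, |s (η i ω)|) ∂P = Real.exp (-∫ x, (1 - Real.exp (-|s x|)) ∂Λ) := by
  classical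
  set R := s.range.filter (· ≠ 0) with hR
  let e := R.equivFin.symm
  let A : Fin R.card → Set E := fun i => s ⁻¹' {(e i : ℝ)}
  have hA : ∀ i, MeasurableSet (A i) := fun i => s.measurableSet_fiber _
  have hne : ∀ i, (e i : ℝ) ≠ 0 := fun i => (Finset.mem_filter.1 (e i).2).2
  have hΛ : ∀ i, Λ (A i) ≠ ∞ := fun i =>
    (SimpleFunc.measure_preimage_lt_top_of_integrable s hs (hne i)).ne
  have hdisj : ∀ i j, i ≠ j → Disjoint (A i) (A j) := by
    intro i j hij
    refine Disjoint.preimage _ (Set.disjoint_singleton.2 fun h => hij ?_)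
    exact e.injective (Subtype.ext h)
  have hind := h.indep_count R.card A hA hdisj
  have hexp : ∀ᵐ ω ∂P, Real.exp (-∑' i, |s (η i ω)|) =
      ∏ i, Real.exp (-(|(e i : ℝ)| * (pointCount η (A i) ω).toReal)) := by
    have hfin : ∀ᵐ ω ∂P, ∀ i, pointCount η (A i) ω ≠ ∞ :=
      ae_all_iff.2 fun i => h.ae_pointCount_ne_top (hA i) (hΛ i)
    filter_upwards [hfin] with ω hω
    rw [← Real.exp_sum, Finset.sum_neg_distrib]
    congr 2
    rw [tsum_eq_toReal_tsum_ofReal fun _ => abs_nonneg _]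
    have hpt : ∀ x, ENNReal.ofReal |s x| =
        ∑ i, ENNReal.ofReal |(e i : ℝ)| * (A i).indicator 1 x := by
      intro x
      by_cases hx : s x = 0
      · rw [hx]
        symm
        simp only [abs_zero, ENNReal.ofReal_zero]
        refine Finset.sum_eq_zero fun i _ => ?_
        have : x ∉ A i := fun hxi => hne i (by rw [← hx]; exact hxi.symm)
        simp [this]
      · have hxR : s x ∈ R := Finset.mem_filter.2 ⟨s.mem_range_self x, hx⟩
        rw [Finset.sum_eq_single (e.symm ⟨s x, hxR⟩)]
        · simp [A]
        · intro j _ hj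
          have : x ∉ A j := fun hxi => hj (by
            rw [Equiv.eq_symm_apply]; exact Subtype.ext hxi.symm)
          simp [this]
        · simp
    simp_rw [hpt]
    rw [Summable.tsum_finsetSum fun i _ => ENNReal.summable, ENNReal.toReal_sum]
    · refine Finset.sum_congr rfl fun i _ => ?_
      rw [ENNReal.tsum_mul_left, ← pointCount_eq_tsum η (hA i), ENNReal.toReal_mul,
        ENNReal.toReal_ofReal (abs_nonneg _)]
    · intro i _
      rw [ENNReal.tsum_mul_left, ← pointCount_eq_tsum η (hA i)]
      exact ENNReal.mul_ne_top ENNReal.ofReal_ne_top (hω i)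
  rw [integral_congr_ae hexp]
  have hind' := hind.comp (fun i (x : ℝ≥0∞) => Real.exp (-(|(e i : ℝ)| * x.toReal)))
    (fun i => by fun_prop)
  have hprod := hind'.integral_fun_prod_eq_prod_integral fun i =>
    (Measurable.comp_aemeasurable (by fun_prop)
      (h.law_count (A i) (hA i) (hΛ i)).aemeasurable).aestronglyMeasurable
  simp only [Function.comp_apply] at hprod
  rw [hprod]
  simp_rw [fun i => h.integral_exp_neg_mul_pointCount (hA i) (hΛ i) |(e i : ℝ)|]
  rw [← Real.exp_sum, Finset.sum_neg_distrib]
  congr 2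
  have hg : (fun x => 1 - Real.exp (-|s x|)) = s.map (fun y => 1 - Real.exp (-|y|)) := by
    ext x; simp
  have hgi : Integrable (s.map (fun y => 1 - Real.exp (-|y|))) Λ := by
    refine hs.mono (SimpleFunc.aestronglyMeasurable _) (ae_of_all _ fun x => ?_)
    simp only [SimpleFunc.coe_map, Function.comp_apply, Real.norm_eq_abs]
    rw [abs_of_nonneg (one_sub_exp_neg_nonneg (abs_nonneg _))]
    exact one_sub_exp_neg_le _
  rw [hg, ← SimpleFunc.integral_eq_integral _ hgi, SimpleFunc.map_integral _ _ hs (by simp)]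
  rw [← Finset.sum_filter_of_ne (p := (· ≠ 0)) (s := s.range)]
  · rw [← hR, ← Finset.sum_coe_sort R, ← e.sum_comp]
    rfl
  · rintro y _ hy rfl
    simp at hy

/-- The Laplace functional of a Poisson point process. -/
lemma laplace [SigmaFinite Λ] [IsProbabilityMeasure P] (h : IsPoissonPointProcess η Λ P)
    {f : E → ℝ} (hf : Measurable f) (h0 : ∀ x, 0 ≤ f x) (hi : Integrable f Λ) :
    ∫ ω, Real.exp (-∑' i, f (η i ω)) ∂P = Real.exp (-∫ x, (1 - Real.exp (-f x)) ∂Λ) := by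
  have hmeas : ∀ {g : E → ℝ}, Measurable g → (∀ x, 0 ≤ g x) →
      Integrable (fun ω => Real.exp (-∑' i, g (η i ω))) P := by
    intro g hg hg0
    refine Integrable.of_bound (C := 1) (Measurable.aestronglyMeasurable ?_)
      (ae_of_all _ fun ω => ?_)
    · exact (measurable_tsum_of_nonneg (fun i => hg.comp (h.measurable i))
        (fun i ω => hg0 _)).neg.exp
    · rw [Real.norm_eq_abs, Real.abs_exp, Real.exp_le_one_iff]
      exact neg_nonpos.2 (tsum_nonneg fun i => hg0 _)
  have hint : ∀ {g : E → ℝ}, Measurable g → (∀ x, 0 ≤ g x) → Integrable g Λ →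
      Integrable (fun x => 1 - Real.exp (-g x)) Λ := by
    intro g hg hg0 hgi
    refine hgi.mono (Measurable.aestronglyMeasurable (by fun_prop)) (ae_of_all _ fun x => ?_)
    rw [Real.norm_eq_abs, Real.norm_eq_abs, abs_of_nonneg (one_sub_exp_neg_nonneg (hg0 x)),
      abs_of_nonneg (hg0 x)]
    exact one_sub_exp_neg_le _
  rw [← sub_eq_zero, ← norm_le_zero_iff]
  refine le_of_forall_pos_le_add fun ε hε => ?_
  -- Both sides of the identity are 1-Lipschitz in `f` for the L¹ norm of `Λ`, the left one by
  -- Campbell's formula. Each therefore contributes at most `ε / 2`.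
  obtain ⟨s, hs, hsm⟩ := (memLp_one_iff_integrable.2 hi).exists_simpleFunc_eLpNorm_sub_lt
    (by simp) (ε := ENNReal.ofReal (ε / 2)) (by simpa using hε)
  have hsi : Integrable s Λ := memLp_one_iff_integrable.1 hsm
  rw [eLpNorm_one_eq_lintegral_enorm] at hs
  have hsa : Measurable fun x => |s x| := s.measurable.abs
  have hpt : ∀ x, abs (f x - |s x|) ≤ ‖f x - s x‖ := fun x => by
    conv_lhs => rw [← abs_of_nonneg (h0 x)]
    exact abs_abs_sub_abs_le _ _
  have h1 : ‖∫ ω, Real.exp (-∑' i, f (η i ω)) ∂P - ∫ ω, Real.exp (-∑' i, |s (η i ω)|) ∂P‖ ≤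
      ε / 2 := by
    rw [← integral_sub (hmeas hf h0) (hmeas hsa fun _ => abs_nonneg _)]
    rw [← ENNReal.ofReal_le_ofReal_iff (by positivity), ofReal_norm]
    refine (enorm_integral_le_lintegral_enorm _).trans (le_trans ?_ hs.le)
    rw [← h.lintegral_tsum_eq (f := fun x => ‖(f - ⇑s) x‖ₑ)
      ((hf.sub s.measurable).enorm)]
    refine lintegral_mono_ae ?_
    filter_upwards [h.ae_summable hf h0 hi, h.ae_summable hsa (fun _ => abs_nonneg _) hsi.abs]
      with ω h1 h2
    have h3 := abs_exp_neg_sub_exp_neg_le (a := ∑' i, f (η i ω)) (b := ∑' i, |s (η i ω)|)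
      (tsum_nonneg fun i => h0 (η i ω)) (tsum_nonneg fun i => abs_nonneg (s (η i ω)))
    rw [← h1.tsum_sub h2] at h3
    rw [← ofReal_norm, Real.norm_eq_abs]
    refine (ENNReal.ofReal_le_ofReal h3).trans ?_
    rw [← Real.norm_eq_abs, ofReal_norm]
    refine enorm_tsum_le_tsum_enorm.trans ?_
    refine ENNReal.tsum_le_tsum fun i => ?_
    rw [← ofReal_norm, ← ofReal_norm]
    exact ENNReal.ofReal_le_ofReal (hpt _)
  have h2 : ‖Real.exp (-∫ x, (1 - Real.exp (-|s x|)) ∂Λ) -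
      Real.exp (-∫ x, (1 - Real.exp (-f x)) ∂Λ)‖ ≤ ε / 2 := by
    rw [Real.norm_eq_abs]
    refine (abs_exp_neg_sub_exp_neg_le
      (integral_nonneg fun x => one_sub_exp_neg_nonneg (abs_nonneg _))
      (integral_nonneg fun x => one_sub_exp_neg_nonneg (h0 x))).trans ?_
    rw [← integral_sub (hint hsa (fun _ => abs_nonneg _) hsi.abs) (hint hf h0 hi),
      ← Real.norm_eq_abs, ← ENNReal.ofReal_le_ofReal_iff (by positivity), ofReal_norm]
    refine (enorm_integral_le_lintegral_enorm _).trans (le_trans ?_ hs.le)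
    refine lintegral_mono fun x => ?_
    rw [← ofReal_norm, ← ofReal_norm, Real.norm_eq_abs, sub_sub_sub_cancel_left]
    exact ENNReal.ofReal_le_ofReal ((abs_exp_neg_sub_exp_neg_le (h0 x) (abs_nonneg _)).trans
      (hpt x))
  rw [h.laplace_simpleFunc s hsi] at h1
  have := norm_add_le_of_le h1 h2
  rw [sub_add_sub_cancel] at this
  linarith

end IsPoissonPointProcess

end PoissonPointProcess

/-! ### The cascade sums: convergence, Laplace transform and limit law. -/

section Cascade

open scoped ENNReal NNReal

/-- The weight of the word `π` in terms of the points `a`. -/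
noncomputable def wordWeight {r : ℕ} (π : Fin r → ℕ) (a : List ℕ → ℕ → ℝ) : ℝ :=
  Real.exp (-∑ j : Fin r, a ((List.ofFn π).take j) (π j))

lemma measurable_wordWeight {r : ℕ} (π : Fin r → ℕ) : Measurable (wordWeight π) := by
  unfold wordWeight
  fun_prop

/-- Position `j` reads the process attached to a prefix of length `j < r`. This makes the weights of
words of length `r` independent of the processes attached to these words. -/
lemma wordWeight_congr {r : ℕ} (π : Fin r → ℕ) {a b : List ℕ → ℕ → ℝ}
    (h : Set.EqOn a b {p | p.length < r}) : wordWeight π a = wordWeight π b := by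
  unfold wordWeight
  congr 2
  refine Finset.sum_congr rfl fun j _ => ?_
  rw [h (by simp)]

variable {Ω : Type*} {η : List ℕ → ℕ → Ω → ℝ}

lemma cascadeTerm_pos (η : List ℕ → ℕ → Ω → ℝ) (r : ℕ) (ω : Ω) (π : Fin r → ℕ) :
    0 < cascadeTerm η r ω π := Real.exp_pos _

lemma cascadeTerm_snoc (η : List ℕ → ℕ → Ω → ℝ) (k : ℕ) (ω : Ω) (π : Fin k → ℕ) (i : ℕ) :
    cascadeTerm η (k + 1) ω (Fin.snoc (α := fun _ => ℕ) π i) =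
      cascadeTerm η k ω π * Real.exp (-η (List.ofFn π) i ω) := by
  unfold cascadeTerm
  have h : List.ofFn (Fin.snoc (α := fun _ => ℕ) π i) = List.ofFn π ++ [i] := by
    rw [List.ofFn_succ', List.concat_eq_append]
    simp
  rw [← Real.exp_add, h, Fin.sum_univ_castSucc, neg_add]
  congr 3
  · refine Finset.sum_congr rfl fun j _ => ?_
    rw [Fin.snoc_castSucc, List.take_append_of_le_length (by simp)]
    rfl
  · rw [Fin.snoc_last]
    simp

/-- Splitting off the last letter of a word. -/
def wordEquiv (k : ℕ) : (Fin k → ℕ) × ℕ ≃ (Fin (k + 1) → ℕ) :=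
  (Equiv.prodComm _ _).trans (Fin.snocEquiv (fun _ => ℕ))

lemma wordEquiv_apply (k : ℕ) (p : (Fin k → ℕ) × ℕ) :
    wordEquiv k p = Fin.snoc (α := fun _ => ℕ) p.1 p.2 := rfl

lemma cascadeSum_nonneg (η : List ℕ → ℕ → Ω → ℝ) (r : ℕ) (ω : Ω) : 0 ≤ cascadeSum η r ω :=
  tsum_nonneg fun π => (cascadeTerm_pos η r ω π).le

variable [MeasurableSpace Ω] {P : Measure Ω}

lemma measurable_cascadeTerm (hm : ∀ p i, Measurable (η p i)) (r : ℕ) (π : Fin r → ℕ) :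
    Measurable (fun ω => cascadeTerm η r ω π) := by
  unfold cascadeTerm
  fun_prop

lemma measurable_cascadeSum (hm : ∀ p i, Measurable (η p i)) (r : ℕ) :
    Measurable (cascadeSum η r) :=
  measurable_tsum_of_nonneg (fun π => measurable_cascadeTerm hm r π)
    fun π ω => (cascadeTerm_pos η r ω π).le

lemma indepFun_cascadeSum {η' : List ℕ → ℕ → Ω → ℝ} (hm : ∀ p i, Measurable (η p i))
    (hm' : ∀ p i, Measurable (η' p i)) (hind : iIndepFun
      (fun (q : List ℕ ⊕ List ℕ) (ω : Ω) (i : ℕ) => Sum.elim η η' q i ω) P) (r : ℕ) :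
    IndepFun (cascadeSum η r) (cascadeSum η' r) P := by
  refine iIndepFun_indepFun_of_eqOn hind (S := Set.range Sum.inl) (T := Set.range Sum.inr)
    (φ := fun a => ∑' π : Fin r → ℕ, wordWeight π (fun p => a (Sum.inl p)))
    (ψ := fun a => ∑' π : Fin r → ℕ, wordWeight π (fun p => a (Sum.inr p))) ?_ ?_ ?_ ?_ ?_ ?_
  · rintro (p | p)
    · exact measurable_pi_lambda _ (hm p)
    · exact measurable_pi_lambda _ (hm' p)
  · exact Set.isCompl_range_inl_range_inr.disjoint
  · exact measurable_tsum_of_nonneg (fun π => (measurable_wordWeight π).comp (by fun_prop))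
      fun π a => (Real.exp_pos _).le
  · exact measurable_tsum_of_nonneg (fun π => (measurable_wordWeight π).comp (by fun_prop))
      fun π a => (Real.exp_pos _).le
  · intro a b h
    have : (fun p => a (Sum.inl p)) = fun p => b (Sum.inl p) := funext fun p => h ⟨p, rfl⟩
    simp only [this]
  · intro a b h
    have : (fun p => a (Sum.inr p)) = fun p => b (Sum.inr p) := funext fun p => h ⟨p, rfl⟩
    simp only [this]

lemma lintegral_exp_neg_Ici :
    ∫⁻ x in Set.Ici (0 : ℝ), ENNReal.ofReal (Real.exp (-x)) = 1 := by
  rw [setLIntegral_congr Ioi_ae_eq_Ici.symm, ← ofReal_integral_eq_lintegral_ofReal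
    integrableOn_exp_neg (ae_of_all _ fun x => (Real.exp_pos _).le), integral_exp_neg_Ioi_eq_one]
  simp

variable [IsProbabilityMeasure P]

/-- The expected total weight of the words of length `r` is `1`. -/
lemma lintegral_tsum_cascadeTerm
    (hη : ∀ p, IsPoissonPointProcess (η p) (volume.restrict (Set.Ici (0 : ℝ))) P)
    (hind : iIndepFun (fun p ω i => η p i ω) P) (r : ℕ) :
    ∫⁻ ω, ∑' π, ENNReal.ofReal (cascadeTerm η r ω π) ∂P = 1 := by
  have hm : ∀ p i, Measurable (η p i) := fun p => (hη p).measurable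
  induction r with
  | zero => simp [cascadeTerm]
  | succ k ih =>
    have hsplit : ∀ ω, ∑' π, ENNReal.ofReal (cascadeTerm η (k + 1) ω π) =
        ∑' π : Fin k → ℕ, ENNReal.ofReal (cascadeTerm η k ω π) *
          ∑' i, ENNReal.ofReal (Real.exp (-η (List.ofFn π) i ω)) := by
      intro ω
      rw [← (wordEquiv k).tsum_eq, ENNReal.tsum_prod']
      simp_rw [wordEquiv_apply, cascadeTerm_snoc, ENNReal.ofReal_mul (cascadeTerm_pos _ _ _ _).le,
        ENNReal.tsum_mul_left]
    have hmw := fun π => (measurable_cascadeTerm hm k π).ennreal_ofReal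
    have hmG : ∀ p, Measurable fun ω => ∑' i, ENNReal.ofReal (Real.exp (-η p i ω)) := by
      intro p
      exact Measurable.tsum fun i => (hm p i).neg.exp.ennreal_ofReal
    simp_rw [hsplit]
    rw [lintegral_tsum (f := fun (π : Fin k → ℕ) ω => ENNReal.ofReal (cascadeTerm η k ω π) *
      ∑' i, ENNReal.ofReal (Real.exp (-η (List.ofFn π) i ω)))
      fun π => ((hmw π).mul (hmG _)).aemeasurable]
    rw [lintegral_tsum fun π => (hmw π).aemeasurable] at ih
    rw [← ih]
    refine tsum_congr fun π => ?_
    have hi : IndepFun (fun ω => ENNReal.ofReal (cascadeTerm η k ω π))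
        (fun ω => ∑' i, ENNReal.ofReal (Real.exp (-η (List.ofFn π) i ω))) P := by
      refine iIndepFun_indepFun_of_eqOn hind (fun p => measurable_pi_lambda _ (hm p))
        (S := {p | p.length < k}) (T := {p | p.length = k})
        (φ := fun a => ENNReal.ofReal (wordWeight π a))
        (ψ := fun a => ∑' i, ENNReal.ofReal (Real.exp (-a (List.ofFn π) i))) ?_
        (measurable_wordWeight π).ennreal_ofReal ?_ ?_ ?_
      · rw [Set.disjoint_left]
        intro p h1 h2
        exact h1.ne h2
      · exact Measurable.tsum fun i => by fun_prop
      · intro a b h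
        exact congrArg ENNReal.ofReal (wordWeight_congr π h)
      · intro a b h
        have := h (x := List.ofFn π) (by simp)
        simp only [this]
    rw [lintegral_mul_eq_lintegral_mul_lintegral_of_indepFun'' (hmw π).aemeasurable
      (hmG _).aemeasurable hi, (hη _).lintegral_tsum_eq
      (f := fun x => ENNReal.ofReal (Real.exp (-x))) (by fun_prop), lintegral_exp_neg_Ici, mul_one]

lemma ae_summable_cascadeTerm
    (hη : ∀ p, IsPoissonPointProcess (η p) (volume.restrict (Set.Ici (0 : ℝ))) P)
    (hind : iIndepFun (fun p ω i => η p i ω) P) (r : ℕ) :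
    ∀ᵐ ω ∂P, Summable (cascadeTerm η r ω) := by
  have hm : ∀ p i, Measurable (η p i) := fun p => (hη p).measurable
  have h := lintegral_tsum_cascadeTerm hη hind r
  refine (ae_lt_top (Measurable.tsum fun π => (measurable_cascadeTerm hm r π).ennreal_ofReal)
    (by rw [h]; simp)).mono fun ω hω => ?_
  exact summable_of_tsum_ofReal_ne_top (fun π => (cascadeTerm_pos η r ω π).le) hω.ne

lemma lintegral_cascadeSum_le
    (hη : ∀ p, IsPoissonPointProcess (η p) (volume.restrict (Set.Ici (0 : ℝ))) P)
    (hind : iIndepFun (fun p ω i => η p i ω) P) (r : ℕ) :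
    ∫⁻ ω, ENNReal.ofReal (cascadeSum η r ω) ∂P ≤ 1 := by
  rw [← lintegral_tsum_cascadeTerm hη hind r]
  refine lintegral_mono fun ω => ?_
  rw [cascadeSum, tsum_eq_toReal_tsum_ofReal fun π => (cascadeTerm_pos η r ω π).le]
  exact ENNReal.ofReal_toReal_le

lemma Summable.laplaceExponent_mul {ι : Type*} {w : ι → ℝ} (hw : Summable w) (m : ℕ) (t : ℝ) :
    Summable fun i => laplaceExponent m (t * w i) :=
  Summable.of_nonneg_of_le (fun _ => laplaceExponent_nonneg _ _)
    (fun _ => laplaceExponent_le_abs _ _) (hw.mul_left t).abs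

/-- The recursion for `laplaceExponent` is the Laplace functional evaluated at `laplaceExponent m (s
* exp (-x))`. -/
lemma integral_exp_neg_tsum_laplaceExponent {ζ : ℕ → Ω → ℝ}
    (hζ : IsPoissonPointProcess ζ (volume.restrict (Set.Ici (0 : ℝ))) P) (m : ℕ) (s : ℝ) :
    ∫ ω, Real.exp (-∑' i, laplaceExponent m (s * Real.exp (-ζ i ω))) ∂P =
      Real.exp (-laplaceExponent (m + 1) s) := by
  rw [hζ.laplace (f := fun x => laplaceExponent m (s * Real.exp (-x))) (by fun_prop)
    (fun x => laplaceExponent_nonneg _ _), laplaceExponent_succ, integral_Ici_eq_integral_Ioi]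
  rw [← IntegrableOn, integrableOn_Ici_iff_integrableOn_Ioi]
  refine Integrable.mono' (integrableOn_exp_neg.const_mul |s|) (by fun_prop)
    (ae_of_all _ fun x => ?_)
  rw [Real.norm_eq_abs, abs_of_nonneg (laplaceExponent_nonneg _ _)]
  exact laplaceExponent_mul_exp_le m s x

/-- Given the weights of generation `k`, the offspring of different words are independent, so each
word is averaged separately. Finitely many words are taken so that this is a finite product of
expectations. -/
lemma integral_exp_neg_sum_laplaceExponent_cascade
    (hη : ∀ p, IsPoissonPointProcess (η p) (volume.restrict (Set.Ici (0 : ℝ))) P)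
    (hind : iIndepFun (fun p ω i => η p i ω) P) (k m : ℕ) (t : ℝ) (F : Finset (Fin k → ℕ)) :
    ∫ ω, Real.exp (-∑ π ∈ F, ∑' i, laplaceExponent m
      (t * (cascadeTerm η k ω π * Real.exp (-η (List.ofFn π) i ω)))) ∂P =
    ∫ ω, Real.exp (-∑ π ∈ F, laplaceExponent (m + 1) (t * cascadeTerm η k ω π)) ∂P := by
  have hm : ∀ p i, Measurable (η p i) := fun p => (hη p).measurable
  have hsep : IndepFun (fun ω (π : F) => cascadeTerm η k ω π)
      (fun ω (π : F) i => η (List.ofFn π.1) i ω) P := by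
    refine iIndepFun_indepFun_of_eqOn hind (fun p => measurable_pi_lambda _ (hm p))
        (S := {p | p.length < k}) (T := {p | p.length = k})
        (φ := fun a (π : F) => wordWeight π.1 a)
        (ψ := fun a (π : F) => a (List.ofFn π.1)) ?_
        (measurable_pi_lambda _ fun π => measurable_wordWeight π.1) (by fun_prop) ?_ ?_
    · rw [Set.disjoint_left]
      intro p h1 h2
      exact h1.ne h2
    · intro a b h
      ext π
      exact wordWeight_congr π.1 h
    · intro a b h
      ext1 π
      exact h (by simp)
  have hpre : iIndepFun (fun (π : F) ω i => η (List.ofFn π.1) i ω) P :=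
    hind.precomp (g := fun π : F => List.ofFn π.1)
      (List.ofFn_injective.comp Subtype.val_injective)
  have h := integral_prod_of_indepFun (P := P)
    (measurable_pi_lambda _ fun π : F => measurable_cascadeTerm hm k π.1)
    (fun π => measurable_pi_lambda _ (hm (List.ofFn π.1))) hsep hpre
    (f := fun π x y => Real.exp (-∑' i, laplaceExponent m (t * (x π * Real.exp (-y i)))))
    (fun π => by
      refine (measurable_tsum_of_nonneg (fun i => ?_)
        (fun i x => laplaceExponent_nonneg _ _)).neg.exp
      fun_prop)
    (fun _ _ _ => (Real.exp_pos _).le)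
    (fun _ _ _ => Real.exp_le_one_iff.2
      (neg_nonpos.2 (tsum_nonneg fun i => laplaceExponent_nonneg _ _)))
  convert h using 1
  · refine integral_congr_ae (ae_of_all _ fun ω => ?_)
    dsimp only
    rw [← Real.exp_sum, Finset.sum_neg_distrib, ← Finset.sum_coe_sort F]
  · refine integral_congr_ae (ae_of_all _ fun ω => ?_)
    dsimp only
    simp_rw [← mul_assoc, fun π : F => integral_exp_neg_tsum_laplaceExponent (hη (List.ofFn π.1)) m]
    rw [← Real.exp_sum, Finset.sum_neg_distrib, ← Finset.sum_coe_sort F]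

/-- Integrating out the last generation of points. -/
lemma integral_exp_neg_tsum_laplaceExponent_cascade_succ
    (hη : ∀ p, IsPoissonPointProcess (η p) (volume.restrict (Set.Ici (0 : ℝ))) P)
    (hind : iIndepFun (fun p ω i => η p i ω) P) (k m : ℕ) (t : ℝ) :
    ∫ ω, Real.exp (-∑' π, laplaceExponent m (t * cascadeTerm η (k + 1) ω π)) ∂P =
    ∫ ω, Real.exp (-∑' π, laplaceExponent (m + 1) (t * cascadeTerm η k ω π)) ∂P := by
  have hm : ∀ p i, Measurable (η p i) := fun p => (hη p).measurable
  -- Both sides are limits along finite sets of words of length `k`, by dominated convergence with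
  -- bound 1.
  have h1 : Tendsto (fun F : Finset (Fin k → ℕ) => ∫ ω, Real.exp (-∑ π ∈ F, ∑' i, laplaceExponent m
      (t * (cascadeTerm η k ω π * Real.exp (-η (List.ofFn π) i ω)))) ∂P) atTop
      (𝓝 (∫ ω, Real.exp (-∑' π, laplaceExponent m (t * cascadeTerm η (k + 1) ω π)) ∂P)) := by
    refine tendsto_integral_filter_of_dominated_convergence (fun _ => 1)
      (Eventually.of_forall fun F => Measurable.aestronglyMeasurable ?_)
      (Eventually.of_forall fun F => ae_of_all _ fun ω => ?_) (integrable_const _) ?_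
    · refine (Finset.measurable_sum _ fun π _ => ?_).neg.exp
      refine measurable_tsum_of_nonneg (fun i => ?_) (fun i x => laplaceExponent_nonneg _ _)
      have := measurable_cascadeTerm hm k π
      have := hm (List.ofFn π) i
      fun_prop
    · rw [Real.norm_eq_abs, Real.abs_exp, Real.exp_le_one_iff]
      exact neg_nonpos.2 (Finset.sum_nonneg fun π _ => tsum_nonneg
        fun i => laplaceExponent_nonneg _ _)
    · filter_upwards [ae_summable_cascadeTerm hη hind (k + 1)] with ω hω
      have hs := hω.laplaceExponent_mul m t
      have hs' := (wordEquiv k).summable_iff.2 hs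
      have hsum := (hs'.hasSum.prod_fiberwise fun π => (hs'.prod_factor π).hasSum)
      rw [Function.comp_def, (wordEquiv k).tsum_eq
        (fun π => laplaceExponent m (t * cascadeTerm η (k + 1) ω π))] at hsum
      have hsum' : Tendsto _ atTop _ := hsum
      refine (Real.continuous_exp.tendsto _).comp (Tendsto.neg ?_)
      refine Tendsto.congr (fun F => Finset.sum_congr rfl fun π _ => tsum_congr fun i => ?_) hsum'
      simp only [wordEquiv_apply, cascadeTerm_snoc]
  have h2 : Tendsto (fun F : Finset (Fin k → ℕ) => ∫ ω, Real.exp (-∑ π ∈ F,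
      laplaceExponent (m + 1) (t * cascadeTerm η k ω π)) ∂P) atTop
      (𝓝 (∫ ω, Real.exp (-∑' π, laplaceExponent (m + 1) (t * cascadeTerm η k ω π)) ∂P)) := by
    refine tendsto_integral_filter_of_dominated_convergence (fun _ => 1)
      (Eventually.of_forall fun F => Measurable.aestronglyMeasurable ?_)
      (Eventually.of_forall fun F => ae_of_all _ fun ω => ?_) (integrable_const _) ?_
    · refine (Finset.measurable_sum _ fun π _ => ?_).neg.exp
      have := measurable_cascadeTerm hm k π
      fun_prop
    · rw [Real.norm_eq_abs, Real.abs_exp, Real.exp_le_one_iff]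
      exact neg_nonpos.2 (Finset.sum_nonneg fun π _ => laplaceExponent_nonneg _ _)
    · filter_upwards [ae_summable_cascadeTerm hη hind k] with ω hω
      have hsum : Tendsto _ atTop _ := (hω.laplaceExponent_mul (m + 1) t).hasSum
      exact (Real.continuous_exp.tendsto _).comp hsum.neg
  refine tendsto_nhds_unique h1 (h2.congr fun F => ?_)
  exact (integral_exp_neg_sum_laplaceExponent_cascade hη hind k m t F).symm

/-- Each induction step trades one generation of the cascade for one step of the exponent, which is
why `m` has to vary. -/
lemma integral_exp_neg_tsum_laplaceExponent_cascade
    (hη : ∀ p, IsPoissonPointProcess (η p) (volume.restrict (Set.Ici (0 : ℝ))) P)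
    (hind : iIndepFun (fun p ω i => η p i ω) P) (k m : ℕ) (t : ℝ) :
    ∫ ω, Real.exp (-∑' π, laplaceExponent m (t * cascadeTerm η k ω π)) ∂P =
      Real.exp (-laplaceExponent (m + k) t) := by
  induction k generalizing m with
  | zero => simp [cascadeTerm]
  | succ k ih =>
    rw [integral_exp_neg_tsum_laplaceExponent_cascade_succ hη hind, ih]
    congr 3
    omega

/-- The Laplace transform of the cascade sum. -/
lemma integral_exp_neg_cascadeSum
    (hη : ∀ p, IsPoissonPointProcess (η p) (volume.restrict (Set.Ici (0 : ℝ))) P)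
    (hind : iIndepFun (fun p ω i => η p i ω) P) (r : ℕ) {t : ℝ} (ht : 0 ≤ t) :
    ∫ ω, Real.exp (-(t * cascadeSum η r ω)) ∂P = Real.exp (-laplaceExponent r t) := by
  have h := integral_exp_neg_tsum_laplaceExponent_cascade hη hind r 0 t
  rw [zero_add] at h
  rw [← h]
  refine integral_congr_ae (ae_of_all _ fun ω => ?_)
  simp only [laplaceExponent_zero]
  rw [cascadeSum, ← tsum_mul_left]
  congr 2
  exact tsum_congr fun π => (abs_of_nonneg (mul_nonneg ht (cascadeTerm_pos η r ω π).le)).symm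

lemma integral_expMeasure_one (f : ℝ → ℝ) :
    ∫ x, f x ∂(expMeasure 1) = ∫ x in Set.Ioi (0 : ℝ), Real.exp (-x) * f x := by
  have h : expMeasure 1 = (volume.restrict (Set.Ici (0 : ℝ))).withDensity
      (fun x => ENNReal.ofReal (Real.exp (-x))) := by
    rw [← withDensity_indicator measurableSet_Ici]
    change volume.withDensity (exponentialPDF 1) = _
    congr 1
    ext x
    rw [exponentialPDF_eq]
    by_cases hx : 0 ≤ x <;> simp [Set.indicator, hx]
  rw [h, integral_withDensity_eq_integral_toReal_smul (by fun_prop) (by simp),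
    integral_Ici_eq_integral_Ioi]
  refine integral_congr_ae (ae_of_all _ fun x => ?_)
  simp [(Real.exp_pos _).le]

lemma integral_exp_neg_mul_expMeasure_one {t : ℝ} (ht : 0 ≤ t) :
    ∫ x, Real.exp (-(t * x)) ∂(expMeasure 1) = (1 + t)⁻¹ := by
  rw [integral_expMeasure_one]
  have h := integral_exp_mul_Ioi (a := -(1 + t)) (by linarith) 0
  have h2 : ∀ x : ℝ, Real.exp (-x) * Real.exp (-(t * x)) = Real.exp (-(1 + t) * x) := by
    intro x
    rw [← Real.exp_add]
    congr 1
    ring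
  simp_rw [h2, h]
  simp only [mul_zero, Real.exp_zero]
  rw [neg_div_neg_eq, one_div]

lemma ae_nonneg_expMeasure_one : ∀ᵐ x ∂(expMeasure 1), 0 ≤ x := by
  change ∀ᵐ x ∂(volume.withDensity (exponentialPDF 1)), 0 ≤ x
  have hmeas : Measurable (exponentialPDF 1) := (measurable_exponentialPDFReal 1).ennreal_ofReal
  rw [ae_withDensity_iff hmeas]
  refine ae_of_all _ fun x hx => ?_
  by_contra h
  exact hx (exponentialPDF_of_neg (not_le.1 h))

/-- The cascade sum converges in distribution to a standard exponential variable. -/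
lemma tendstoInDistribution_cascadeSum
    (hη : ∀ p, IsPoissonPointProcess (η p) (volume.restrict (Set.Ici (0 : ℝ))) P)
    (hind : iIndepFun (fun p ω i => η p i ω) P) :
    TendstoInDistribution (fun r => cascadeSum η r) atTop (fun x : ℝ => |x|) (fun _ => P)
      (expMeasure 1) := by
  -- The criterion wants a limit variable that is nonnegative everywhere, hence `|x|`, which equals
  -- `x` almost surely.
  refine tendstoInDistribution_of_tendsto_laplace
    (fun r => (measurable_cascadeSum (fun p => (hη p).measurable) r).aemeasurable) (by fun_prop)
    (fun r ω => cascadeSum_nonneg η r ω) (fun x => abs_nonneg x) 1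
    (fun r => lintegral_cascadeSum_le hη hind r) fun t ht => ?_
  have : ∫ x, Real.exp (-(t * |x|)) ∂(expMeasure 1) = (1 + t)⁻¹ := by
    rw [← integral_exp_neg_mul_expMeasure_one ht]
    refine integral_congr_ae (ae_nonneg_expMeasure_one.mono fun x hx => ?_)
    simp only [abs_of_nonneg hx]
  rw [this]
  simp_rw [fun r => integral_exp_neg_cascadeSum hη hind r ht]
  exact tendsto_exp_neg_laplaceExponent ht

lemma tendstoInDistribution_cascadeSum_prod {η' : List ℕ → ℕ → Ω → ℝ}
    (hη : ∀ p, IsPoissonPointProcess (η p) (volume.restrict (Set.Ici (0 : ℝ))) P)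
    (hη' : ∀ p, IsPoissonPointProcess (η' p) (volume.restrict (Set.Ici (0 : ℝ))) P)
    (hind : iIndepFun
      (fun (q : List ℕ ⊕ List ℕ) (ω : Ω) (i : ℕ) => Sum.elim η η' q i ω) P) :
    TendstoInDistribution
      (fun (r : ℕ) (ω : Ω) => (cascadeSum η r ω, cascadeSum η' r ω)) atTop
      (id : ℝ × ℝ → ℝ × ℝ) (fun _ => P) ((expMeasure 1).prod (expMeasure 1)) := by
  have h1 := tendstoInDistribution_cascadeSum hη (hind.precomp Sum.inl_injective)
  have h2 := tendstoInDistribution_cascadeSum hη' (hind.precomp Sum.inr_injective)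
  -- Replaces the limit variable by a coordinate of the product space, so that both limits live on
  -- one probability space.
  have hlift : ∀ {X : ℕ → Ω → ℝ} (g : ℝ × ℝ → ℝ), Measurable g →
      TendstoInDistribution X atTop (fun x : ℝ => |x|) (fun _ => P) (expMeasure 1) →
      ((expMeasure 1).prod (expMeasure 1)).map g = expMeasure 1 →
      TendstoInDistribution X atTop g (fun _ => P) ((expMeasure 1).prod (expMeasure 1)) := by
    intro X g hg hX hmap
    refine ⟨hX.forall_aemeasurable, hg.aemeasurable, ?_⟩
    have : (expMeasure 1).map (fun x : ℝ => |x|) = expMeasure 1 := by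
      have : (fun x : ℝ => |x|) =ᵐ[expMeasure 1] id :=
        ae_nonneg_expMeasure_one.mono fun x hx => abs_of_nonneg hx
      rw [Measure.map_congr this, Measure.map_id]
    have hlim : (⟨(expMeasure 1).map (fun x : ℝ => |x|), Measure.isProbabilityMeasure_map
        hX.aemeasurable_limit⟩ : ProbabilityMeasure ℝ) =
        ⟨((expMeasure 1).prod (expMeasure 1)).map g, Measure.isProbabilityMeasure_map
          hg.aemeasurable⟩ := Subtype.ext (this.trans hmap.symm)
    exact hlim ▸ hX.tendsto
  have h1' := hlift Prod.fst measurable_fst h1 (by simp)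
  have h2' := hlift Prod.snd measurable_snd h2 (by simp)
  exact tendstoInDistribution_prodMk_of_indepFun h1' h2' (Eventually.of_forall fun r =>
    indepFun_cascadeSum (fun p => (hη p).measurable) (fun p => (hη' p).measurable) hind r)
    (indepFun_prod measurable_id measurable_id)

end Cascade

/-! ### Path weights in the lattice of subsets. -/

section UpEdge

/-- The edges `(v, v ∪ {j})` of the lattice of subsets of `Fin n`. -/
abbrev UpEdge (n : ℕ) : Type := {e : Finset (Fin n) × Fin n // e.2 ∉ e.1}

variable {n : ℕ}

/-- The edge leading from `v \ {j}` to `v ∪ {j}`. -/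
def UpEdge.into (v : Finset (Fin n)) (j : Fin n) : UpEdge n :=
  ⟨(v.erase j, j), Finset.notMem_erase j v⟩

/-- The sum over the directed paths of length `k` from `∅` to `v` of the products of the weights
of their edges. -/
noncomputable def pathWeight : ℕ → (UpEdge n → ℝ) → Finset (Fin n) → ℝ
  | 0, _, v => if v = ∅ then 1 else 0
  | k + 1, a, v => ∑ j ∈ v, pathWeight k a (v.erase j) * a (UpEdge.into v j)

lemma pathWeight_zero (a : UpEdge n → ℝ) (v : Finset (Fin n)) :
    pathWeight 0 a v = if v = ∅ then 1 else 0 := rfl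

lemma pathWeight_succ (k : ℕ) (a : UpEdge n → ℝ) (v : Finset (Fin n)) :
    pathWeight (k + 1) a v = ∑ j ∈ v, pathWeight k a (v.erase j) * a (UpEdge.into v j) := rfl

/-- An edge is determined by its direction and either endpoint. The recursion for `pathWeight` lists
edges by upper endpoint, whereas counting and independence refer to the lower one. -/
lemma sum_sum_upEdge_into (F : UpEdge n → ℝ) :
    ∑ v : Finset (Fin n), ∑ j ∈ v, F (UpEdge.into v j) = ∑ e, F e := by
  rw [Finset.sum_sigma']
  refine Finset.sum_bij' (fun p _ => UpEdge.into p.1 p.2)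
    (fun e _ => ⟨insert e.1.2 e.1.1, e.1.2⟩) ?_ ?_ ?_ ?_ ?_
  · simp
  · simp
  · rintro ⟨v, j⟩ h
    have hj : j ∈ v := by simpa using h
    simp [UpEdge.into, Finset.insert_erase hj]
  · rintro ⟨⟨v, j⟩, h⟩ _
    simp only [UpEdge.into, Finset.erase_insert h]
  · simp

lemma sum_upEdge (F : Finset (Fin n) → Fin n → ℝ) :
    ∑ e : UpEdge n, F e.1.1 e.1.2 = ∑ v : Finset (Fin n), ∑ j ∈ vᶜ, F v j := by
  rw [Finset.sum_sigma']
  refine Finset.sum_bij' (fun e _ => ⟨e.1.1, e.1.2⟩)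
    (fun p hp => ⟨(p.1, p.2), by simpa using hp⟩) ?_ ?_ ?_ ?_ ?_
  · rintro ⟨⟨v, j⟩, h⟩ _
    simpa using h
  all_goals simp

lemma sum_upEdge_fst (G : Finset (Fin n) → ℝ) :
    ∑ e : UpEdge n, G e.1.1 = ∑ v : Finset (Fin n), ((n : ℝ) - v.card) * G v := by
  rw [sum_upEdge (fun v _ => G v)]
  refine Finset.sum_congr rfl fun v _ => ?_
  rw [Finset.sum_const, nsmul_eq_mul, Finset.card_compl, Fintype.card_fin,
    Nat.cast_sub (by simpa using v.card_le_univ)]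

lemma sum_upEdge_fst_le {G : Finset (Fin n) → ℝ} (hG : ∀ v, 0 ≤ G v) :
    ∑ e : UpEdge n, G e.1.1 ≤ n * ∑ v : Finset (Fin n), G v := by
  rw [sum_upEdge_fst, Finset.mul_sum]
  refine Finset.sum_le_sum fun v _ => mul_le_mul_of_nonneg_right ?_ (hG v)
  simp

lemma pathWeight_nonneg {a : UpEdge n → ℝ} (ha : ∀ e, 0 ≤ a e) (k : ℕ) (v : Finset (Fin n)) :
    0 ≤ pathWeight k a v := by
  induction k generalizing v with
  | zero => rw [pathWeight_zero]; split_ifs <;> simp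
  | succ k ih => exact Finset.sum_nonneg fun j _ => mul_nonneg (ih _) (ha _)

lemma pathWeight_eq_zero {k : ℕ} {v : Finset (Fin n)} (hv : v.card ≠ k) (a : UpEdge n → ℝ) :
    pathWeight k a v = 0 := by
  induction k generalizing v with
  | zero => simpa [pathWeight_zero] using hv
  | succ k ih =>
    refine Finset.sum_eq_zero fun j hj => ?_
    rw [ih, zero_mul]
    rw [Finset.card_erase_of_mem hj]
    have := Finset.card_pos.2 ⟨j, hj⟩
    omega

/-- A crude bound, needed only for integrability. -/
lemma pathWeight_le {a : UpEdge n → ℝ} (ha : ∀ e, 0 ≤ a e) (ha1 : ∀ e, a e ≤ 1) (k : ℕ)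
    (v : Finset (Fin n)) : pathWeight k a v ≤ (n : ℝ) ^ k := by
  induction k generalizing v with
  | zero => rw [pathWeight_zero]; split_ifs <;> simp
  | succ k ih =>
    rw [pathWeight_succ]
    refine (Finset.sum_le_card_nsmul v _ ((n : ℝ) ^ k) fun j _ => ?_).trans ?_
    · exact (mul_le_of_le_one_right (pathWeight_nonneg ha _ _) (ha1 _)).trans (ih _)
    · rw [nsmul_eq_mul, pow_succ']
      gcongr
      simpa using v.card_le_univ

/-- Paths of length `k` use only edges starting below level `k`, so the edges leaving level `k` are
fresh randomness. -/
lemma pathWeight_congr {a b : UpEdge n → ℝ} (k : ℕ) (h : Set.EqOn a b {e | e.1.1.card < k}) :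
    pathWeight k a = pathWeight k b := by
  induction k with
  | zero => rfl
  | succ k ih =>
    ext v
    have h1 := ih fun e he => h (Nat.lt_succ_of_lt he)
    rw [pathWeight_succ, pathWeight_succ, h1]
    refine Finset.sum_congr rfl fun j hj => ?_
    by_cases hv : (v.erase j).card = k
    · rw [h (x := UpEdge.into v j)]
      change (v.erase j).card < k + 1
      omega
    · rw [pathWeight_eq_zero hv, zero_mul, zero_mul]

@[fun_prop]
lemma measurable_pathWeight (k : ℕ) (v : Finset (Fin n)) :
    Measurable (fun a : UpEdge n → ℝ => pathWeight k a v) := by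
  induction k generalizing v with
  | zero => exact measurable_const
  | succ k ih =>
    simp only [pathWeight_succ]
    fun_prop

end UpEdge

/-! ### First and second moments of the path weights. -/

section EdgeWeights

variable {Ω : Type*} [MeasurableSpace Ω]

/-- Independent edge weights with values in `[0, 1]`, whose laws satisfy the estimates valid for
the law of `exp (-n ξ)` if `ξ` is a standard exponential variable. -/
structure IsEdgeWeights {n : ℕ} (a : UpEdge n → Ω → ℝ) (P : Measure Ω) : Prop where
  measurable : ∀ e, Measurable (a e)
  nonneg : ∀ e ω, 0 ≤ a e ω
  le_one : ∀ e ω, a e ω ≤ 1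
  indep : iIndepFun a P
  mean_le : ∀ e, ∫ ω, a e ω ∂P ≤ 1 / n
  sq_le : ∀ e, ∫ ω, a e ω ^ 2 ∂P ≤ 1 / n
  laplace : ∀ m e s, 0 ≤ s →
    |1 - ∫ ω, Real.exp (-laplaceExponent m (s * a e ω)) ∂P - laplaceExponent (m + 1) s / n| ≤
      s / n ^ 2

/-- The path weights of a random family of edge weights. -/
noncomputable abbrev randomPathWeight {n : ℕ} (a : UpEdge n → Ω → ℝ) (k : ℕ) (v : Finset (Fin n))
    (ω : Ω) : ℝ := pathWeight k (fun e => a e ω) v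

lemma abs_prod_sub_prod_le {ι : Type*} (s : Finset ι) {f g : ι → ℝ} (hf0 : ∀ i, 0 ≤ f i)
    (hf1 : ∀ i, f i ≤ 1) (hg0 : ∀ i, 0 ≤ g i) (hg1 : ∀ i, g i ≤ 1) :
    |∏ i ∈ s, f i - ∏ i ∈ s, g i| ≤ ∑ i ∈ s, |f i - g i| := by
  classical
  induction s using Finset.induction_on with
  | empty => simp
  | insert i s hi ih =>
    rw [Finset.prod_insert hi, Finset.prod_insert hi, Finset.sum_insert hi]
    have h1 : f i * ∏ j ∈ s, f j - g i * ∏ j ∈ s, g j =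
        (f i - g i) * ∏ j ∈ s, f j + g i * (∏ j ∈ s, f j - ∏ j ∈ s, g j) := by ring
    rw [h1]
    refine (abs_add_le _ _).trans (add_le_add ?_ (le_trans ?_ ih))
    · rw [abs_mul, abs_of_nonneg (Finset.prod_nonneg fun j _ => hf0 j)]
      exact mul_le_of_le_one_right (abs_nonneg _)
        (Finset.prod_le_one (fun j _ => hf0 j) fun j _ => hf1 j)
    · rw [abs_mul, abs_of_nonneg (hg0 i)]
      exact mul_le_of_le_one_left (abs_nonneg _) (hg1 i)

lemma sq_sum_sub_sum_sq {ι : Type*} [DecidableEq ι] (s : Finset ι) (b : ι → ℝ) :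
    (∑ i ∈ s, b i) ^ 2 - ∑ i ∈ s, b i ^ 2 = ∑ i ∈ s, ∑ j ∈ s.erase i, b i * b j := by
  have h : ∀ i ∈ s, ∑ j ∈ s.erase i, b i * b j = b i * ∑ j ∈ s, b j - b i ^ 2 := by
    intro i hi
    rw [← Finset.mul_sum, ← Finset.add_sum_erase s b hi]
    ring
  rw [Finset.sum_congr rfl h, Finset.sum_sub_distrib, ← Finset.sum_mul, sq]

lemma sum_sum_erase_add (n : ℕ) {ι : Type*} [DecidableEq ι] (s : Finset ι) (b : ι → ℝ)
    (hs : s.card = n + 1) :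
    ∑ i ∈ s, ∑ j ∈ s.erase i, (b i + b j) / 2 = n * ∑ i ∈ s, b i := by
  have h : ∀ i ∈ s, ∑ j ∈ s.erase i, (b i + b j) / 2 = ((n - 1) * b i + ∑ j ∈ s, b j) / 2 := by
    intro i hi
    rw [← Finset.sum_div, Finset.sum_add_distrib, Finset.sum_const, Finset.card_erase_of_mem hi, hs,
      nsmul_eq_mul, ← Finset.add_sum_erase s b hi]
    push_cast [Nat.add_sub_cancel]
    ring
  rw [Finset.sum_congr rfl h, ← Finset.sum_div, Finset.sum_add_distrib, ← Finset.mul_sum,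
    Finset.sum_const, hs, nsmul_eq_mul]
  push_cast
  ring

namespace IsEdgeWeights

variable {n : ℕ} {a : UpEdge n → Ω → ℝ} {P : Measure Ω}

lemma pathWeight_nonneg (h : IsEdgeWeights a P) (k : ℕ) (v : Finset (Fin n)) (ω : Ω) :
    0 ≤ randomPathWeight a k v ω := _root_.pathWeight_nonneg (fun e => h.nonneg e ω) k v

lemma measurable_pathWeight (h : IsEdgeWeights a P) (k : ℕ) (v : Finset (Fin n)) :
    Measurable (randomPathWeight a k v) :=
  (_root_.measurable_pathWeight k v).comp (measurable_pi_lambda _ h.measurable)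

lemma pathWeight_le (h : IsEdgeWeights a P) (k : ℕ) (v : Finset (Fin n)) (ω : Ω) :
    randomPathWeight a k v ω ≤ (n : ℝ) ^ k :=
  _root_.pathWeight_le (fun e => h.nonneg e ω) (fun e => h.le_one e ω) k v

lemma indepFun_pathWeight (h : IsEdgeWeights a P) (k : ℕ) {γ δ : Type*} [MeasurableSpace γ]
    [MeasurableSpace δ] {φ : (Finset (Fin n) → ℝ) → γ} {ψ : (UpEdge n → ℝ) → δ} (hφ : Measurable φ)
    (hψ : Measurable ψ) (hψT : ∀ a b, Set.EqOn a b {e | e.1.1.card = k} → ψ a = ψ b) :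
    IndepFun (fun ω => φ (fun v => randomPathWeight a k v ω)) (fun ω => ψ (fun e => a e ω)) P := by
  refine iIndepFun_indepFun_of_eqOn h.indep h.measurable (S := {e | e.1.1.card < k})
    (T := {e | e.1.1.card = k}) (φ := fun a => φ (pathWeight k a)) ?_
    (hφ.comp (measurable_pi_lambda _ fun v => _root_.measurable_pathWeight k v)) hψ ?_ hψT
  · rw [Set.disjoint_left]
    intro e h1 h2
    exact h1.ne h2
  · intro a b hab
    exact congrArg φ (pathWeight_congr k hab)

lemma integral_pathWeight_mul_edge_le (h : IsEdgeWeights a P) (k : ℕ) (e : UpEdge n) :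
    ∫ ω, randomPathWeight a k e.1.1 ω * a e ω ∂P ≤
      1 / n * ∫ ω, randomPathWeight a k e.1.1 ω ∂P := by
  by_cases he : e.1.1.card = k
  · have hi := h.indepFun_pathWeight k (φ := fun w => w e.1.1) (ψ := fun a => a e) (by fun_prop)
      (by fun_prop) (fun a b hab => hab he)
    rw [hi.integral_fun_mul_eq_mul_integral
      (h.measurable_pathWeight k _).aestronglyMeasurable (h.measurable e).aestronglyMeasurable,
      mul_comm]
    exact mul_le_mul_of_nonneg_right (h.mean_le e)
      (integral_nonneg fun ω => h.pathWeight_nonneg k _ ω)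
  · simp [randomPathWeight, pathWeight_eq_zero he]

lemma integral_pathWeight_mul_edge_sq_le (h : IsEdgeWeights a P) (k : ℕ) (e : UpEdge n) :
    ∫ ω, (randomPathWeight a k e.1.1 ω * a e ω) ^ 2 ∂P ≤
      1 / n * ∫ ω, randomPathWeight a k e.1.1 ω ^ 2 ∂P := by
  by_cases he : e.1.1.card = k
  · have hi := h.indepFun_pathWeight k (φ := fun w => w e.1.1 ^ 2) (ψ := fun a => a e ^ 2)
      (by fun_prop) (by fun_prop) (fun a b hab => by simp only [hab (x := e) he])
    simp_rw [mul_pow]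
    rw [hi.integral_fun_mul_eq_mul_integral
      ((h.measurable_pathWeight k _).pow_const 2).aestronglyMeasurable
      ((h.measurable e).pow_const 2).aestronglyMeasurable, mul_comm]
    exact mul_le_mul_of_nonneg_right (h.sq_le e) (integral_nonneg fun ω => sq_nonneg _)
  · simp [randomPathWeight, pathWeight_eq_zero he]

variable [IsProbabilityMeasure P]

lemma integrable_of_bound' {f : Ω → ℝ} (hf : Measurable f) {C : ℝ} (h0 : ∀ ω, 0 ≤ f ω)
    (hC : ∀ ω, f ω ≤ C) : Integrable f P :=
  Integrable.of_bound hf.aestronglyMeasurable C (ae_of_all _ fun ω => by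
    rw [Real.norm_eq_abs, abs_of_nonneg (h0 ω)]; exact hC ω)

lemma integrable_pathWeight (h : IsEdgeWeights a P) (k : ℕ) (v : Finset (Fin n)) :
    Integrable (randomPathWeight a k v) P :=
  integrable_of_bound' (h.measurable_pathWeight k v) (h.pathWeight_nonneg k v) (h.pathWeight_le k v)

lemma integrable_pathWeight_mul (h : IsEdgeWeights a P) (k l : ℕ) (v w : Finset (Fin n)) :
    Integrable (fun ω => randomPathWeight a k v ω * randomPathWeight a l w ω) P :=
  integrable_of_bound' ((h.measurable_pathWeight k v).mul (h.measurable_pathWeight l w))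
    (fun ω => mul_nonneg (h.pathWeight_nonneg k v ω) (h.pathWeight_nonneg l w ω))
    (fun ω => mul_le_mul (h.pathWeight_le k v ω) (h.pathWeight_le l w ω) (h.pathWeight_nonneg l w ω)
      (by positivity))

lemma integrable_pathWeight_sq (h : IsEdgeWeights a P) (k : ℕ) (v : Finset (Fin n)) :
    Integrable (fun ω => randomPathWeight a k v ω ^ 2) P := by
  simpa only [sq] using h.integrable_pathWeight_mul k k v v

lemma integrable_pathWeight_mul_edge (h : IsEdgeWeights a P) (k : ℕ) (v : Finset (Fin n))
    (e : UpEdge n) : Integrable (fun ω => randomPathWeight a k v ω * a e ω) P :=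
  integrable_of_bound' ((h.measurable_pathWeight k v).mul (h.measurable e))
    (fun ω => mul_nonneg (h.pathWeight_nonneg k v ω) (h.nonneg e ω))
    (fun ω => (mul_le_of_le_one_right (h.pathWeight_nonneg k v ω) (h.le_one e ω)).trans
      (h.pathWeight_le k v ω))

/-- The two edge weights are independent of each other and of the path weights, giving `1 / n ^ 2`.
The path weights may be correlated, so their product is bounded by the mean of the squares. -/
lemma integral_pathWeight_mul_edge_mul_le (h : IsEdgeWeights a P) (k : ℕ) {e e' : UpEdge n}
    (hne : e ≠ e') :
    ∫ ω, (randomPathWeight a k e.1.1 ω * a e ω) * (randomPathWeight a k e'.1.1 ω * a e' ω) ∂P ≤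
      1 / n ^ 2 * ((∫ ω, randomPathWeight a k e.1.1 ω ^ 2 ∂P +
        ∫ ω, randomPathWeight a k e'.1.1 ω ^ 2 ∂P) / 2) := by
  have hr : 0 ≤ 1 / (n : ℝ) ^ 2 * ((∫ ω, randomPathWeight a k e.1.1 ω ^ 2 ∂P +
        ∫ ω, randomPathWeight a k e'.1.1 ω ^ 2 ∂P) / 2) := by
    have h1 : 0 ≤ ∫ ω, randomPathWeight a k e.1.1 ω ^ 2 ∂P := integral_nonneg fun ω => sq_nonneg _
    have h2 : 0 ≤ ∫ ω, randomPathWeight a k e'.1.1 ω ^ 2 ∂P := integral_nonneg fun ω => sq_nonneg _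
    positivity
  by_cases he : e.1.1.card = k
  swap
  · simpa [randomPathWeight, pathWeight_eq_zero he] using hr
  by_cases he' : e'.1.1.card = k
  swap
  · simpa [randomPathWeight, pathWeight_eq_zero he'] using hr
  have hi := h.indepFun_pathWeight k (φ := fun w => w e.1.1 * w e'.1.1)
    (ψ := fun a => a e * a e') (by fun_prop) (by fun_prop)
    (fun a b hab => by simp only [hab (x := e) he, hab (x := e') he'])
  have hm := (h.indep.indepFun hne).integral_fun_mul_eq_mul_integral
    (h.measurable e).aestronglyMeasurable (h.measurable e').aestronglyMeasurable
  have hre : ∀ ω, (randomPathWeight a k e.1.1 ω * a e ω) * (randomPathWeight a k e'.1.1 ω * a e' ω) =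
      (randomPathWeight a k e.1.1 ω * randomPathWeight a k e'.1.1 ω) * (a e ω * a e' ω) :=
    fun ω => by ring
  simp_rw [hre]
  rw [hi.integral_fun_mul_eq_mul_integral
    ((h.measurable_pathWeight k _).mul (h.measurable_pathWeight k _)).aestronglyMeasurable
    ((h.measurable e).mul (h.measurable e')).aestronglyMeasurable, hm, mul_comm]
  have hpos : ∀ e, 0 ≤ ∫ ω, a e ω ∂P := fun e => integral_nonneg fun ω => h.nonneg e ω
  refine mul_le_mul ?_ ?_ (integral_nonneg fun ω =>
    mul_nonneg (h.pathWeight_nonneg k _ ω) (h.pathWeight_nonneg k _ ω)) (by positivity)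
  · refine (mul_le_mul (h.mean_le e) (h.mean_le e') (hpos e') (by positivity)).trans (le_of_eq ?_)
    rw [sq, one_div_mul_one_div]
  · rw [← integral_add (h.integrable_pathWeight_sq k _) (h.integrable_pathWeight_sq k _),
      ← integral_div]
    refine integral_mono (h.integrable_pathWeight_mul k k _ _)
      (((h.integrable_pathWeight_sq k _).add (h.integrable_pathWeight_sq k _)).div_const 2)
      fun ω => ?_
    dsimp only
    nlinarith [sq_nonneg (randomPathWeight a k e.1.1 ω - randomPathWeight a k e'.1.1 ω)]

lemma sum_integral_pathWeight_succ_le (h : IsEdgeWeights a P) (k : ℕ) (p : Finset (Fin n) → Prop)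
    [DecidablePred p] :
    ∑ v with p v, ∫ ω, randomPathWeight a (k + 1) v ω ∂P ≤
      ∑ e : UpEdge n, if p (insert e.1.2 e.1.1) then
        1 / n * ∫ ω, randomPathWeight a k e.1.1 ω ∂P else 0 := by
  rw [← sum_sum_upEdge_into, Finset.sum_filter]
  refine Finset.sum_le_sum fun v _ => ?_
  have hins : ∀ j ∈ v, insert (UpEdge.into v j).1.2 (UpEdge.into v j).1.1 = v :=
    fun j hj => Finset.insert_erase hj
  rw [Finset.sum_congr rfl fun j hj => by rw [hins j hj]]
  split_ifs with hp
  · simp only [randomPathWeight, pathWeight_succ]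
    rw [integral_finsetSum _ fun j _ => h.integrable_pathWeight_mul_edge k (v.erase j) _]
    exact Finset.sum_le_sum fun j _ => h.integral_pathWeight_mul_edge_le k (UpEdge.into v j)
  · simp

/-- A vertex has at most `n` outgoing edges, each of mean weight at most `1 / n`, so the total
expected weight does not grow. -/
lemma sum_integral_pathWeight_le (h : IsEdgeWeights a P) (k : ℕ) :
    ∑ v, ∫ ω, randomPathWeight a k v ω ∂P ≤ 1 := by
  induction k with
  | zero => simp [randomPathWeight, pathWeight_zero]
  | succ k ih =>
    have h1 := h.sum_integral_pathWeight_succ_le k (fun _ => True)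
    simp only [Finset.filter_true, if_true] at h1
    rw [← Finset.mul_sum] at h1
    have hpos : ∀ v, 0 ≤ ∫ ω, randomPathWeight a k v ω ∂P :=
      fun v => integral_nonneg fun ω => h.pathWeight_nonneg k v ω
    have h2 := sum_upEdge_fst_le hpos
    obtain rfl | hn := Nat.eq_zero_or_pos n
    · simp only [Nat.cast_zero, div_zero, zero_mul] at h1
      linarith
    have hn' : (0 : ℝ) < n := by exact_mod_cast hn
    refine h1.trans ((mul_le_mul_of_nonneg_left h2 (by positivity)).trans ?_)
    rw [← mul_assoc, one_div, inv_mul_cancel₀ hn'.ne', one_mul]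
    exact ih

/-- Each of the `k` steps switches on the coordinate `c` with expected weight at most `1 / n`, since
a vertex has at most one outgoing edge in direction `c`. -/
lemma sum_integral_pathWeight_mem_le (h : IsEdgeWeights a P) (k : ℕ) (c : Fin n) :
    ∑ v with c ∈ v, ∫ ω, randomPathWeight a k v ω ∂P ≤ k / n := by
  have hn' : (0 : ℝ) < n := by exact_mod_cast c.pos
  induction k with
  | zero =>
    refine le_of_eq ?_
    rw [Nat.cast_zero, zero_div]
    refine Finset.sum_eq_zero fun v hv => ?_
    have : v ≠ ∅ := by
      rintro rfl
      simp at hv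
    simp [randomPathWeight, pathWeight_zero, this]
  | succ k ih =>
    have h1 := h.sum_integral_pathWeight_succ_le k (fun v => c ∈ v)
    refine h1.trans ?_
    set G : Finset (Fin n) → ℝ := fun v => ∫ ω, randomPathWeight a k v ω ∂P with hG
    have hpos : ∀ v, 0 ≤ G v := fun v => integral_nonneg fun ω => h.pathWeight_nonneg k v ω
    -- Either `c` was switched on before the last edge or the last edge does it.
    have h2 : ∑ e : UpEdge n, (if c ∈ insert e.1.2 e.1.1 then 1 / n * G e.1.1 else 0) ≤
        1 / n * (∑ e : UpEdge n, (if c ∈ e.1.1 then G e.1.1 else 0)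
          + ∑ e : UpEdge n, if e.1.2 = c then G e.1.1 else 0) := by
      rw [← Finset.sum_add_distrib, Finset.mul_sum]
      refine Finset.sum_le_sum fun e _ => ?_
      have := hpos e.1.1
      by_cases h1 : c ∈ e.1.1
      · rw [if_pos (Finset.mem_insert_of_mem h1), if_pos h1]
        gcongr
        split_ifs <;> linarith
      · by_cases h2 : e.1.2 = c
        · simp [h2]
          split_ifs
          all_goals nlinarith [inv_pos.2 hn', mul_nonneg (inv_pos.2 hn').le this]
        · have h3 : c ∉ insert e.1.2 e.1.1 := by
            simp only [Finset.mem_insert, not_or]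
            exact ⟨fun h => h2 h.symm, h1⟩
          simp [h1, h2, h3]
    have h3 := sum_upEdge_fst_le (G := fun v => if c ∈ v then G v else 0)
      (fun v => by split_ifs <;> simp [hpos])
    have h4 : ∑ e : UpEdge n, (if e.1.2 = c then G e.1.1 else 0) ≤ 1 := by
      rw [sum_upEdge (fun v j => if j = c then G v else 0)]
      refine le_trans (Finset.sum_le_sum fun v _ => ?_) (h.sum_integral_pathWeight_le k)
      rw [Finset.sum_ite_eq']
      split_ifs
      exacts [le_rfl, hpos v]
    rw [← Finset.sum_filter (s := Finset.univ) (p := fun v => c ∈ v)] at h3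
    refine h2.trans ?_
    have h5 := h3.trans (mul_le_mul_of_nonneg_left ih hn'.le)
    rw [mul_div_cancel₀ _ hn'.ne'] at h5
    calc 1 / (n : ℝ) * (_ + _) ≤ 1 / n * (k + 1) :=
          mul_le_mul_of_nonneg_left (add_le_add h5 h4) (by positivity)
      _ = _ := by push_cast; ring

/-- The expectation of the sum of the products of the weights of two different ways to reach
a vertex. -/
lemma integral_cross_le (h : IsEdgeWeights a P) (k : ℕ) :
    ∑ v, ∫ ω, ((∑ j ∈ v, randomPathWeight a k (v.erase j) ω * a (UpEdge.into v j) ω) ^ 2 -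
      ∑ j ∈ v, (randomPathWeight a k (v.erase j) ω * a (UpEdge.into v j) ω) ^ 2) ∂P ≤
    k / n * ∑ v, ∫ ω, randomPathWeight a k v ω ^ 2 ∂P := by
  set D : Finset (Fin n) → ℝ := fun v => ∫ ω, randomPathWeight a k v ω ^ 2 ∂P with hD
  have hpos : ∀ v, 0 ≤ D v := fun v => integral_nonneg fun ω => sq_nonneg _
  have hone : ∀ v, ∫ ω, ((∑ j ∈ v, randomPathWeight a k (v.erase j) ω * a (UpEdge.into v j) ω) ^ 2 -
      ∑ j ∈ v, (randomPathWeight a k (v.erase j) ω * a (UpEdge.into v j) ω) ^ 2) ∂P ≤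
      k / n ^ 2 * ∑ j ∈ v, D (UpEdge.into v j).1.1 := by
    intro v
    -- Only on level `k + 1` is there any weight. There each of the `k + 1` last edges meets `k`
    -- others, which produces the factor `k`.
    by_cases hv : v.card = k + 1
    · simp_rw [sq_sum_sub_sum_sq]
      have hint : ∀ i j, Integrable (fun ω => randomPathWeight a k (v.erase i) ω *
          a (UpEdge.into v i) ω * (randomPathWeight a k (v.erase j) ω * a (UpEdge.into v j) ω)) P := by
        intro i j
        refine integrable_of_bound' (C := (n : ℝ) ^ k * (n : ℝ) ^ k) ?_ (fun ω => ?_) (fun ω => ?_)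
        · exact ((h.measurable_pathWeight k _).mul (h.measurable _)).mul
            ((h.measurable_pathWeight k _).mul (h.measurable _))
        · exact mul_nonneg (mul_nonneg (h.pathWeight_nonneg _ _ _) (h.nonneg _ _))
            (mul_nonneg (h.pathWeight_nonneg _ _ _) (h.nonneg _ _))
        · refine mul_le_mul ?_ ?_ (mul_nonneg (h.pathWeight_nonneg _ _ _) (h.nonneg _ _))
            (by positivity)
          · exact (mul_le_of_le_one_right (h.pathWeight_nonneg _ _ _) (h.le_one _ _)).trans
              (h.pathWeight_le _ _ _)
          · exact (mul_le_of_le_one_right (h.pathWeight_nonneg _ _ _) (h.le_one _ _)).trans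
              (h.pathWeight_le _ _ _)
      rw [integral_finsetSum _ fun i _ => integrable_finsetSum _ fun j _ => hint i j]
      simp_rw [fun i => integral_finsetSum (μ := P) (v.erase i) fun j _ => hint i j]
      calc _ ≤ ∑ i ∈ v, ∑ j ∈ v.erase i, 1 / (n : ℝ) ^ 2 *
            ((D (UpEdge.into v i).1.1 + D (UpEdge.into v j).1.1) / 2) := by
            refine Finset.sum_le_sum fun i _ => Finset.sum_le_sum fun j hj => ?_
            refine h.integral_pathWeight_mul_edge_mul_le k
              (e := UpEdge.into v i) (e' := UpEdge.into v j) fun he => ?_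
            exact (Finset.ne_of_mem_erase hj) (congrArg (fun e => e.1.2) he).symm
        _ = _ := by
            simp_rw [← Finset.mul_sum]
            rw [sum_sum_erase_add k v _ hv]
            ring
    · have h0 : ∀ ω, ∀ j ∈ v, randomPathWeight a k (v.erase j) ω * a (UpEdge.into v j) ω = 0 := by
        intro ω j hj
        rw [randomPathWeight, pathWeight_eq_zero, zero_mul]
        rw [Finset.card_erase_of_mem hj]
        have := Finset.card_pos.2 ⟨j, hj⟩
        omega
      have h1 : ∀ ω, (∑ j ∈ v, randomPathWeight a k (v.erase j) ω * a (UpEdge.into v j) ω) ^ 2 -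
          ∑ j ∈ v, (randomPathWeight a k (v.erase j) ω * a (UpEdge.into v j) ω) ^ 2 = 0 := by
        intro ω
        rw [Finset.sum_eq_zero (h0 ω), Finset.sum_eq_zero fun j hj => by simp [h0 ω j hj]]
        simp
      simp_rw [h1, integral_zero]
      have := Finset.sum_nonneg fun j (_ : j ∈ v) => hpos (UpEdge.into v j).1.1
      positivity
  refine (Finset.sum_le_sum fun v _ => hone v).trans ?_
  rw [← Finset.mul_sum, sum_sum_upEdge_into (fun e => D e.1.1)]
  refine (mul_le_mul_of_nonneg_left (sum_upEdge_fst_le hpos) (by positivity)).trans (le_of_eq ?_)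
  obtain rfl | hn := Nat.eq_zero_or_pos n
  · simp
  have hn' : (n : ℝ) ≠ 0 := by exact_mod_cast hn.ne'
  field_simp

lemma integrable_pathWeight_mul_edge_sq (h : IsEdgeWeights a P) (k : ℕ) (v : Finset (Fin n))
    (e : UpEdge n) : Integrable (fun ω => (randomPathWeight a k v ω * a e ω) ^ 2) P :=
  integrable_of_bound' (C := ((n : ℝ) ^ k) ^ 2)
    (((h.measurable_pathWeight k v).mul (h.measurable e)).pow_const 2)
    (fun _ => sq_nonneg _)
    (fun ω => pow_le_pow_left₀ (mul_nonneg (h.pathWeight_nonneg k v ω) (h.nonneg e ω))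
      ((mul_le_of_le_one_right (h.pathWeight_nonneg k v ω) (h.le_one e ω)).trans
      (h.pathWeight_le k v ω)) 2)

lemma integrable_cross (h : IsEdgeWeights a P) (k : ℕ) (v : Finset (Fin n)) :
    Integrable (fun ω =>
      (∑ j ∈ v, randomPathWeight a k (v.erase j) ω * a (UpEdge.into v j) ω) ^ 2 -
      ∑ j ∈ v, (randomPathWeight a k (v.erase j) ω * a (UpEdge.into v j) ω) ^ 2) P :=
  (h.integrable_pathWeight_sq (k + 1) v).sub
    (integrable_finsetSum _ fun _ _ => h.integrable_pathWeight_mul_edge_sq k _ _)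

/-- Diagonal terms reproduce the previous second moment and cross terms add at most `k / n` times
it; for `n ≥ 1` the growth factor is at most `k + 1`. -/
lemma sum_integral_pathWeight_sq_le (h : IsEdgeWeights a P) (hn : 1 ≤ n) (k : ℕ) :
    ∑ v, ∫ ω, randomPathWeight a k v ω ^ 2 ∂P ≤ k.factorial := by
  induction k with
  | zero => simp [randomPathWeight, pathWeight_zero]
  | succ k ih =>
    have hn' : (1 : ℝ) ≤ n := by exact_mod_cast hn
    set D : ℝ := ∑ v, ∫ ω, randomPathWeight a k v ω ^ 2 ∂P with hD
    have hD0 : 0 ≤ D := Finset.sum_nonneg fun v _ => integral_nonneg fun ω => sq_nonneg _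
    have h1 := h.integral_cross_le k
    have h2 : ∑ v : Finset (Fin n), ∫ ω,
        ∑ j ∈ v, (randomPathWeight a k (v.erase j) ω * a (UpEdge.into v j) ω) ^ 2 ∂P ≤ D := by
      simp_rw [fun v : Finset (Fin n) => integral_finsetSum (μ := P) v
        fun j _ => h.integrable_pathWeight_mul_edge_sq k (v.erase j) (UpEdge.into v j)]
      calc _ ≤ ∑ v : Finset (Fin n), ∑ j ∈ v, 1 / n *
            ∫ ω, randomPathWeight a k (UpEdge.into v j).1.1 ω ^ 2 ∂P :=
            Finset.sum_le_sum fun v _ => Finset.sum_le_sum fun j _ =>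
              h.integral_pathWeight_mul_edge_sq_le k (UpEdge.into v j)
        _ = 1 / n * ∑ e : UpEdge n, ∫ ω, randomPathWeight a k e.1.1 ω ^ 2 ∂P := by
            simp_rw [← Finset.mul_sum]
            rw [sum_sum_upEdge_into (fun e => ∫ ω, randomPathWeight a k e.1.1 ω ^ 2 ∂P)]
        _ ≤ 1 / n * (n * D) := mul_le_mul_of_nonneg_left
            (sum_upEdge_fst_le (G := fun v => ∫ ω, randomPathWeight a k v ω ^ 2 ∂P)
              fun v => integral_nonneg fun ω => sq_nonneg _) (by positivity)
        _ = D := by field_simp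
    have h3 : ∑ v, ∫ ω, randomPathWeight a (k + 1) v ω ^ 2 ∂P ≤ k / n * D + D := by
      refine le_trans (le_of_eq ?_) (add_le_add h1 h2)
      rw [← Finset.sum_add_distrib]
      refine Finset.sum_congr rfl fun v _ => ?_
      rw [← integral_add (h.integrable_cross k v)
        (integrable_finsetSum _ fun j _ => h.integrable_pathWeight_mul_edge_sq k _ _)]
      simp only [sub_add_cancel]
      rfl
    refine h3.trans ?_
    rw [Nat.factorial_succ]
    push_cast
    have h4 : (k : ℝ) / n ≤ k := div_le_self (by positivity) hn'
    nlinarith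

end IsEdgeWeights

end EdgeWeights

/-! ### The weights `exp (-n ξ)` for exponential `ξ`. -/

section ExponentialEdgeWeights

lemma integral_Ioi_mul_exp_neg : IntegrableOn (fun x : ℝ => x * Real.exp (-x)) (Set.Ioi 0) ∧
    ∫ x in Set.Ioi (0 : ℝ), x * Real.exp (-x) = 1 := by
  have h1 := Real.GammaIntegral_convergent (s := 2) (by norm_num)
  have h2 := Real.Gamma_eq_integral (s := 2) (by norm_num)
  have h3 : ∀ x : ℝ, Real.exp (-x) * x ^ ((2 : ℝ) - 1) = x * Real.exp (-x) := by
    intro x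
    rw [show (2 : ℝ) - 1 = 1 by norm_num, Real.rpow_one, mul_comm]
  simp_rw [h3] at h1 h2
  exact ⟨h1, h2.symm.trans Real.Gamma_two⟩

variable {Ω : Type*} [MeasurableSpace Ω] {P : Measure Ω}

/-- `n * ζ` has density `exp (-(x / n)) / n` on the half-line, which is nearly `1 / n` times
Lebesgue measure: this is where the Poisson intensity comes from. -/
lemma integral_comp_exp_neg_mul {n : ℕ} (hn : 1 ≤ n) {ζ : Ω → ℝ} (hζ : HasLaw ζ (expMeasure 1) P)
    {F : ℝ → ℝ} (hF : Measurable F) :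
    ∫ ω, F (Real.exp (-(n * ζ ω))) ∂P =
      1 / n * ∫ x in Set.Ioi (0 : ℝ), Real.exp (-(x / n)) * F (Real.exp (-x)) := by
  have hn' : (0 : ℝ) < n := by exact_mod_cast hn
  rw [← integral_map (f := fun x => F (Real.exp (-(n * x)))) hζ.aemeasurable
    (Measurable.aestronglyMeasurable (by fun_prop)), hζ.map_eq, integral_expMeasure_one]
  have h := integral_comp_mul_left_Ioi (fun x => Real.exp (-(x / n)) * F (Real.exp (-x))) 0 hn'
  rw [mul_zero, smul_eq_mul, ← one_div] at h
  rw [← h]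
  refine integral_congr_ae (ae_of_all _ fun x => ?_)
  dsimp only
  rw [mul_div_cancel_left₀ _ hn'.ne']

lemma integral_comp_exp_neg_mul_le {n : ℕ} (hn : 1 ≤ n) {ζ : Ω → ℝ}
    (hζ : HasLaw ζ (expMeasure 1) P) {F : ℝ → ℝ} (hF : Measurable F) (hF0 : ∀ x, 0 ≤ F x)
    (hi : IntegrableOn (fun x => F (Real.exp (-x))) (Set.Ioi 0)) :
    ∫ ω, F (Real.exp (-(n * ζ ω))) ∂P ≤ 1 / n * ∫ x in Set.Ioi (0 : ℝ), F (Real.exp (-x)) := by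
  rw [integral_comp_exp_neg_mul hn hζ hF]
  refine mul_le_mul_of_nonneg_left ?_ (by positivity)
  refine integral_mono_of_nonneg (ae_of_all _ fun x => mul_nonneg (Real.exp_pos _).le (hF0 _)) hi ?_
  filter_upwards [ae_restrict_mem measurableSet_Ioi] with x hx
  have hx0 : (0 : ℝ) < x := hx
  exact mul_le_of_le_one_left (hF0 _) (Real.exp_le_one_iff.2 (neg_nonpos.2 (by positivity)))

lemma isEdgeWeights_exp_neg {n : ℕ} {ζ : UpEdge n → Ω → ℝ} (hm : ∀ e, Measurable (ζ e))
    (h0 : ∀ e ω, 0 ≤ ζ e ω) (hlaw : ∀ e, HasLaw (ζ e) (expMeasure 1) P) (hind : iIndepFun ζ P) :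
    IsEdgeWeights (fun e ω => Real.exp (-(n * ζ e ω))) P where
  measurable e := by
    have := hm e
    fun_prop
  nonneg e ω := (Real.exp_pos _).le
  le_one e ω := Real.exp_le_one_iff.2 (neg_nonpos.2 (mul_nonneg (by positivity) (h0 e ω)))
  indep := hind.comp (fun _ x => Real.exp (-(n * x))) fun _ => by fun_prop
  mean_le e := by
    -- `|x|` instead of `x` meets the nonnegativity demanded of `F`.
    have := integral_comp_exp_neg_mul_le e.1.2.pos (hlaw e) (F := fun x => |x|) (by fun_prop)
      abs_nonneg (by simpa using integrableOn_exp_neg)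
    simp only [Real.abs_exp] at this
    rwa [integral_exp_neg_Ioi_eq_one, mul_one] at this
  sq_le e := by
    have := integral_comp_exp_neg_mul_le e.1.2.pos (hlaw e) (F := fun x => x ^ 2) (by fun_prop)
      sq_nonneg integrableOn_exp_neg_two
    refine this.trans ?_
    rw [integral_exp_neg_sq]
    have : (0 : ℝ) ≤ 1 / n := by positivity
    linarith
  laplace m e s hs := by
    have hn := e.1.2.pos
    have hn' : (0 : ℝ) < n := by exact_mod_cast hn
    have := hind.isProbabilityMeasure
    have h1 : 1 - ∫ ω, Real.exp (-laplaceExponent m (s * Real.exp (-(n * ζ e ω)))) ∂P =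
        ∫ ω, (1 - Real.exp (-laplaceExponent m (s * Real.exp (-(n * ζ e ω))))) ∂P := by
      rw [integral_sub (integrable_const _)]
      · simp
      · refine Integrable.of_bound (C := 1) (Measurable.aestronglyMeasurable ?_)
          (ae_of_all _ fun ω => ?_)
        · have := hm e
          fun_prop
        · rw [Real.norm_eq_abs, Real.abs_exp, Real.exp_le_one_iff]
          exact neg_nonpos.2 (laplaceExponent_nonneg _ _)
    rw [h1, integral_comp_exp_neg_mul hn (hlaw e)
      (F := fun y => 1 - Real.exp (-laplaceExponent m (s * y))) (by fun_prop),
      laplaceExponent_succ, div_eq_mul_one_div (∫ x in Set.Ioi (0 : ℝ), _) (n : ℝ),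
      mul_comm _ (1 / (n : ℝ)), ← mul_sub]
    have hi := integrableOn_one_sub_exp_neg_laplaceExponent m s
    have hi' : IntegrableOn (fun x => Real.exp (-(x / n)) *
        (1 - Real.exp (-laplaceExponent m (s * Real.exp (-x))))) (Set.Ioi 0) := by
      refine Integrable.mono hi (by fun_prop) ?_
      filter_upwards [ae_restrict_mem measurableSet_Ioi] with x hx
      have hx0 : (0 : ℝ) < x := hx
      rw [norm_mul]
      refine mul_le_of_le_one_left (norm_nonneg _) ?_
      rw [Real.norm_eq_abs, Real.abs_exp]
      exact Real.exp_le_one_iff.2 (neg_nonpos.2 (by positivity))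
    rw [← integral_sub hi' hi, abs_mul, abs_of_pos (by positivity), ← Real.norm_eq_abs]
    -- Replacing `exp (-(x / n))` by 1 costs at most `x / n`, the other factor is at most `s * exp
    -- (-x)`, and `x * exp (-x)` has integral 1.
    have hb : ‖∫ x in Set.Ioi (0 : ℝ), (Real.exp (-(x / n)) *
        (1 - Real.exp (-laplaceExponent m (s * Real.exp (-x)))) -
        (1 - Real.exp (-laplaceExponent m (s * Real.exp (-x)))))‖ ≤ s / n := by
      refine (norm_integral_le_of_norm_le (integral_Ioi_mul_exp_neg.1.const_mul (s / n)) ?_).trans ?_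
      · filter_upwards [ae_restrict_mem measurableSet_Ioi] with x hx
        have hx0 : (0 : ℝ) < x := hx
        set f := 1 - Real.exp (-laplaceExponent m (s * Real.exp (-x))) with hf
        have hf0 : 0 ≤ f := one_sub_exp_neg_nonneg (laplaceExponent_nonneg _ _)
        have hf1 : f ≤ s * Real.exp (-x) := (one_sub_exp_neg_le _).trans
          (laplaceExponent_le m (by positivity))
        have hx1 : 0 ≤ 1 - Real.exp (-(x / n)) := one_sub_exp_neg_nonneg (by positivity)
        have hx2 : 1 - Real.exp (-(x / n)) ≤ x / n := one_sub_exp_neg_le _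
        have he : Real.exp (-(x / n)) * f - f = -((1 - Real.exp (-(x / n))) * f) := by ring
        rw [he, norm_neg, Real.norm_eq_abs, abs_of_nonneg (mul_nonneg hx1 hf0)]
        refine (mul_le_mul hx2 hf1 hf0 (by positivity)).trans (le_of_eq ?_)
        ring
      · rw [integral_const_mul, integral_Ioi_mul_exp_neg.2, mul_one]
    refine (mul_le_mul_of_nonneg_left hb (by positivity)).trans (le_of_eq ?_)
    field_simp

end ExponentialEdgeWeights

/-! ### The approximate recursion for the path weights. -/

section LaplaceEstimate

namespace IsEdgeWeights

variable {Ω : Type*} [MeasurableSpace Ω] {n : ℕ} {a : UpEdge n → Ω → ℝ} {P : Measure Ω}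

/-- Bound for the error made by integrating out the edges leaving the vertices with `k`
elements. -/
noncomputable def laplaceError (k n : ℕ) (t : ℝ) : ℝ :=
  -- The first summand pays for separating the edges into a common vertex, the parenthesis for
  -- integrating out the edges.
  t ^ 2 * (k / n * k.factorial) + ((1 + k) / n * t + k.factorial / (n - k) * t ^ 2)

lemma tendsto_laplaceError (k : ℕ) (t : ℝ) :
    Tendsto (fun n => laplaceError k n t) atTop (𝓝 0) := by
  have h1 : ∀ c : ℝ, Tendsto (fun n : ℕ => c / (n : ℝ)) atTop (𝓝 0) :=
    fun c => tendsto_const_div_atTop_nhds_zero_nat c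
  have h2 : Tendsto (fun n : ℕ => (k.factorial : ℝ) / ((n : ℝ) - k)) atTop (𝓝 0) :=
    (tendsto_atTop_add_const_right _ (-(k : ℝ)) tendsto_natCast_atTop_atTop).const_div_atTop _
  unfold laplaceError
  have := (((h1 k).mul_const (k.factorial : ℝ)).const_mul (t ^ 2)).add
    (((h1 (1 + k)).mul_const t).add (h2.mul_const (t ^ 2)))
  simpa using this

lemma integrable_exp_neg [IsProbabilityMeasure P] {f : Ω → ℝ} (hf : Measurable f) (h0 : ∀ ω, 0 ≤ f ω) :
    Integrable (fun ω => Real.exp (-f ω)) P :=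
  Integrable.of_bound hf.neg.exp.aestronglyMeasurable 1 (ae_of_all _ fun ω => by
    rw [Real.norm_eq_abs, Real.abs_exp, Real.exp_le_one_iff]
    exact neg_nonpos.2 (h0 ω))

lemma abs_integral_sub_le_of_abs_sub_le {f g b : Ω → ℝ} (hf : Integrable f P) (hg : Integrable g P)
    (hb : Integrable b P) (h : ∀ ω, |f ω - g ω| ≤ b ω) :
    |∫ ω, f ω ∂P - ∫ ω, g ω ∂P| ≤ ∫ ω, b ω ∂P := by
  rw [← integral_sub hf hg, ← Real.norm_eq_abs]
  exact norm_integral_le_of_norm_le hb (ae_of_all _ h)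

variable [IsProbabilityMeasure P]

/-- Different edges leading to the same vertex may be treated separately. -/
lemma abs_integral_sub_integral_edges_le (h : IsEdgeWeights a P) (hn : 1 ≤ n) (k m : ℕ) {t : ℝ}
    (ht : 0 ≤ t) :
    |∫ ω, Real.exp (-∑ v, laplaceExponent m (t * randomPathWeight a (k + 1) v ω)) ∂P -
      ∫ ω, Real.exp (-∑ e : UpEdge n,
        laplaceExponent m (t * (randomPathWeight a k e.1.1 ω * a e ω))) ∂P| ≤
      t ^ 2 * (k / n * k.factorial) := by
  have hmW := h.measurable_pathWeight
  have hma := h.measurable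
  refine (abs_integral_sub_le_of_abs_sub_le
    (b := fun ω => t ^ 2 * ∑ v : Finset (Fin n),
      ((∑ j ∈ v, randomPathWeight a k (v.erase j) ω * a (UpEdge.into v j) ω) ^ 2 -
      ∑ j ∈ v, (randomPathWeight a k (v.erase j) ω * a (UpEdge.into v j) ω) ^ 2))
    (integrable_exp_neg ?_ fun ω => Finset.sum_nonneg fun v _ => laplaceExponent_nonneg _ _)
    (integrable_exp_neg ?_ fun ω => Finset.sum_nonneg fun v _ => laplaceExponent_nonneg _ _)
    ((integrable_finsetSum _ fun v _ => h.integrable_cross k v).const_mul _) fun ω => ?_).trans ?_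
  · exact Finset.measurable_sum _ fun v _ =>
      (measurable_laplaceExponent m).comp ((hmW (k + 1) v).const_mul t)
  · exact Finset.measurable_sum _ fun e _ =>
      (measurable_laplaceExponent m).comp (((hmW k _).mul (hma e)).const_mul t)
  · refine (abs_exp_neg_sub_exp_neg_le (Finset.sum_nonneg fun v _ => laplaceExponent_nonneg _ _)
      (Finset.sum_nonneg fun v _ => laplaceExponent_nonneg _ _)).trans ?_
    rw [← sum_sum_upEdge_into, ← Finset.sum_sub_distrib, Finset.mul_sum]
    refine (Finset.abs_sum_le_sum_abs _ _).trans (Finset.sum_le_sum fun v _ => ?_)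
    have h1 := abs_laplaceExponent_sum_sub_le m v
      (fun j => t * (randomPathWeight a k (v.erase j) ω * a (UpEdge.into v j) ω))
      fun j _ => mul_nonneg ht (mul_nonneg (h.pathWeight_nonneg _ _ _) (h.nonneg _ _))
    simp only [mul_pow t, ← Finset.mul_sum, ← mul_sub] at h1
    exact h1
  · rw [integral_const_mul, integral_finsetSum _ fun v _ => h.integrable_cross k v]
    refine mul_le_mul_of_nonneg_left ((h.integral_cross_le k).trans ?_) (by positivity)
    exact mul_le_mul_of_nonneg_left (h.sum_integral_pathWeight_sq_le hn k) (by positivity)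

lemma sum_level {k : ℕ} {f : UpEdge n → ℝ} (hf : ∀ e, e.1.1.card ≠ k → f e = 0) :
    ∑ e : {e : UpEdge n // e.1.1.card = k}, f e = ∑ e, f e := by
  rw [← Finset.sum_subtype (Finset.univ.filter fun e : UpEdge n => e.1.1.card = k) (by simp) f,
    Finset.sum_filter]
  refine Finset.sum_congr rfl fun e _ => ?_
  split_ifs with he
  exacts [rfl, (hf e he).symm]

lemma sum_level_fst {k : ℕ} {G : Finset (Fin n) → ℝ} (hG : ∀ v, v.card ≠ k → G v = 0) :
    ∑ e : {e : UpEdge n // e.1.1.card = k}, G e.1.1.1 = (n - k) * ∑ v, G v := by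
  rw [sum_level (f := fun e => G e.1.1) fun e he => hG _ he, sum_upEdge_fst, Finset.mul_sum]
  refine Finset.sum_congr rfl fun v _ => ?_
  by_cases hv : v.card = k
  · rw [hv]
  · rw [hG v hv]; simp

/-- The exponent `g / (n - k)` is chosen so that the `n - k` edges leaving a vertex multiply to
exactly `exp (-g)`. The three errors are the given one, the change from `g / n` to `g / (n - k)`,
and the second-order term of the exponential. -/
lemma edge_estimate {k n : ℕ} (hk : k < n) {y g s : ℝ} (hg0 : 0 ≤ g) (hgs : g ≤ s)
    (hy : |1 - y - g / n| ≤ s / n ^ 2) :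
    |y - Real.exp (-(g / (n - k)))| ≤
      s / n ^ 2 + s * k / (n * (n - k)) + s ^ 2 / (n - k) ^ 2 := by
  have hn : (0 : ℝ) < n := by exact_mod_cast (Nat.zero_le k).trans_lt hk
  have hnk : (0 : ℝ) < n - k := by
    rw [sub_pos]
    exact_mod_cast hk
  set x := g / (n - k) with hx
  have hx0 : 0 ≤ x := by positivity
  have h1 : |1 - x - Real.exp (-x)| ≤ x ^ 2 := by
    have h2 := Real.one_sub_le_exp_neg x
    have h3 : Real.exp (-x) ≤ (1 + x)⁻¹ := by
      rw [Real.exp_neg]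
      exact inv_anti₀ (by positivity) (by linarith [Real.add_one_le_exp x])
    have h4 : (1 + x)⁻¹ ≤ 1 - x + x ^ 2 := by
      rw [inv_le_iff_one_le_mul₀ (by positivity)]
      nlinarith [pow_nonneg hx0 3]
    rw [abs_le]
    constructor <;> linarith
  have h2 : x ^ 2 ≤ s ^ 2 / (n - k) ^ 2 := by
    rw [hx, div_pow]
    gcongr
  have h3 : x - g / n = g * k / (n * (n - k)) := by
    rw [hx]
    field_simp
    ring
  have h4 : g * k / (n * (n - k)) ≤ s * k / (n * (n - k)) := by gcongr
  have h5 : 0 ≤ g * k / (n * (n - k)) := by positivity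
  rw [abs_le] at hy h1 ⊢
  constructor <;> linarith [hy.1, hy.2, h1.1, h1.2]

/-- The edges leaving the vertices with `k` elements can be integrated out. -/
lemma abs_integral_edges_sub_integral_le (h : IsEdgeWeights a P) (k m : ℕ) (hk : k < n) {t : ℝ}
    (ht : 0 ≤ t) :
    |∫ ω, Real.exp (-∑ e : UpEdge n,
        laplaceExponent m (t * (randomPathWeight a k e.1.1 ω * a e ω))) ∂P -
      ∫ ω, Real.exp (-∑ v, laplaceExponent (m + 1) (t * randomPathWeight a k v ω)) ∂P| ≤
      (1 + k) / n * t + k.factorial / (n - k) * t ^ 2 := by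
  have hmW := h.measurable_pathWeight
  have hma := h.measurable
  have hn : (0 : ℝ) < n := by exact_mod_cast (Nat.zero_le k).trans_lt hk
  have hnk : (0 : ℝ) < n - k := by
    rw [sub_pos]
    exact_mod_cast hk
  set T := {e : UpEdge n // e.1.1.card = k} with hT
  have hsep : IndepFun (fun ω v => randomPathWeight a k v ω) (fun ω (e : T) => a e.1 ω) P :=
    h.indepFun_pathWeight k (φ := id) (ψ := fun a (e : T) => a e.1) measurable_id (by fun_prop)
      fun a b hab => funext fun e => hab e.2
  have hprod := integral_prod_of_indepFun (P := P)
    (measurable_pi_lambda _ fun v => hmW k v) (fun e : T => hma e.1) hsep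
    (h.indep.precomp (g := fun e : T => e.1) Subtype.val_injective)
    (f := fun e x y => Real.exp (-laplaceExponent m (t * (x e.1.1.1 * y))))
    (fun e => by
      have : Measurable fun p : (Finset (Fin n) → ℝ) × ℝ => p.1 e.1.1.1 := by fun_prop
      exact ((measurable_laplaceExponent m).comp ((this.mul measurable_snd).const_mul t)).neg.exp)
    (fun _ _ _ => (Real.exp_pos _).le)
    (fun _ _ _ => Real.exp_le_one_iff.2 (neg_nonpos.2 (laplaceExponent_nonneg _ _)))
  have hexp1 : ∀ ω, Real.exp (-∑ e : UpEdge n,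
      laplaceExponent m (t * (randomPathWeight a k e.1.1 ω * a e ω))) =
      ∏ e : T, Real.exp (-laplaceExponent m (t * (randomPathWeight a k e.1.1.1 ω * a e.1 ω))) := by
    intro ω
    rw [← Real.exp_sum, Finset.sum_neg_distrib, sum_level
      (f := fun e => laplaceExponent m (t * (randomPathWeight a k e.1.1 ω * a e ω)))]
    intro e he
    rw [randomPathWeight, pathWeight_eq_zero he, zero_mul, mul_zero, laplaceExponent_apply_zero]
  -- Spreading the exponent of a vertex evenly over its outgoing edges makes both sides products
  -- over `T`, to be compared factor by factor.
  have hexp2 : ∀ ω, Real.exp (-∑ v, laplaceExponent (m + 1) (t * randomPathWeight a k v ω)) =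
      ∏ e : T, Real.exp (-(laplaceExponent (m + 1) (t * randomPathWeight a k e.1.1.1 ω) /
        (n - k))) := by
    intro ω
    rw [← Real.exp_sum, Finset.sum_neg_distrib, ← Finset.sum_div, sum_level_fst
      (G := fun v => laplaceExponent (m + 1) (t * randomPathWeight a k v ω)),
      mul_div_cancel_left₀ _ hnk.ne']
    intro v hv
    rw [randomPathWeight, pathWeight_eq_zero hv, mul_zero, laplaceExponent_apply_zero]
  simp_rw [hexp1, hexp2]
  rw [hprod]
  have hψm : ∀ e : T, Measurable fun ω =>
      ∫ ω', Real.exp (-laplaceExponent m (t * (randomPathWeight a k e.1.1.1 ω * a e.1 ω'))) ∂P := by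
    intro e
    have hm1 : Measurable fun p : ℝ × Ω => Real.exp (-laplaceExponent m (t * (p.1 * a e.1 p.2))) := by
      have : Measurable fun p : ℝ × Ω => a e.1 p.2 := (hma e.1).comp measurable_snd
      exact ((measurable_laplaceExponent m).comp
        ((measurable_fst.mul this).const_mul t)).neg.exp
    exact (hm1.stronglyMeasurable.integral_prod_right' (ν := P)).measurable.comp (hmW k e.1.1.1)
  have hψ0 : ∀ (e : T) ω, 0 ≤
      ∫ ω', Real.exp (-laplaceExponent m (t * (randomPathWeight a k e.1.1.1 ω * a e.1 ω'))) ∂P :=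
    fun e ω => integral_nonneg fun ω' => (Real.exp_pos _).le
  have hψ1 : ∀ (e : T) ω,
      ∫ ω', Real.exp (-laplaceExponent m (t * (randomPathWeight a k e.1.1.1 ω * a e.1 ω'))) ∂P ≤ 1 := by
    intro e ω
    have h1 : ∫ _ω : Ω, (1 : ℝ) ∂P = 1 := by simp
    rw [← h1]
    refine integral_mono_of_nonneg (ae_of_all _ fun ω' => (Real.exp_pos _).le)
      (integrable_const _) (ae_of_all _ fun ω' => ?_)
    exact Real.exp_le_one_iff.2 (neg_nonpos.2 (laplaceExponent_nonneg _ _))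
  have he0 : ∀ (e : T) ω, 0 ≤ Real.exp
      (-(laplaceExponent (m + 1) (t * randomPathWeight a k e.1.1.1 ω) / (n - k))) :=
    fun e ω => (Real.exp_pos _).le
  have he1 : ∀ (e : T) ω, Real.exp
      (-(laplaceExponent (m + 1) (t * randomPathWeight a k e.1.1.1 ω) / (n - k))) ≤ 1 :=
    fun e ω => Real.exp_le_one_iff.2
      (neg_nonpos.2 (div_nonneg (laplaceExponent_nonneg _ _) hnk.le))
  have hI : ∀ v, Integrable (fun ω => t * randomPathWeight a k v ω *
      (1 / n ^ 2 + k / (n * (n - k))) + (t * randomPathWeight a k v ω) ^ 2 / (n - k) ^ 2) P := by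
    intro v
    simp_rw [mul_pow]
    exact (((h.integrable_pathWeight k v).const_mul t).mul_const _).add
      (((h.integrable_pathWeight_sq k v).const_mul _).div_const _)
  refine (abs_integral_sub_le_of_abs_sub_le
    (b := fun ω => (n - k) * ∑ v, (t * randomPathWeight a k v ω *
      (1 / n ^ 2 + k / (n * (n - k))) + (t * randomPathWeight a k v ω) ^ 2 / (n - k) ^ 2))
    (integrable_of_bound' (Finset.measurable_prod _ fun e _ => hψm e)
      (fun ω => Finset.prod_nonneg fun e _ => hψ0 e ω)
      (fun ω => Finset.prod_le_one (fun e _ => hψ0 e ω) fun e _ => hψ1 e ω))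
    (integrable_of_bound' (Finset.measurable_prod _ fun e _ => ?_)
      (fun ω => Finset.prod_nonneg fun e _ => he0 e ω)
      (fun ω => Finset.prod_le_one (fun e _ => he0 e ω) fun e _ => he1 e ω))
    ((integrable_finsetSum _ fun v _ => hI v).const_mul _) fun ω => ?_).trans ?_
  · exact (((measurable_laplaceExponent _).comp ((hmW k _).const_mul t)).div_const _).neg.exp
  · refine (abs_prod_sub_prod_le _ (fun e => hψ0 e ω) (fun e => hψ1 e ω) (fun e => he0 e ω)
      (fun e => he1 e ω)).trans ?_
    rw [← sum_level_fst (G := fun v => t * randomPathWeight a k v ω *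
      (1 / n ^ 2 + k / (n * (n - k))) + (t * randomPathWeight a k v ω) ^ 2 / (n - k) ^ 2)]
    · refine Finset.sum_le_sum fun e _ => ?_
      have hs : 0 ≤ t * randomPathWeight a k e.1.1.1 ω := mul_nonneg ht (h.pathWeight_nonneg _ _ _)
      have hl := h.laplace m e.1 _ hs
      simp_rw [mul_assoc t] at hl
      refine (edge_estimate hk (laplaceExponent_nonneg _ _) (laplaceExponent_le _ hs)
        hl).trans (le_of_eq ?_)
      ring
    · intro v hv
      simp [randomPathWeight, pathWeight_eq_zero hv]
  · rw [integral_const_mul, integral_finsetSum _ fun v _ => hI v]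
    have hsplit : ∀ v, ∫ ω, (t * randomPathWeight a k v ω *
        (1 / n ^ 2 + k / (n * (n - k))) + (t * randomPathWeight a k v ω) ^ 2 / (n - k) ^ 2) ∂P =
        t * (1 / n ^ 2 + k / (n * (n - k))) * ∫ ω, randomPathWeight a k v ω ∂P +
        t ^ 2 / (n - k) ^ 2 * ∫ ω, randomPathWeight a k v ω ^ 2 ∂P := by
      intro v
      rw [← integral_const_mul, ← integral_const_mul, ← integral_add
        ((h.integrable_pathWeight k v).const_mul _) ((h.integrable_pathWeight_sq k v).const_mul _)]
      refine integral_congr_ae (ae_of_all _ fun ω => ?_)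
      dsimp only
      ring
    simp_rw [hsplit]
    rw [Finset.sum_add_distrib, ← Finset.mul_sum, ← Finset.mul_sum]
    have hS := h.sum_integral_pathWeight_le k
    have hD := h.sum_integral_pathWeight_sq_le (by omega) k
    have hc : (0 : ℝ) ≤ t * (1 / n ^ 2 + k / (n * (n - k))) := by positivity
    have hc' : (0 : ℝ) ≤ t ^ 2 / (n - k) ^ 2 := by positivity
    refine (mul_le_mul_of_nonneg_left (add_le_add (mul_le_mul_of_nonneg_left hS hc)
      (mul_le_mul_of_nonneg_left hD hc')) hnk.le).trans ?_
    have h1 : ((n : ℝ) - k) * (t * (1 / n ^ 2 + k / (n * (n - k))) * 1) =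
        ((n - k) / n ^ 2 + k / n) * t := by
      field_simp
    have h2 : ((n : ℝ) - k) * (t ^ 2 / (n - k) ^ 2 * k.factorial) =
        k.factorial / (n - k) * t ^ 2 := by
      field_simp
    have h3 : ((n : ℝ) - k) / n ^ 2 ≤ 1 / n := by
      rw [div_le_div_iff₀ (by positivity) hn]
      nlinarith [(Nat.cast_nonneg k : (0 : ℝ) ≤ k)]
    rw [mul_add, h1, h2, add_div]
    gcongr

/-- Each step shortens the paths by one and raises the exponent index by one; at length zero only
`∅` carries weight, namely 1. -/
lemma abs_integral_exp_neg_sub_le (h : IsEdgeWeights a P) (k m : ℕ) (hk : k ≤ n) {t : ℝ}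
    (ht : 0 ≤ t) :
    |∫ ω, Real.exp (-∑ v, laplaceExponent m (t * randomPathWeight a k v ω)) ∂P -
      Real.exp (-laplaceExponent (m + k) t)| ≤ ∑ i ∈ Finset.range k, laplaceError i n t := by
  induction k generalizing m with
  | zero =>
    have h1 : ∀ ω, ∑ v, laplaceExponent m (t * randomPathWeight a 0 v ω) = laplaceExponent m t := by
      intro ω
      rw [Finset.sum_eq_single ∅]
      · simp [randomPathWeight, pathWeight_zero]
      · intro v _ hv
        simp [randomPathWeight, pathWeight_zero, hv, laplaceExponent_apply_zero]
      · simp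
    simp [h1]
  | succ k ih =>
    have h1 := h.abs_integral_sub_integral_edges_le (by omega) k m ht
    have h2 := h.abs_integral_edges_sub_integral_le k m (by omega) ht
    have h3 := ih (m + 1) (by omega)
    rw [Finset.sum_range_succ, show m + (k + 1) = m + 1 + k by omega]
    have h4 := (abs_sub_le _ _ _).trans (add_le_add h1 h2)
    have h5 := (abs_sub_le _ _ _).trans (add_le_add h4 h3)
    rw [laplaceError]
    linarith

end IsEdgeWeights

end LaplaceEstimate

/-! ### Sums over sequences as iterated kernels. -/

section ChainSum

variable {V : Type*} [Fintype V]

/-- The sum over all the sequences `x 0, …, x k = v` of `F (x 0) * ∏ l, c (x l) (x (l + 1))`. -/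
noncomputable def chainSum (F : V → ℝ) (c : V → V → ℝ) : ℕ → V → ℝ
  | 0, v => F v
  | k + 1, v => ∑ u, chainSum F c k u * c u v

/-- The arbitrary test function `H` at the endpoint carries the induction: the last step is absorbed
into it. -/
lemma sum_prod_eq_sum_chainSum (F : V → ℝ) (c : V → V → ℝ) (k : ℕ) (H : V → ℝ) :
    ∑ x : Fin (k + 1) → V, F (x 0) * (∏ l : Fin k, c (x l.castSucc) (x l.succ)) * H (x (Fin.last k)) =
      ∑ v, chainSum F c k v * H v := by
  induction k generalizing H with
  | zero =>
    rw [← (Equiv.funUnique (Fin 1) V).symm.sum_comp]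
    simp [chainSum]
  | succ k ih =>
    rw [← (Fin.snocEquiv fun _ : Fin (k + 2) => V).sum_comp, Fintype.sum_prod_type_right]
    have h := ih fun u => ∑ v, c u v * H v
    have h' : ∑ v, chainSum F c (k + 1) v * H v = ∑ u, chainSum F c k u * ∑ v, c u v * H v := by
      simp_rw [chainSum, Finset.sum_mul, Finset.mul_sum, mul_assoc]
      exact Finset.sum_comm
    rw [h', ← h]
    refine Finset.sum_congr rfl fun x _ => ?_
    simp_rw [Finset.mul_sum]
    refine Finset.sum_congr rfl fun v _ => ?_
    rw [Fin.prod_univ_castSucc]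
    have h0 : (Fin.snocEquiv fun _ : Fin (k + 2) => V) (v, x) 0 = x 0 :=
      Fin.snoc_castSucc (α := fun _ => V) v x 0
    have hs : ∀ i : Fin (k + 1),
        (Fin.snocEquiv fun _ : Fin (k + 2) => V) (v, x) i.castSucc = x i :=
      fun i => Fin.snoc_castSucc (α := fun _ => V) v x i
    have hl : (Fin.snocEquiv fun _ : Fin (k + 2) => V) (v, x) (Fin.last (k + 1)) = v :=
      Fin.snoc_last (α := fun _ => V) v x
    simp only [Fin.succ_last, Fin.succ_castSucc, h0, hs, hl, mul_assoc]

lemma chainSum_eq_pathWeight {n : ℕ} {a : UpEdge n → ℝ} {c : Finset (Fin n) → Finset (Fin n) → ℝ}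
    (hc0 : ∀ t s, (∀ j ∈ s, t ≠ s.erase j) → c t s = 0)
    (hc : ∀ s, ∀ j ∈ s, c (s.erase j) s = a (UpEdge.into s j)) (k : ℕ) (s : Finset (Fin n)) :
    chainSum (fun t => if t = ∅ then 1 else 0) c k s = pathWeight k a s := by
  induction k generalizing s with
  | zero => rfl
  | succ k ih =>
    rw [chainSum, pathWeight_succ]
    simp_rw [ih]
    rw [← Finset.sum_subset (Finset.subset_univ (s.image s.erase))]
    · rw [Finset.sum_image s.erase_injOn]
      exact Finset.sum_congr rfl fun j hj => by rw [hc s j hj]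
    · intro t _ ht
      rw [hc0 t s, mul_zero]
      rintro j hj rfl
      exact ht (Finset.mem_image_of_mem _ hj)

end ChainSum

/-! ### From paths in the hypercube to path weights of subsets. -/

section Cube

variable {n : ℕ}

/-- The vertices of the hypercube correspond to the subsets of `Fin n`. -/
def finsetEquivVertex (n : ℕ) : Finset (Fin n) ≃ Vertex n where
  toFun s i := decide (i ∈ s)
  invFun v := Finset.univ.filter fun i => v i = true
  left_inv s := by ext; simp
  right_inv v := by ext; simp

lemma embed_finsetEquivVertex (s : Finset (Fin n)) (i : Fin n) :
    (finsetEquivVertex n s).embed i = if i ∈ s then 1 else 0 := by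
  simp [finsetEquivVertex, Vertex.embed]

lemma isEdge_finsetEquivVertex_iff {t s : Finset (Fin n)} :
    IsEdge (finsetEquivVertex n t) (finsetEquivVertex n s) ↔ ∃ j ∈ s, t = s.erase j := by
  refine exists_congr fun j => ?_
  simp only [funext_iff, Pi.add_apply, embed_finsetEquivVertex, Pi.single_apply, Finset.ext_iff,
    Finset.mem_erase]
  constructor
  · intro h
    have hj : j ∈ s ∧ j ∉ t := by
      have := h j
      revert this
      by_cases h1 : j ∈ s <;> by_cases h2 : j ∈ t <;> norm_num [h1, h2]
    refine ⟨hj.1, fun i => ?_⟩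
    by_cases hi : i = j
    · simp [hi, hj.2]
    · have := h i
      revert this
      by_cases h1 : i ∈ s <;> by_cases h2 : i ∈ t <;> simp [h1, h2, hi]
  · rintro ⟨hj, h⟩ i
    by_cases hi : i = j
    · subst hi
      simp [h, hj]
    · simp [h, hi]

/-- The edge of the hypercube given by an edge of the lattice of subsets. -/
def UpEdge.toEdge (e : UpEdge n) : Edge n :=
  ⟨(finsetEquivVertex n e.1.1, finsetEquivVertex n (insert e.1.2 e.1.1)),
    isEdge_finsetEquivVertex_iff.2 ⟨e.1.2, Finset.mem_insert_self _ _,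
      (Finset.erase_insert e.2).symm⟩⟩

/-- The edge of the hypercube given by an edge of the lattice of subsets by passing to the
complements. -/
def UpEdge.toDualEdge (e : UpEdge n) : Edge n :=
  ⟨(finsetEquivVertex n (insert e.1.2 e.1.1)ᶜ, finsetEquivVertex n (e.1.1)ᶜ),
    isEdge_finsetEquivVertex_iff.2 ⟨e.1.2, Finset.mem_compl.2 e.2, Finset.compl_insert⟩⟩

lemma UpEdge.toEdge_injective : Function.Injective (UpEdge.toEdge (n := n)) := by
  rintro ⟨⟨s, i⟩, hi⟩ ⟨⟨t, j⟩, hj⟩ h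
  simp only [UpEdge.toEdge, Subtype.mk.injEq, Prod.mk.injEq, EmbeddingLike.apply_eq_iff_eq] at h
  obtain ⟨rfl, h⟩ := h
  rw [Finset.insert_inj hi] at h
  subst h
  rfl

lemma UpEdge.toDualEdge_injective : Function.Injective (UpEdge.toDualEdge (n := n)) := by
  rintro ⟨⟨s, i⟩, hi⟩ ⟨⟨t, j⟩, hj⟩ h
  simp only [UpEdge.toDualEdge, Subtype.mk.injEq, Prod.mk.injEq, EmbeddingLike.apply_eq_iff_eq,
    compl_inj_iff] at h
  obtain ⟨h, rfl⟩ := h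
  rw [Finset.insert_inj hi] at h
  subst h
  rfl

lemma UpEdge.toEdge_into {s : Finset (Fin n)} {j : Fin n} (hj : j ∈ s) :
    (UpEdge.into s j).toEdge.1 = (finsetEquivVertex n (s.erase j), finsetEquivVertex n s) := by
  simp [UpEdge.toEdge, UpEdge.into, Finset.insert_erase hj]

lemma UpEdge.toDualEdge_into {s : Finset (Fin n)} {j : Fin n} (hj : j ∈ s) :
    (UpEdge.into s j).toDualEdge.1 =
      (finsetEquivVertex n sᶜ, finsetEquivVertex n (s.erase j)ᶜ) := by
  simp [UpEdge.toDualEdge, UpEdge.into, Finset.insert_erase hj]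

/-- The number of coordinates of a vertex which are equal to one. -/
def Vertex.card (v : Vertex n) : ℕ := ((finsetEquivVertex n).symm v).card

lemma IsEdge.card_eq {u v : Vertex n} (h : IsEdge u v) : v.card = u.card + 1 := by
  rw [← (finsetEquivVertex n).apply_symm_apply u, ← (finsetEquivVertex n).apply_symm_apply v,
    isEdge_finsetEquivVertex_iff] at h
  obtain ⟨j, hj, h⟩ := h
  rw [Vertex.card, Vertex.card, h, Finset.card_erase_add_one hj]

lemma card_path {r : ℕ} {x : Fin (r + 1) → Vertex n}
    (hx : ∀ l : Fin r, IsEdge (x l.castSucc) (x l.succ)) (i : Fin (r + 1)) :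
    (x i).card = (x 0).card + i := by
  induction i using Fin.induction with
  | zero => simp
  | succ l ih => rw [(hx l).card_eq, ih]; simp [add_assoc]

lemma hammingDist_zero_eq (v : Vertex n) : hammingDist v (Vertex.zero n) = v.card := by
  simp [hammingDist, Vertex.zero, Vertex.card, finsetEquivVertex]

lemma hammingDist_one_add (v : Vertex n) : hammingDist v (Vertex.one n) + v.card = n := by
  have h : hammingDist v (Vertex.one n) = ((finsetEquivVertex n).symm v)ᶜ.card := by
    simp only [hammingDist, Vertex.one, finsetEquivVertex, Equiv.coe_fn_symm_mk]
    congr 1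
    ext i
    simp
  rw [h, Vertex.card, Finset.card_compl_add_card, Fintype.card_fin]

lemma finsetEquivVertex_empty : finsetEquivVertex n ∅ = Vertex.zero n := by
  ext; simp [finsetEquivVertex, Vertex.zero]

lemma finsetEquivVertex_univ : finsetEquivVertex n Finset.univ = Vertex.one n := by
  ext; simp [finsetEquivVertex, Vertex.one]

/-- A difference of zero-one vectors has entries in `{0, 1}` exactly when no entry is `0 - 1`, that
is, when `t` misses `s`. -/
lemma exists_sub_eq_embed_iff (s t : Finset (Fin n)) :
    (∃ w : Vertex n, (finsetEquivVertex n sᶜ).embed - (finsetEquivVertex n t).embed = w.embed) ↔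
      Disjoint t s := by
  rw [Finset.disjoint_left]
  constructor
  · rintro ⟨w, hw⟩ i hi his
    have := congrFun hw i
    rw [Pi.sub_apply, embed_finsetEquivVertex, embed_finsetEquivVertex, if_pos hi,
      if_neg (by simpa using his), Vertex.embed] at this
    split_ifs at this <;> norm_num at this
  · intro h
    refine ⟨finsetEquivVertex n (sᶜ \ t), funext fun i => ?_⟩
    rw [Pi.sub_apply]
    simp only [embed_finsetEquivVertex, Finset.mem_sdiff, Finset.mem_compl]
    have := @h i
    by_cases h1 : i ∈ s <;> by_cases h2 : i ∈ t <;> simp_all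

open scoped Classical in
/-- The weight of a step from `u` to `v`, which is zero if `(u, v)` is not an edge. -/
noncomputable def stepWeight (w : Edge n → ℝ) (u v : Vertex n) : ℝ :=
  if h : IsEdge u v then w ⟨(u, v), h⟩ else 0

lemma stepWeight_coe (w : Edge n → ℝ) (e : Edge n) : stepWeight w e.1.1 e.1.2 = w e :=
  dif_pos e.2

lemma chainSum_stepWeight (w : Edge n → ℝ) (k : ℕ) (s : Finset (Fin n)) :
    chainSum (fun t => if t = ∅ then 1 else 0)
      (fun t s => stepWeight w (finsetEquivVertex n t) (finsetEquivVertex n s)) k s =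
      pathWeight k (fun e => w e.toEdge) s := by
  refine chainSum_eq_pathWeight (fun t s h => dif_neg fun hts => ?_) (fun s j hj => ?_) k s
  · obtain ⟨j, hj, hts⟩ := isEdge_finsetEquivVertex_iff.1 hts
    exact h j hj hts
  · have := stepWeight_coe w (UpEdge.into s j).toEdge
    rwa [UpEdge.toEdge_into hj] at this

lemma chainSum_stepWeight_compl (w : Edge n → ℝ) (k : ℕ) (s : Finset (Fin n)) :
    chainSum (fun t => if t = ∅ then 1 else 0)
      (fun t s => stepWeight w (finsetEquivVertex n sᶜ) (finsetEquivVertex n tᶜ)) k s =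
      pathWeight k (fun e => w e.toDualEdge) s := by
  refine chainSum_eq_pathWeight (fun t s h => dif_neg fun hts => ?_) (fun s j hj => ?_) k s
  · obtain ⟨j, hj, hts⟩ := isEdge_finsetEquivVertex_iff.1 hts
    have hjs : j ∉ t := Finset.mem_compl.1 hj
    rw [← Finset.compl_insert, compl_inj_iff] at hts
    subst hts
    exact h j (Finset.mem_insert_self _ _) (Finset.erase_insert hjs).symm
  · have := stepWeight_coe w (UpEdge.into s j).toDualEdge
    rwa [UpEdge.toDualEdge_into hj] at this

/-- The distance conditions are redundant: every edge raises the number of ones by one, so the fixed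
start and end determine them. -/
lemma isPathPair_of_edges {r : ℕ} {x y : Fin (r + 1) → Vertex n} (hx0 : x 0 = Vertex.zero n)
    (hy1 : y (Fin.last r) = Vertex.one n)
    (hx : ∀ l : Fin r, IsEdge (x l.castSucc) (x l.succ))
    (hy : ∀ l : Fin r, IsEdge (y l.castSucc) (y l.succ))
    (hxy : ∃ w : Vertex n, (y 0).embed - (x (Fin.last r)).embed = w.embed) : IsPathPair x y where
  x_start := hx0
  y_end := hy1
  x_edge := hx
  y_edge := hy
  diff_mem := hxy
  x_dist := by
    rw [hammingDist_zero_eq, card_path hx, hx0, ← hammingDist_zero_eq]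
    simp
  y_dist := by
    have h1 := hammingDist_one_add (y 0)
    have h2 := card_path hy (Fin.last r)
    have h3 := hammingDist_one_add (y (Fin.last r))
    rw [hy1, hammingDist_self] at h3
    rw [hy1, Fin.val_last] at h2
    omega

-- The path conditions become zero-one factors in a sum over all pairs of sequences. The two
-- sequences then interact only through the condition on their inner endpoints.
open scoped Classical in
lemma pathPairSum_eq (r n : ℕ) (ξ : Edge n → ℝ) :
    pathPairSum r n ξ = ∑ v : Finset (Fin n), ∑ w : Finset (Fin n), if Disjoint v w then
      pathWeight r (fun e => Real.exp (-(n * ξ e.toEdge))) v *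
        pathWeight r (fun e => Real.exp (-(n * ξ e.toDualEdge))) w else 0 := by
  set b : Edge n → ℝ := fun e => Real.exp (-(n * ξ e)) with hb
  let A : (Fin (r + 1) → Vertex n) → ℝ := fun x =>
    (if x 0 = Vertex.zero n then 1 else 0) * ∏ l : Fin r, stepWeight b (x l.castSucc) (x l.succ)
  let B : (Fin (r + 1) → Vertex n) → ℝ := fun y =>
    (if y (Fin.last r) = Vertex.one n then 1 else 0) *
      ∏ l : Fin r, stepWeight b (y l.castSucc) (y l.succ)
  let K : Vertex n → Vertex n → ℝ := fun u v =>
    if ∃ w : Vertex n, v.embed - u.embed = w.embed then 1 else 0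
  have h1 : pathPairSum r n ξ = ∑ p : (Fin (r + 1) → Vertex n) × (Fin (r + 1) → Vertex n),
      A p.1 * (B p.2 * K (p.1 (Fin.last r)) (p.2 0)) := by
    rw [pathPairSum, ← Finset.sum_subset (Finset.subset_univ (Finset.univ.filter
      fun p : (Fin (r + 1) → Vertex n) × (Fin (r + 1) → Vertex n) => IsPathPair p.1 p.2)),
      Finset.sum_subtype 
        (p := fun p : (Fin (r + 1) → Vertex n) × (Fin (r + 1) → Vertex n) => IsPathPair p.1 p.2) _ (by simp)]
    · refine Finset.sum_congr rfl fun p _ => ?_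
      have hA : A p.1.1 = ∏ l, b (p.xEdge l) := by
        simp only [A]
        rw [if_pos p.2.x_start, one_mul]
        exact Finset.prod_congr rfl fun l _ => stepWeight_coe b (p.xEdge l)
      have hB : B p.1.2 = ∏ l, b (p.yEdge l) := by
        simp only [B]
        rw [if_pos p.2.y_end, one_mul]
        exact Finset.prod_congr rfl fun l _ => stepWeight_coe b (p.yEdge l)
      have hK : K (p.1.1 (Fin.last r)) (p.1.2 0) = 1 := if_pos p.2.diff_mem
      rw [hA, hB, hK, mul_one, hb, ← Real.exp_sum, ← Real.exp_sum, ← Real.exp_add,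
        ← Finset.sum_add_distrib, Finset.mul_sum]
      congr 1
      exact Finset.sum_congr rfl fun l _ => by ring
    · rintro ⟨x, y⟩ _ hp
      by_contra h
      simp only [A, B, K, mul_eq_zero, not_or, Finset.prod_eq_zero_iff, not_exists, ite_eq_right_iff,
        one_ne_zero, imp_false, not_not, Finset.mem_univ, true_and] at h
      have hne : ∀ {u v}, stepWeight b u v ≠ 0 → IsEdge u v := fun h => by
        by_contra h'
        exact h (dif_neg h')
      refine hp (Finset.mem_filter.2 ⟨Finset.mem_univ _, isPathPair_of_edges h.1.1 h.2.1.1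
        (fun l => hne (h.1.2 l)) (fun l => hne (h.2.1.2 l)) ?_⟩)
      exact not_forall_not.1 h.2.2
  have hA : ∀ H : Vertex n → ℝ, ∑ x, A x * H (x (Fin.last r)) =
      ∑ v, pathWeight r (fun e => b e.toEdge) v * H (finsetEquivVertex n v) := by
    intro H
    simp_rw [← chainSum_stepWeight b r]
    rw [← sum_prod_eq_sum_chainSum _ _ r (fun v => H (finsetEquivVertex n v)),
      ← (Equiv.arrowCongr (Equiv.refl (Fin (r + 1))) (finsetEquivVertex n)).sum_comp]
    refine Finset.sum_congr rfl fun x _ => ?_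
    simp [A, ← finsetEquivVertex_empty, Equiv.arrowCongr]
  -- Reversing time and complementing turns a path ending at the full set into one starting at `∅`.
  have hB : ∀ H : Vertex n → ℝ, ∑ y, B y * H (y 0) =
      ∑ v, pathWeight r (fun e => b e.toDualEdge) v * H (finsetEquivVertex n vᶜ) := by
    intro H
    simp_rw [← chainSum_stepWeight_compl b r]
    rw [← sum_prod_eq_sum_chainSum _ _ r (fun v => H (finsetEquivVertex n vᶜ)),
      ← (Equiv.arrowCongr (Fin.revPerm (n := r + 1))
        ((Function.Involutive.toPerm _ compl_involutive).trans (finsetEquivVertex n))).sum_comp]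
    refine Finset.sum_congr rfl fun x _ => ?_
    have hprod := Equiv.prod_comp (Fin.revPerm (n := r)) fun l : Fin r =>
      stepWeight b (finsetEquivVertex n (x l.succ)ᶜ) (finsetEquivVertex n (x l.castSucc)ᶜ)
    rw [← hprod]
    simp [B, ← finsetEquivVertex_univ, Equiv.arrowCongr, Fin.rev_castSucc, Fin.rev_succ]
  rw [h1, Fintype.sum_prod_type]
  simp_rw [← Finset.mul_sum]
  have h2 := hA fun u => ∑ y, B y * K u (y 0)
  refine h2.trans (Finset.sum_congr rfl fun v _ => ?_)
  rw [hB fun y => K (finsetEquivVertex n v) y, Finset.mul_sum]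
  refine Finset.sum_congr rfl fun w _ => ?_
  simp only [K, exists_sub_eq_embed_iff]
  split_ifs <;> simp [hb]

end Cube

/-! ### Limit of a single path sum, and the cost of dropping disjointness. -/

namespace IsEdgeWeights

section Limit

variable {Ω : ℕ → Type*} [∀ n, MeasurableSpace (Ω n)] {P : ∀ n, Measure (Ω n)}
  [∀ n, IsProbabilityMeasure (P n)] {a : ∀ n, UpEdge n → Ω n → ℝ}
  {Ω' : Type*} [MeasurableSpace Ω'] {P' : Measure Ω'} [IsProbabilityMeasure P']
  {η : List ℕ → ℕ → Ω' → ℝ}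

/-- The approximate recursion started at `m = 0`, where the exponent is the identity on nonnegative
numbers, ends at the Laplace transform of the cascade sum. -/
lemma tendstoInDistribution_sum_pathWeight (h : ∀ n, IsEdgeWeights (a n) (P n))
    (hη : ∀ p, IsPoissonPointProcess (η p) (volume.restrict (Set.Ici (0 : ℝ))) P')
    (hind : iIndepFun (fun p (ω : Ω') (i : ℕ) => η p i ω) P') (r : ℕ) :
    TendstoInDistribution (fun n ω => ∑ v, randomPathWeight (a n) r v ω) atTop (cascadeSum η r)
      P P' := by
  have hm : ∀ n, Measurable fun ω => ∑ v, randomPathWeight (a n) r v ω :=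
    fun n => Finset.measurable_sum _ fun v _ => (h n).measurable_pathWeight r v
  have h0 : ∀ n ω, 0 ≤ ∑ v, randomPathWeight (a n) r v ω :=
    fun n ω => Finset.sum_nonneg fun v _ => (h n).pathWeight_nonneg r v ω
  refine tendstoInDistribution_of_tendsto_laplace (fun n => (hm n).aemeasurable)
    (measurable_cascadeSum (fun p => (hη p).measurable) r).aemeasurable h0
    (cascadeSum_nonneg η r) 1 (fun n => ?_) fun t ht => ?_
  · rw [← ofReal_integral_eq_lintegral_ofReal
      (integrable_finsetSum _ fun v _ => (h n).integrable_pathWeight r v)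
      (ae_of_all _ (h0 n)), integral_finsetSum _ fun v _ => (h n).integrable_pathWeight r v]
    exact ENNReal.ofReal_le_one.2 ((h n).sum_integral_pathWeight_le r)
  · rw [integral_exp_neg_cascadeSum hη hind r ht, tendsto_iff_norm_sub_tendsto_zero]
    have hlim : Tendsto (fun n => ∑ i ∈ Finset.range r, laplaceError i n t) atTop (𝓝 0) := by
      simpa using tendsto_finsetSum (Finset.range r) fun i _ => tendsto_laplaceError i t
    refine squeeze_zero' (Eventually.of_forall fun n => norm_nonneg _) ?_ hlim
    filter_upwards [eventually_ge_atTop r] with n hn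
    have := (h n).abs_integral_exp_neg_sub_le r 0 hn ht
    rw [zero_add] at this
    refine le_trans (le_of_eq ?_) this
    rw [Real.norm_eq_abs]
    have h1 : ∀ ω, ∑ v, laplaceExponent 0 (t * randomPathWeight (a n) r v ω) =
        t * ∑ v, randomPathWeight (a n) r v ω := fun ω => by
      rw [Finset.mul_sum]
      refine Finset.sum_congr rfl fun v _ => ?_
      rw [laplaceExponent_zero, abs_of_nonneg (mul_nonneg ht ((h n).pathWeight_nonneg r v ω))]
    simp_rw [h1]

end Limit

section Disjoint

variable {Ω : Type*} [MeasurableSpace Ω] {P : Measure Ω} [IsProbabilityMeasure P] {n r : ℕ}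
  {a a' : UpEdge n → Ω → ℝ}

lemma integrable_pathWeight_mul_pathWeight (h : IsEdgeWeights a P) (h' : IsEdgeWeights a' P)
    (v w : Finset (Fin n)) :
    Integrable (fun ω => randomPathWeight a r v ω * randomPathWeight a' r w ω) P :=
  integrable_of_bound' ((h.measurable_pathWeight r v).mul (h'.measurable_pathWeight r w))
    (fun ω => mul_nonneg (h.pathWeight_nonneg r v ω) (h'.pathWeight_nonneg r w ω))
    (fun ω => mul_le_mul (h.pathWeight_le r v ω) (h'.pathWeight_le r w ω)
      (h'.pathWeight_nonneg r w ω) (by positivity))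

lemma sum_disjoint_sub_eq (f g : Finset (Fin n) → ℝ) :
    (∑ v, ∑ w, if Disjoint v w then f v * g w else 0) - (∑ v, f v) * ∑ w, g w =
      -∑ v, ∑ w, if Disjoint v w then 0 else f v * g w := by
  rw [Finset.sum_mul_sum, ← Finset.sum_sub_distrib, ← Finset.sum_neg_distrib]
  refine Finset.sum_congr rfl fun v _ => ?_
  rw [← Finset.sum_sub_distrib, ← Finset.sum_neg_distrib]
  refine Finset.sum_congr rfl fun w _ => ?_
  split_ifs <;> simp

/-- A union bound over the common coordinate. -/
lemma sum_not_disjoint_le {f g : Finset (Fin n) → ℝ} (hf : ∀ v, 0 ≤ f v) (hg : ∀ v, 0 ≤ g v) :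
    ∑ v, ∑ w, (if Disjoint v w then 0 else f v * g w) ≤
      ∑ c : Fin n, ∑ v with c ∈ v, ∑ w with c ∈ w, f v * g w := by
  simp_rw [Finset.sum_filter]
  rw [Finset.sum_comm (s := (Finset.univ : Finset (Fin n)))]
  refine Finset.sum_le_sum fun v _ => ?_
  have h1 : ∀ c, (if c ∈ v then ∑ w, if c ∈ w then f v * g w else 0 else 0) =
      ∑ w, if c ∈ v ∧ c ∈ w then f v * g w else 0 := by
    intro c
    by_cases hc : c ∈ v <;> simp [hc]
  simp_rw [h1]
  rw [Finset.sum_comm (s := (Finset.univ : Finset (Fin n)))]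
  refine Finset.sum_le_sum fun w _ => ?_
  have h2 : ∀ c, 0 ≤ if c ∈ v ∧ c ∈ w then f v * g w else 0 := fun c => by
    split_ifs
    exacts [mul_nonneg (hf v) (hg w), le_rfl]
  split_ifs with hd
  · exact Finset.sum_nonneg fun c _ => h2 c
  · obtain ⟨c, hcv, hcw⟩ := Finset.not_disjoint_iff.1 hd
    refine le_trans (le_of_eq ?_) (Finset.single_le_sum (fun c _ => h2 c) (Finset.mem_univ c))
    rw [if_pos ⟨hcv, hcw⟩]

lemma integrable_sum_disjoint_sub (h : IsEdgeWeights a P) (h' : IsEdgeWeights a' P) :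
    Integrable (fun ω => (∑ v, ∑ w, if Disjoint v w then
      randomPathWeight a r v ω * randomPathWeight a' r w ω else 0) -
      (∑ v, randomPathWeight a r v ω) * ∑ w, randomPathWeight a' r w ω) P := by
  simp_rw [sum_disjoint_sub_eq]
  refine (integrable_finsetSum _ fun v _ => integrable_finsetSum _ fun w _ => ?_).neg
  split_ifs
  exacts [integrable_zero _ _ _, h.integrable_pathWeight_mul_pathWeight h' v w]

/-- By independence a given coordinate is shared with expected weight at most `(r / n) ^ 2`, and
there are `n` coordinates. -/
lemma integral_abs_sum_disjoint_sub_le (h : IsEdgeWeights a P) (h' : IsEdgeWeights a' P)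
    (hI : IndepFun (fun ω v => randomPathWeight a r v ω) (fun ω v => randomPathWeight a' r v ω) P) :
    ∫ ω, |(∑ v, ∑ w, if Disjoint v w then
      randomPathWeight a r v ω * randomPathWeight a' r w ω else 0) -
      (∑ v, randomPathWeight a r v ω) * ∑ w, randomPathWeight a' r w ω| ∂P ≤ r ^ 2 / n := by
  have hW := h.integrable_pathWeight_mul_pathWeight (r := r) h'
  have hW0 : ∀ v w ω, 0 ≤ randomPathWeight a r v ω * randomPathWeight a' r w ω :=
    fun v w ω => mul_nonneg (h.pathWeight_nonneg r v ω) (h'.pathWeight_nonneg r w ω)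
  have h1 : ∫ ω, |(∑ v, ∑ w, if Disjoint v w then
      randomPathWeight a r v ω * randomPathWeight a' r w ω else 0) -
      (∑ v, randomPathWeight a r v ω) * ∑ w, randomPathWeight a' r w ω| ∂P ≤
      ∫ ω, ∑ c : Fin n, ∑ v with c ∈ v, ∑ w with c ∈ w,
        randomPathWeight a r v ω * randomPathWeight a' r w ω ∂P := by
    refine integral_mono (h.integrable_sum_disjoint_sub h').abs (integrable_finsetSum _ fun c _ =>
      integrable_finsetSum _ fun v _ => integrable_finsetSum _ fun w _ => hW v w) fun ω => ?_
    dsimp only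
    rw [sum_disjoint_sub_eq, abs_neg, abs_of_nonneg]
    · exact sum_not_disjoint_le (fun v => h.pathWeight_nonneg r v ω)
        (fun w => h'.pathWeight_nonneg r w ω)
    · refine Finset.sum_nonneg fun v _ => Finset.sum_nonneg fun w _ => ?_
      split_ifs
      exacts [le_rfl, hW0 v w ω]
  refine h1.trans ?_
  rw [integral_finsetSum _ fun c _ => integrable_finsetSum _ fun v _ =>
    integrable_finsetSum _ fun w _ => hW v w]
  have h2 : ∀ c : Fin n, ∫ ω, ∑ v with c ∈ v, ∑ w with c ∈ w,
      randomPathWeight a r v ω * randomPathWeight a' r w ω ∂P ≤ r / n * (r / n) := by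
    intro c
    rw [integral_finsetSum _ fun v _ => integrable_finsetSum _ fun w _ => hW v w]
    simp_rw [fun v => integral_finsetSum (μ := P) (Finset.univ.filter fun w => c ∈ w)
      fun w _ => hW v w]
    have h3 : ∀ v w, ∫ ω, randomPathWeight a r v ω * randomPathWeight a' r w ω ∂P =
        (∫ ω, randomPathWeight a r v ω ∂P) * ∫ ω, randomPathWeight a' r w ω ∂P := by
      intro v w
      have hi := hI.comp (measurable_pi_apply v) (measurable_pi_apply w)
      exact hi.integral_fun_mul_eq_mul_integral (h.measurable_pathWeight r v).aestronglyMeasurable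
        (h'.measurable_pathWeight r w).aestronglyMeasurable
    simp_rw [h3]
    rw [← Finset.sum_mul_sum]
    exact mul_le_mul (h.sum_integral_pathWeight_mem_le r c) (h'.sum_integral_pathWeight_mem_le r c)
      (Finset.sum_nonneg fun v _ => integral_nonneg fun ω => h'.pathWeight_nonneg r v ω)
      (by positivity)
  refine (Finset.sum_le_sum fun c _ => h2 c).trans (le_of_eq ?_)
  rw [Finset.sum_const, Finset.card_univ, Fintype.card_fin, nsmul_eq_mul]
  obtain rfl | hn := Nat.eq_zero_or_pos n
  · simp
  field_simp

end Disjoint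

end IsEdgeWeights

/-! ### Independence of the two ends of the cube and the limit of the pair sum. -/

section PathPairSum

lemma UpEdge.card_toEdge {n : ℕ} (e : UpEdge n) : e.toEdge.1.1.card = e.1.1.card := by
  simp [UpEdge.toEdge, Vertex.card]

lemma UpEdge.card_toDualEdge {n : ℕ} (e : UpEdge n) :
    e.toDualEdge.1.1.card + (e.1.1.card + 1) = n := by
  rw [← Finset.card_insert_of_notMem e.2]
  simp only [UpEdge.toDualEdge, Vertex.card, Equiv.symm_apply_apply]
  rw [Finset.card_compl_add_card, Fintype.card_fin]

/-- Edges near `0` start below level `r`; those near `1` start at level at least `n - r`, which is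
at least `r` under `hn`. -/
lemma indepFun_randomPathWeight_dual {Ω : Type*} [MeasurableSpace Ω] {P : Measure Ω} {n r : ℕ}
    {ζ : Edge n → Ω → ℝ} (hm : ∀ e, Measurable (ζ e)) (hind : iIndepFun ζ P) (hn : 2 * r ≤ n) :
    IndepFun
      (fun ω v => randomPathWeight (fun (e : UpEdge n) ω => Real.exp (-(n * ζ e.toEdge ω))) r v ω)
      (fun ω v => randomPathWeight (fun (e : UpEdge n) ω => Real.exp (-(n * ζ e.toDualEdge ω)))
        r v ω) P := by
  refine iIndepFun_indepFun_of_eqOn hind hm (S := {e | e.1.1.card < r}) (T := {e | r ≤ e.1.1.card})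
    (φ := fun x => pathWeight r fun e => Real.exp (-(n * x e.toEdge)))
    (ψ := fun x => pathWeight r fun e => Real.exp (-(n * x e.toDualEdge))) ?_ ?_ ?_ ?_ ?_
  · rw [Set.disjoint_left]
    intro e h1 h2
    exact (not_lt.2 (show r ≤ e.1.1.card from h2)) h1
  · exact measurable_pi_lambda _ fun v => (measurable_pathWeight r v).comp (by fun_prop)
  · exact measurable_pi_lambda _ fun v => (measurable_pathWeight r v).comp (by fun_prop)
  · intro x y hxy
    refine pathWeight_congr r fun e he => ?_
    have : x e.toEdge = y e.toEdge := hxy (e.card_toEdge.trans_lt he)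
    rw [this]
  · intro x y hxy
    refine pathWeight_congr r fun e he => ?_
    have he' : e.1.1.card < r := he
    have h1 := e.card_toDualEdge
    have : x e.toDualEdge = y e.toDualEdge := hxy (show r ≤ e.toDualEdge.1.1.card by omega)
    rw [this]

variable {Ω : ℕ → Type*} [∀ n, MeasurableSpace (Ω n)] {P : ∀ n, Measure (Ω n)}
  [∀ n, IsProbabilityMeasure (P n)]
  {Ω' : Type*} [MeasurableSpace Ω'] {P' : Measure Ω'} [IsProbabilityMeasure P']
  {η η' : List ℕ → ℕ → Ω' → ℝ}

/-- The two unrestricted path sums converge jointly, so their product converges by continuity; the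
pair sum differs from it by a quantity vanishing in L¹. -/
lemma tendstoInDistribution_pathPairSum_of_measurable {ζ : ∀ n, Edge n → Ω n → ℝ}
    (hm : ∀ n e, Measurable (ζ n e)) (h0 : ∀ n e ω, 0 ≤ ζ n e ω)
    (hlaw : ∀ n e, HasLaw (ζ n e) (expMeasure 1) (P n)) (hind : ∀ n, iIndepFun (ζ n) (P n))
    (hη : ∀ p, IsPoissonPointProcess (η p) (volume.restrict (Set.Ici (0 : ℝ))) P')
    (hη' : ∀ p, IsPoissonPointProcess (η' p) (volume.restrict (Set.Ici (0 : ℝ))) P')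
    (hηη' : iIndepFun
      (fun (q : List ℕ ⊕ List ℕ) (ω : Ω') (i : ℕ) => Sum.elim η η' q i ω) P') (r : ℕ) :
    TendstoInDistribution (fun (n : ℕ) (ω : Ω n) => pathPairSum r n (fun e => ζ n e ω)) atTop
      (fun ω : Ω' => cascadeSum η r ω * cascadeSum η' r ω) P P' := by
  classical
  have ha : ∀ n, IsEdgeWeights (fun e ω => Real.exp (-(n * ζ n e.toEdge ω))) (P n) := fun n =>
    isEdgeWeights_exp_neg (ζ := fun e => ζ n e.toEdge) (fun e => hm n _) (fun e => h0 n _)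
      (fun e => hlaw n _) ((hind n).precomp UpEdge.toEdge_injective)
  have ha' : ∀ n, IsEdgeWeights (fun e ω => Real.exp (-(n * ζ n e.toDualEdge ω))) (P n) := fun n =>
    isEdgeWeights_exp_neg (ζ := fun e => ζ n e.toDualEdge) (fun e => hm n _) (fun e => h0 n _)
      (fun e => hlaw n _) ((hind n).precomp UpEdge.toDualEdge_injective)
  have hI : ∀ n, 2 * r ≤ n → _ := fun n hn =>
    indepFun_randomPathWeight_dual (r := r) (hm n) (hind n) hn
  have hX := IsEdgeWeights.tendstoInDistribution_sum_pathWeight ha hη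
    (hηη'.precomp Sum.inl_injective) r
  have hY := IsEdgeWeights.tendstoInDistribution_sum_pathWeight ha' hη'
    (hηη'.precomp Sum.inr_injective) r
  have hXY := tendstoInDistribution_prodMk_of_indepFun hX hY
    ((eventually_ge_atTop (2 * r)).mono fun n hn =>
      (hI n hn).comp (φ := fun x : Finset (Fin n) → ℝ => ∑ v, x v)
        (ψ := fun x : Finset (Fin n) → ℝ => ∑ v, x v) (by fun_prop) (by fun_prop))
    (indepFun_cascadeSum (fun p => (hη p).measurable) (fun p => (hη' p).measurable) hηη' r)
  have hmul := hXY.continuous_comp (g := fun p : ℝ × ℝ => p.1 * p.2) (by fun_prop)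
  have hint := fun n => (ha n).integrable_sum_disjoint_sub (r := r) (ha' n)
  have heq : ∀ n ω, pathPairSum r n (fun e => ζ n e ω) = ∑ v, ∑ w, if Disjoint v w then
      randomPathWeight (fun (e : UpEdge n) ω => Real.exp (-(n * ζ n e.toEdge ω))) r v ω *
      randomPathWeight (fun (e : UpEdge n) ω => Real.exp (-(n * ζ n e.toDualEdge ω))) r w ω
      else 0 := fun n ω => by
    rw [pathPairSum_eq]
  refine tendstoInDistribution_of_tendsto_integral_abs_sub hmul (fun n => ?_) (fun n => ?_) ?_
  · simp_rw [heq]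
    refine (Finset.measurable_sum _ fun v _ => Finset.measurable_sum _ fun w _ => ?_).aemeasurable
    split_ifs
    exacts [((ha n).measurable_pathWeight r v).mul ((ha' n).measurable_pathWeight r w),
      measurable_const]
  · simp_rw [heq]
    exact hint n
  · refine squeeze_zero' (g := fun n : ℕ => (r : ℝ) ^ 2 / n)
      (Eventually.of_forall fun n => integral_nonneg fun ω => abs_nonneg _) ?_
      (tendsto_const_div_atTop_nhds_zero_nat _)
    filter_upwards [eventually_ge_atTop (2 * r)] with n hn
    simp_rw [heq]
    exact (ha n).integral_abs_sum_disjoint_sub_le (ha' n) (hI n hn)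

/-- The law gives measurability and nonnegativity of the weights only almost everywhere; the
absolute value of a measurable version has both everywhere. -/
lemma tendstoInDistribution_pathPairSum {ξ : ∀ n, Edge n → Ω n → ℝ}
    (hlaw : ∀ n e, HasLaw (ξ n e) (expMeasure 1) (P n)) (hind : ∀ n, iIndepFun (ξ n) (P n))
    (hη : ∀ p, IsPoissonPointProcess (η p) (volume.restrict (Set.Ici (0 : ℝ))) P')
    (hη' : ∀ p, IsPoissonPointProcess (η' p) (volume.restrict (Set.Ici (0 : ℝ))) P')
    (hηη' : iIndepFun
      (fun (q : List ℕ ⊕ List ℕ) (ω : Ω') (i : ℕ) => Sum.elim η η' q i ω) P') (r : ℕ) :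
    TendstoInDistribution (fun (n : ℕ) (ω : Ω n) => pathPairSum r n (fun e => ξ n e ω)) atTop
      (fun ω : Ω' => cascadeSum η r ω * cascadeSum η' r ω) P P' := by
  set ζ : ∀ n, Edge n → Ω n → ℝ := fun n e ω => |(hlaw n e).aemeasurable.mk (ξ n e) ω| with hζ
  have heq : ∀ n e, ξ n e =ᵐ[P n] ζ n e := fun n e => by
    have h1 : ∀ᵐ ω ∂P n, 0 ≤ ξ n e ω := by
      refine ae_of_ae_map (p := fun x => 0 ≤ x) (hlaw n e).aemeasurable ?_
      rw [(hlaw n e).map_eq]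
      exact ae_nonneg_expMeasure_one
    filter_upwards [h1, (hlaw n e).aemeasurable.ae_eq_mk] with ω h h'
    rw [hζ]
    dsimp only
    rw [← h', abs_of_nonneg h]
  have hm : ∀ n e, Measurable (ζ n e) := fun n e => by
    have := (hlaw n e).aemeasurable.measurable_mk
    exact continuous_abs.measurable.comp this
  have main := tendstoInDistribution_pathPairSum_of_measurable hm (fun n e ω => abs_nonneg _)
    (fun n e => (hlaw n e).congr (heq n e).symm) (fun n => (iIndepFun_congr (heq n)).1 (hind n))
    hη hη' hηη' r
  refine main.congr (fun n => ?_) (ae_eq_refl _)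
  filter_upwards [eventually_all.2 (heq n)] with ω hω
  simp_rw [hω]

end PathPairSum

theorem proposition3
    -- for every `n`, independent standard exponential weights on the edges of the `n`-cube
    {Ω : ℕ → Type*} [∀ n, MeasurableSpace (Ω n)]
    (P : ∀ n, Measure (Ω n)) [∀ n, IsProbabilityMeasure (P n)]
    (ξ : ∀ n, Edge n → Ω n → ℝ)
    (hξ_law : ∀ n e, HasLaw (ξ n e) (expMeasure 1) (P n))
    (hξ_indep : ∀ n, iIndepFun (ξ n) (P n))
    -- two families of Poisson point processes, indexed by finite words, all of them independent
    {Ω' : Type*} [MeasurableSpace Ω'] (P' : Measure Ω') [IsProbabilityMeasure P']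
    (η η' : List ℕ → ℕ → Ω' → ℝ)
    (hη : ∀ p, IsPoissonPointProcess (η p) (volume.restrict (Set.Ici (0 : ℝ))) P')
    (hη' : ∀ p, IsPoissonPointProcess (η' p) (volume.restrict (Set.Ici (0 : ℝ))) P')
    (hηη'_indep : iIndepFun
      (fun (q : List ℕ ⊕ List ℕ) (ω : Ω') (i : ℕ) => Sum.elim η η' q i ω) P') :
    -- the series defining the two cascade sums converge almost surely
    (∀ r : ℕ, ∀ᵐ ω ∂P', Summable (cascadeTerm η r ω) ∧ Summable (cascadeTerm η' r ω)) ∧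
    -- `n`-convergence, for fixed `r`
    (∀ r : ℕ, TendstoInDistribution
      (fun (n : ℕ) (ω : Ω n) => pathPairSum r n (fun e => ξ n e ω)) atTop
      (fun ω : Ω' => cascadeSum η r ω * cascadeSum η' r ω) P P') ∧
    -- `r`-convergence, jointly, to a pair of independent standard exponentials
    TendstoInDistribution
      (fun (r : ℕ) (ω : Ω') => (cascadeSum η r ω, cascadeSum η' r ω)) atTop
      (id : ℝ × ℝ → ℝ × ℝ) (fun _ => P') ((expMeasure 1).prod (expMeasure 1)) :=
  ⟨fun r => (ae_summable_cascadeTerm hη (hηη'_indep.precomp Sum.inl_injective) r).and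
      (ae_summable_cascadeTerm hη' (hηη'_indep.precomp Sum.inr_injective) r),
    tendstoInDistribution_pathPairSum hξ_law hξ_indep hη hη' hηη'_indep,
    tendstoInDistribution_cascadeSum_prod hη hη' hηη'_indep⟩
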